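/- Let $k$ be a field. **Conventions.** A dualizing object of a monoidal category $\mathcal C$ is an object $K$ such that every functor $\operatorname{Hom}(-\otimes Y,K)$ is representable by an object $DY$ and the induced functor $D\colon\mathcal C^{\mathrm{op}}\to\mathcal C$ is an equivalence; $\mathcal C$ is an *r-category* if its monoidal unit is dualizing. $\mathcal C$ is *closed* if all functors $X\otimes-$ and $-\otimes X$ have right adjoints (the internal homs), and a lax monoidal functor $F$ between closed monoidal categories is *closed* if both canonical comparison morphisms $F(X\multimap Y)\to F(X)\multimap F(Y)$ and their right-handed analogues are invertible. A *bimonad* is a monad $T$ on a monoidal category with an opmonoidal structure for which multiplication $\mu$ and unit are opmonoidal; it is *Hopf* if both fusion operators $T(TX\otimes Y)\to TX\otimes TY$ and $T(X\otimes TY)\to TX\otimes TY$ (comultiplication followed by $\mu$) are invertible. Modules over a bimonad form a monoidal category for which the forgetful functor is strict monoidal; its unit is the unit object with the action given by the counit. For a $k$-algebra $R$, an *$R$-Hopf algebroid* $B$ is a $k$-linear Hopf bimonad, admitting a right adjoint, on the monoidal category $({}_R\mathrm{Mod}_R,\otimes_R,R)$ of $R$-bimodules; for commutative $R$, an *$R$-Hopf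 algebroid with commutative base* is a $k$-linear Hopf bimonad, admitting a right adjoint, on $({}_R\mathrm{Mod},\otimes_R,R)$. $B\text{-mod}^{\mathrm{fd}}$ is the full monoidal subcategory of $B$-modules that are finite-dimensional over $k$. A finite-dimensional $k$-algebra $R$ is *symmetric Frobenius* if there is a linear form $\lambda\colon R\to k$ with $\lambda(xy)=\lambda(yx)$ whose bilinear form $(x,y)\mapsto\lambda(xy)$ is nondegenerate; it is *commutative Frobenius* if moreover $R$ is commutative. **Statement.** 1. Let $B$ be an $R$-Hopf algebroid over a symmetric Frobenius $k$-algebra $R$. Then $B\text{-mod}^{\mathrm{fd}}$ is an r-category: its unit, the regular bimodule $R$ with the canonical $B$-module structure, is dualizing. The strict monoidal forgetful functor $B\text{-mod}^{\mathrm{fd}}\to{}_R\mathrm{Mod}_R^{\mathrm{fd}}$ is closed. 2. Let $B$ be an $R$-Hopf algebroid with commutative base over a commutative Frobenius $k$-algebra $R$. Then $B\text{-mod}^{\mathrm{fd}}$ is an r-category: its unit, the regular module $R$ with the canonical $B$-module structure, is dualizing. The strict monoidal forgetful functor $B\text{-mod}^{\mathrm{fd}}\to{}_R\mathrm{Mod}^{\mathrm{fd}}$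 is closed. 3. Let $L$ be a Lie–Rinehart algebra over a commutative Frobenius $k$-algebra $R$, with universal enveloping algebra $\mathscr U_R(L)$. The category of finite-dimensional $\mathscr U_R(L)$-modules, with tensor product $M\otimes_R N$ on which $x\in L$ acts by $x(m\otimes n)=xm\otimes n+m\otimes xn$ (that is, through $\Delta(\iota_L(x))=1\otimes\iota_L(x)+\iota_L(x)\otimes 1$) and with unit $R$ on which $L$ acts by derivations through the anchor, is an r-category, and the forgetful functor to finite-dimensional $R$-modules is closed. 4. Let $k$ have characteristic $p>0$, let $n\ge 0$ and $R=k[x_1,\dots,x_n]/(x_1^p,\dots,x_n^p)$. Extracting the coefficient of $x_1^{p-1}\cdots x_n^{p-1}$ is a Frobenius form on $R$. There are derivations $\partial_i$ of $R$ with $\partial_i(x_j)=\delta_{ij}$, and the truncated modular Weyl algebra $A_n^{(p)}$, generated over $k$ by $x_i,\partial_i$ $(1\le i\le n)$ with relations $x_i^p=0$, $x_ix_j=x_jx_i$, $\partial_i\partial_j=\partial_j\partial_i$, $\partial_ix_j-x_j\partial_i=\delta_{ij}$, is isomorphic to $\mathscr U_R(\operatorname{Der}_k(R))$ by $x_i\mapsto\iota_R(x_i)$,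 $\partial_i\mapsto\iota_L(\partial_i)$. Its finite-dimensional modules, with the monoidal structure of 3., form an r-category, and the forgetful functor to finite-dimensional $R$-modules is closed. -/

import Mathlib

set_option linter.unusedSectionVars false

universe v u v₁ u₁ v₂ u₂

namespace HopfGV

open CategoryTheory MonoidalCategory Opposite
open scoped TensorProduct

section Closed

variable {C : Type u₁} [Category.{v₁} C] [MonoidalCategory C]
variable {D : Type u₂} [Category.{v₂} D] [MonoidalCategory D]

/-- `K` is a dualizing object: each functor `Hom(- ⊗ Y, K)` is represented by an object `D Y`,
and the induced contravariant functor `D` (functorial through the naturality of the representing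
bijections in `Y`) is an antiequivalence. -/
def IsDualizing (K : C) : Prop :=
  ∃ (D : Cᵒᵖ ⥤ C) (e : ∀ X Y : C, (X ⊗ Y ⟶ K) ≃ (X ⟶ D.obj (op Y))),
    (∀ (X' X Y : C) (f : X' ⟶ X) (g : X ⊗ Y ⟶ K), e X' Y (f ▷ Y ≫ g) = f ≫ e X Y g) ∧
    (∀ (X Y' Y : C) (f : Y' ⟶ Y) (g : X ⊗ Y ⟶ K),
      e X Y' (X ◁ f ≫ g) = e X Y g ≫ D.map f.op) ∧
    D.IsEquivalence

variable (C) in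
/-- An r-category: the monoidal unit is a dualizing object. -/
def IsRCategory : Prop := IsDualizing (𝟙_ C)

/-- The left internal hom `X ⊸ Y`, given by a right adjoint of `X ⊗ -`. -/
noncomputable def leftHom (X : C) [(tensorLeft X).IsLeftAdjoint] (Y : C) : C :=
  (tensorLeft X).rightAdjoint.obj Y

/-- The evaluation `X ⊗ (X ⊸ Y) ⟶ Y`. -/
noncomputable def leftEv (X : C) [(tensorLeft X).IsLeftAdjoint] (Y : C) :
    X ⊗ leftHom X Y ⟶ Y :=
  (Adjunction.ofIsLeftAdjoint (tensorLeft X)).counit.app Y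

/-- The adjunct `Z ⟶ X ⊸ Y` of a morphism `X ⊗ Z ⟶ Y`. -/
noncomputable def leftCurry {X : C} [(tensorLeft X).IsLeftAdjoint] {Z Y : C} (f : X ⊗ Z ⟶ Y) :
    Z ⟶ leftHom X Y :=
  (Adjunction.ofIsLeftAdjoint (tensorLeft X)).homEquiv Z Y f

/-- The right internal hom `Y ⟜ X`, given by a right adjoint of `- ⊗ X`. -/
noncomputable def rightHom (Y X : C) [(tensorRight X).IsLeftAdjoint] : C :=
  (tensorRight X).rightAdjoint.obj Y

/-- The evaluation `(Y ⟜ X) ⊗ X ⟶ Y`. -/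
noncomputable def rightEv (Y X : C) [(tensorRight X).IsLeftAdjoint] :
    rightHom Y X ⊗ X ⟶ Y :=
  (Adjunction.ofIsLeftAdjoint (tensorRight X)).counit.app Y

/-- The adjunct `Z ⟶ Y ⟜ X` of a morphism `Z ⊗ X ⟶ Y`. -/
noncomputable def rightCurry {X : C} [(tensorRight X).IsLeftAdjoint] {Z Y : C}
    (f : Z ⊗ X ⟶ Y) : Z ⟶ rightHom Y X :=
  (Adjunction.ofIsLeftAdjoint (tensorRight X)).homEquiv Z Y f

open Functor.LaxMonoidal in
/-- The left internal hom comparator `F (X ⊸ Y) ⟶ F X ⊸ F Y` of a lax monoidal functor. -/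
noncomputable def leftComparator (F : C ⥤ D) [F.LaxMonoidal] (X Y : C)
    [(tensorLeft X).IsLeftAdjoint] [(tensorLeft (F.obj X)).IsLeftAdjoint] :
    F.obj (leftHom X Y) ⟶ leftHom (F.obj X) (F.obj Y) :=
  leftCurry (μ F X (leftHom X Y) ≫ F.map (leftEv X Y))

open Functor.LaxMonoidal in
/-- The right internal hom comparator `F (Y ⟜ X) ⟶ F Y ⟜ F X` of a lax monoidal functor. -/
noncomputable def rightComparator (F : C ⥤ D) [F.LaxMonoidal] (Y X : C)
    [(tensorRight X).IsLeftAdjoint] [(tensorRight (F.obj X)).IsLeftAdjoint] :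
    F.obj (rightHom Y X) ⟶ rightHom (F.obj Y) (F.obj X) :=
  rightCurry (μ F (rightHom Y X) X ≫ F.map (rightEv Y X))

variable (C) in
/-- Left and right closed monoidal categories. -/
class IsClosedMonoidal : Prop where
  left (X : C) : (tensorLeft X).IsLeftAdjoint
  right (X : C) : (tensorRight X).IsLeftAdjoint

attribute [instance] IsClosedMonoidal.left IsClosedMonoidal.right

/-- A closed lax monoidal functor between closed monoidal categories: both internal hom
comparators are invertible. -/
structure IsClosedFunctor (F : C ⥤ D) [F.LaxMonoidal] : Prop where
  [closed_source : IsClosedMonoidal C]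
  [closed_target : IsClosedMonoidal D]
  isIso_left (X Y : C) : IsIso (leftComparator F X Y)
  isIso_right (Y X : C) : IsIso (rightComparator F Y X)

end Closed

section Bimonad

variable {C : Type u₁} [Category.{v₁} C] [MonoidalCategory C]

open Functor.OplaxMonoidal in
/-- A bimonad structure on a monad `T`: an opmonoidal structure on the functor `T` for which the
multiplication and the unit of `T` are opmonoidal natural transformations. -/
class Bimonad (T : Monad C) where
  [oplax : T.toFunctor.OplaxMonoidal]
  mu_comul (X Y : C) : T.μ.app (X ⊗ Y) ≫ δ T.toFunctor X Y =
    T.map (δ T.toFunctor X Y) ≫ δ T.toFunctor (T.obj X) (T.obj Y) ≫ (T.μ.app X ⊗ₘ T.μ.app Y)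
  mu_counit : T.μ.app (𝟙_ C) ≫ η T.toFunctor = T.map (η T.toFunctor) ≫ η T.toFunctor
  unit_comul (X Y : C) : T.η.app (X ⊗ Y) ≫ δ T.toFunctor X Y = T.η.app X ⊗ₘ T.η.app Y
  unit_counit : T.η.app (𝟙_ C) ≫ η T.toFunctor = 𝟙 (𝟙_ C)

attribute [reducible, instance] Bimonad.oplax

open Functor.OplaxMonoidal

section
variable (T : Monad C) [Bimonad T]

/-- The left fusion operator of a bimonad. -/
def leftFusion (X Y : C) : T.obj (T.obj X ⊗ Y) ⟶ T.obj X ⊗ T.obj Y :=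
  δ T.toFunctor (T.obj X) Y ≫ T.μ.app X ▷ T.obj Y

/-- The right fusion operator of a bimonad: the left fusion operator for the reversed tensor
product. -/
def rightFusion (X Y : C) : T.obj (X ⊗ T.obj Y) ⟶ T.obj X ⊗ T.obj Y :=
  δ T.toFunctor X (T.obj Y) ≫ T.obj X ◁ T.μ.app Y

/-- A Hopf monad: both fusion operators are invertible. -/
structure IsHopfMonad : Prop where
  left (X Y : C) : IsIso (leftFusion T X Y)
  right (X Y : C) : IsIso (rightFusion T X Y)
end

variable {T : Monad C} [Bimonad T]

/-- The tensor product of two modules over a bimonad. -/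
@[simps]
def tensorAlgebra (M N : T.Algebra) : T.Algebra where
  A := M.A ⊗ N.A
  a := δ T.toFunctor M.A N.A ≫ (M.a ⊗ₘ N.a)
  unit := by
    rw [← Category.assoc, Bimonad.unit_comul, tensorHom_comp_tensorHom, M.unit, N.unit]
    exact id_tensorHom_id _ _
  assoc := by
    rw [← Category.assoc, Bimonad.mu_comul]
    simp only [Category.assoc, tensorHom_comp_tensorHom, M.assoc, N.assoc, Functor.map_comp]
    rw [← δ_natural_assoc, tensorHom_comp_tensorHom]

variable (T) in
/-- The unit object with the canonical action of a bimonad, given by the counit. -/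
@[simps]
def unitAlgebra : T.Algebra where
  A := 𝟙_ C
  a := η T.toFunctor
  unit := Bimonad.unit_counit
  assoc := Bimonad.mu_counit

lemma tensorAlgebra_map {M M' N N' : T.Algebra} (f : M ⟶ M') (g : N ⟶ N') :
    T.map (f.f ⊗ₘ g.f) ≫ δ T.toFunctor M'.A N'.A ≫ (M'.a ⊗ₘ N'.a) =
      (δ T.toFunctor M.A N.A ≫ (M.a ⊗ₘ N.a)) ≫ (f.f ⊗ₘ g.f) := by
  rw [← δ_natural_assoc, tensorHom_comp_tensorHom, Category.assoc, tensorHom_comp_tensorHom,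
    f.h, g.h]

lemma tensorAlgebra_assoc (L M N : T.Algebra) :
    T.map (α_ L.A M.A N.A).hom ≫ δ T.toFunctor L.A (M.A ⊗ N.A) ≫
        (L.a ⊗ₘ (δ T.toFunctor M.A N.A ≫ (M.a ⊗ₘ N.a))) =
      (δ T.toFunctor (L.A ⊗ M.A) N.A ≫
        ((δ T.toFunctor L.A M.A ≫ (L.a ⊗ₘ M.a)) ⊗ₘ N.a)) ≫ (α_ L.A M.A N.A).hom := by
  have h₁ : (L.a ⊗ₘ (δ T.toFunctor M.A N.A ≫ (M.a ⊗ₘ N.a))) =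
      (T.obj L.A ◁ δ T.toFunctor M.A N.A) ≫ (L.a ⊗ₘ (M.a ⊗ₘ N.a)) := by
    rw [← id_tensorHom, tensorHom_comp_tensorHom, Category.id_comp]
  have h₂ : ((δ T.toFunctor L.A M.A ≫ (L.a ⊗ₘ M.a)) ⊗ₘ N.a) =
      (δ T.toFunctor L.A M.A ▷ T.obj N.A) ≫ ((L.a ⊗ₘ M.a) ⊗ₘ N.a) := by
    rw [← tensorHom_id, tensorHom_comp_tensorHom, Category.id_comp]
  rw [h₁, h₂, Category.assoc, Category.assoc, associator_naturality]
  exact (associativity_assoc T.toFunctor L.A M.A N.A _).symm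

lemma tensorAlgebra_leftUnit (M : T.Algebra) :
    T.map (λ_ M.A).hom ≫ M.a =
      (δ T.toFunctor (𝟙_ C) M.A ≫ (η T.toFunctor ⊗ₘ M.a)) ≫ (λ_ M.A).hom := by
  have h : (η T.toFunctor ⊗ₘ M.a) = (η T.toFunctor ▷ T.obj M.A) ≫ (𝟙_ C ◁ M.a) := by
    rw [← tensorHom_id, ← id_tensorHom, tensorHom_comp_tensorHom, Category.id_comp,
      Category.comp_id]
  rw [h, Category.assoc, Category.assoc, leftUnitor_naturality,
    left_unitality_hom_assoc T.toFunctor M.A]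

lemma tensorAlgebra_rightUnit (M : T.Algebra) :
    T.map (ρ_ M.A).hom ≫ M.a =
      (δ T.toFunctor M.A (𝟙_ C) ≫ (M.a ⊗ₘ η T.toFunctor)) ≫ (ρ_ M.A).hom := by
  have h : (M.a ⊗ₘ η T.toFunctor) = (T.obj M.A ◁ η T.toFunctor) ≫ (M.a ▷ 𝟙_ C) := by
    rw [← tensorHom_id, ← id_tensorHom, tensorHom_comp_tensorHom, Category.id_comp,
      Category.comp_id]
  rw [h, Category.assoc, Category.assoc, rightUnitor_naturality,
    right_unitality_hom_assoc T.toFunctor M.A]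

instance : MonoidalCategoryStruct T.Algebra where
  tensorObj := tensorAlgebra
  whiskerLeft M N N' f :=
    { f := M.A ◁ f.f
      h := by
        have := tensorAlgebra_map (𝟙 M) f
        rw [Monad.Algebra.id_f, id_tensorHom] at this
        exact this }
  whiskerRight f N :=
    { f := f.f ▷ N.A
      h := by
        have := tensorAlgebra_map f (𝟙 N)
        rw [Monad.Algebra.id_f, tensorHom_id] at this
        exact this }
  tensorHom f g := { f := f.f ⊗ₘ g.f, h := tensorAlgebra_map f g }
  tensorUnit := unitAlgebra T
  associator L M N := Monad.Algebra.isoMk (α_ L.A M.A N.A) (tensorAlgebra_assoc L M N)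
  leftUnitor M := Monad.Algebra.isoMk (λ_ M.A) (tensorAlgebra_leftUnit M)
  rightUnitor M := Monad.Algebra.isoMk (ρ_ M.A) (tensorAlgebra_rightUnit M)

@[simp] lemma forget_obj_tensor (M N : T.Algebra) :
    T.forget.obj (M ⊗ N) = T.forget.obj M ⊗ T.forget.obj N := rfl

variable (T) in
def forgetInducing : Monoidal.InducingFunctorData T.forget where
  μIso M N := Iso.refl (M.A ⊗ N.A)
  εIso := Iso.refl (𝟙_ C)
  whiskerLeft_eq M _ _ f := by
    change M.A ◁ f.f = 𝟙 _ ≫ M.A ◁ f.f ≫ 𝟙 _; simp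
  whiskerRight_eq f N := by
    change f.f ▷ N.A = 𝟙 _ ≫ f.f ▷ N.A ≫ 𝟙 _; simp
  tensorHom_eq f g := by
    change (f.f ⊗ₘ g.f) = 𝟙 _ ≫ (f.f ⊗ₘ g.f) ≫ 𝟙 _; simp
  associator_eq L M N := by
    change (α_ L.A M.A N.A).hom = (𝟙 _ ≫ (𝟙 _ ⊗ₘ 𝟙 _)) ≫ (α_ L.A M.A N.A).hom ≫
      ((𝟙 _ ⊗ₘ 𝟙 _) ≫ 𝟙 _)
    simp
  leftUnitor_eq M := by
    change (λ_ M.A).hom = (𝟙 _ ≫ (𝟙 _ ⊗ₘ 𝟙 _)) ≫ (λ_ M.A).hom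
    simp
  rightUnitor_eq M := by
    change (ρ_ M.A).hom = (𝟙 _ ≫ (𝟙 _ ⊗ₘ 𝟙 _)) ≫ (ρ_ M.A).hom
    simp

/-- The monoidal category of modules over a bimonad. -/
instance : MonoidalCategory T.Algebra :=
  Monoidal.induced T.forget (forgetInducing T)

/-- The forgetful functor is strict monoidal: its structure isomorphisms are identities. -/
instance : T.forget.Monoidal :=
  Monoidal.fromInducedMonoidal T.forget (forgetInducing T)

end Bimonad

section Property
variable {C : Type u₁} [Category.{v₁} C] [MonoidalCategory C]
variable {D : Type u₂} [Category.{v₂} D] [MonoidalCategory D]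
variable (F : C ⥤ D) [F.Monoidal] (P : ObjectProperty D) [P.IsMonoidal]
  [P.IsClosedUnderIsomorphisms]

open Functor.Monoidal

instance : (P.inverseImage F).IsMonoidal where
  prop_unit := P.prop_of_iso (εIso F) P.prop_unit
  prop_tensor X Y hX hY := P.prop_of_iso (μIso F X Y) (ObjectProperty.prop_tensor hX hY)

/-- The restriction of a functor `F : C ⥤ D` to the objects of `D` satisfying `P` and the objects
of `C` which `F` sends to such objects. -/
def restrictedFunctor : (P.inverseImage F).FullSubcategory ⥤ P.FullSubcategory :=
  P.lift ((P.inverseImage F).ι ⋙ F) (fun X => X.property)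


lemma restrictedFunctor_map_hom {X Y : (P.inverseImage F).FullSubcategory} (f : X ⟶ Y) :
    ((restrictedFunctor F P).map f).hom = F.map f.hom := rfl

instance : (restrictedFunctor F P).Monoidal :=
  Functor.CoreMonoidal.toMonoidal
    { εIso := P.isoMk (εIso F)
      μIso := fun X Y ↦ P.isoMk (μIso F X.obj Y.obj)
      μIso_hom_natural_left := fun f X' => by
        ext; exact Functor.LaxMonoidal.μ_natural_left F f.hom X'.obj
      μIso_hom_natural_right := fun X' f => by
        ext; exact Functor.LaxMonoidal.μ_natural_right F X'.obj f.hom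
      associativity := fun X Y Z => by
        ext; exact Functor.LaxMonoidal.associativity F X.obj Y.obj Z.obj
      left_unitality := fun X => by
        ext; exact Functor.LaxMonoidal.left_unitality F X.obj
      right_unitality := fun X => by
        ext; exact Functor.LaxMonoidal.right_unitality F X.obj }

end Property
section RB
variable (k R : Type u) [Field k] [Ring R] [Algebra k R]

/-- The `k`-algebra `R` as an algebra in the monoidal category of `k`-vector spaces. -/
noncomputable abbrev algMon : Mon (ModuleCat.{u} k) :=
  ModuleCat.monModuleEquivalenceAlgebra.inverse.obj (AlgCat.of k R)

/-- The category of `R`-bimodules (over the field `k`). -/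
abbrev RBimod : Type (u + 1) := Bimod (algMon k R) (algMon k R)

/-- The monoidal category of `R`-bimodules, with tensor product over `R` and unit `R`. -/
noncomputable instance : MonoidalCategory (RBimod k R) :=
  let _ : Bicategory (Mon (ModuleCat.{u} k)) := Bimod.monBicategory
  let M : MonoidalCategory (EndMonoidal (algMon k R)) := inferInstance
  { tensorObj := fun M N => M.tensorBimod N
    whiskerLeft := fun M _ _ f => Bimod.whiskerLeft M f
    whiskerRight := fun f N => Bimod.whiskerRight f N
    tensorHom := fun f g => Bimod.whiskerRight f _ ≫ Bimod.whiskerLeft _ g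
    tensorUnit := Bimod.regular (algMon k R)
    associator := Bimod.associatorBimod
    leftUnitor := Bimod.leftUnitorBimod
    rightUnitor := Bimod.rightUnitorBimod
    tensorHom_def := M.tensorHom_def
    id_tensorHom_id := M.id_tensorHom_id
    tensorHom_comp_tensorHom := M.tensorHom_comp_tensorHom
    whiskerLeft_id := M.whiskerLeft_id
    id_whiskerRight := M.id_whiskerRight
    associator_naturality := M.associator_naturality
    leftUnitor_naturality := M.leftUnitor_naturality
    rightUnitor_naturality := M.rightUnitor_naturality
    pentagon := M.pentagon
    triangle := M.triangle }

/-- The `R`-bimodules that are finite-dimensional over `k`. -/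
def fdBimod : ObjectProperty (RBimod k R) := fun M => FiniteDimensional k M.X

open Limits in
instance [FiniteDimensional k R] : (fdBimod k R).IsMonoidal where
  prop_unit := (inferInstance : FiniteDimensional k R)
  prop_tensor M N hM hN := by
    have : FiniteDimensional k M.X := hM
    have : FiniteDimensional k N.X := hN
    have : FiniteDimensional k (M.X ⊗ N.X : ModuleCat k) :=
      (inferInstance : Module.Finite k (TensorProduct k M.X N.X))
    let f : (M.X ⊗ N.X : ModuleCat k) ⟶ (M.tensorBimod N).X :=
      coequalizer.π (M.actRight ▷ N.X) ((α_ M.X _ N.X).hom ≫ M.X ◁ N.actLeft)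
    have hf : Epi f := coequalizer.π_epi
    exact Module.Finite.of_surjective f.hom ((ModuleCat.epi_iff_surjective f).1 hf)

instance : (fdBimod k R).IsClosedUnderIsomorphisms where
  of_iso {M N} e hM := by
    have : FiniteDimensional k ((Bimod.forget (algMon k R) (B := algMon k R)).obj M) := hM
    exact Module.Finite.equiv ((Bimod.forget _).mapIso e).toLinearEquiv

end RB

section CommBase
variable (k R : Type u) [Field k] [CommRing R] [Algebra k R]

/-- The left `R`-modules that are finite-dimensional over `k`. -/
def fdModule : ObjectProperty (ModuleCat.{u} R) := fun M =>
  FiniteDimensional k ((ModuleCat.restrictScalars (algebraMap k R)).obj M)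

lemma fdModule_iff [FiniteDimensional k R] (M : ModuleCat.{u} R) :
    fdModule k R M ↔ Module.Finite R M := by
  let M₀ := (ModuleCat.restrictScalars (algebraMap k R)).obj M
  let _ : Module R M₀ := inferInstanceAs (Module R M)
  have : IsScalarTower k R M₀ := IsScalarTower.of_algebraMap_smul fun _ _ => rfl
  change Module.Finite k M₀ ↔ Module.Finite R M₀
  exact ⟨fun _ => Module.Finite.of_restrictScalars_finite k R M₀, fun _ => Module.Finite.trans R M₀⟩

instance [FiniteDimensional k R] : (fdModule k R).IsMonoidal where
  prop_unit := (fdModule_iff k R _).2 (inferInstanceAs (Module.Finite R R))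
  prop_tensor M N hM hN := by
    rw [fdModule_iff] at hM hN ⊢
    exact inferInstanceAs (Module.Finite R (M ⊗[R] N))

instance : (fdModule k R).IsClosedUnderIsomorphisms where
  of_iso {M N} e hM := by
    have : FiniteDimensional k ((ModuleCat.restrictScalars (algebraMap k R)).obj M) := hM
    exact Module.Finite.equiv
      ((ModuleCat.restrictScalars (algebraMap k R)).mapIso e).toLinearEquiv

end CommBase

section Algebroid
variable (k R : Type u) [Field k]

/-- An `R`-Hopf algebroid over a `k`-algebra `R`: a `k`-linear bimonad on the monoidal category of
`R`-bimodules which admits a right adjoint and is both left and right Hopf. -/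
structure HopfAlgebroid [Ring R] [Algebra k R] where
  monad : Monad (RBimod k R)
  [bimonad : Bimonad monad]
  map_add {M N : RBimod k R} (f g h : M ⟶ N) : h.hom = f.hom + g.hom →
    (monad.map h).hom = (monad.map f).hom + (monad.map g).hom
  map_smul {M N : RBimod k R} (c : k) (f h : M ⟶ N) : h.hom = c • f.hom →
    (monad.map h).hom = c • (monad.map f).hom
  isLeftAdjoint : monad.toFunctor.IsLeftAdjoint
  isHopf : IsHopfMonad monad

attribute [instance] HopfAlgebroid.bimonad

/-- An `R`-Hopf algebroid over a commutative `k`-algebra `R`, in the sense of commutative bases: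
a `k`-linear bimonad on the monoidal category of left `R`-modules which admits a right adjoint and
is both left and right Hopf. -/
structure CommHopfAlgebroid [CommRing R] [Algebra k R] where
  monad : Monad (ModuleCat.{u} R)
  [bimonad : Bimonad monad]
  map_add {M N : ModuleCat.{u} R} (f g : M ⟶ N) : monad.map (f + g) = monad.map f + monad.map g
  map_smul {M N : ModuleCat.{u} R} (c : k) (f : M ⟶ N) :
    monad.map (algebraMap k R c • f) = algebraMap k R c • monad.map f
  isLeftAdjoint : monad.toFunctor.IsLeftAdjoint
  isHopf : IsHopfMonad monad

attribute [instance] CommHopfAlgebroid.bimonad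

/-- Finite-dimensional modules over a Hopf algebroid `B`: the modules over the monad whose
underlying bimodule is finite-dimensional. Its monoidal unit is the regular bimodule `R` with the
canonical action, the counit of `B`. -/
abbrev HopfAlgebroid.FDMod {k R : Type u} [Field k] [Ring R] [Algebra k R]
    (B : HopfAlgebroid k R) : Type (u + 1) :=
  ((fdBimod k R).inverseImage B.monad.forget).FullSubcategory

/-- The forgetful functor from finite-dimensional `B`-modules to finite-dimensional
`R`-bimodules. -/
noncomputable abbrev HopfAlgebroid.fdForget {k R : Type u} [Field k] [Ring R] [Algebra k R]
    (B : HopfAlgebroid k R) : B.FDMod ⥤ (fdBimod k R).FullSubcategory :=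
  restrictedFunctor B.monad.forget (fdBimod k R)

/-- Finite-dimensional modules over a Hopf algebroid with commutative base. -/
abbrev CommHopfAlgebroid.FDMod {k R : Type u} [Field k] [CommRing R] [Algebra k R]
    (B : CommHopfAlgebroid k R) : Type (u + 1) :=
  ((fdModule k R).inverseImage B.monad.forget).FullSubcategory

/-- The forgetful functor from finite-dimensional `B`-modules to finite-dimensional
`R`-modules. -/
abbrev CommHopfAlgebroid.fdForget {k R : Type u} [Field k] [CommRing R] [Algebra k R]
    (B : CommHopfAlgebroid k R) : B.FDMod ⥤ (fdModule k R).FullSubcategory :=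
  restrictedFunctor B.monad.forget (fdModule k R)

/-- A linear form on `R` whose associated bilinear form `(x, y) ↦ form (x * y)` is nondegenerate
(for finite-dimensional `R`, nondegeneracy on one side suffices). -/
def IsFrobeniusForm {k R : Type u} [Field k] [Ring R] [Algebra k R] (form : R →ₗ[k] k) : Prop :=
  ∀ x : R, (∀ y : R, form (x * y) = 0) → x = 0

/-- A finite-dimensional algebra is symmetric Frobenius if it has a Frobenius form with
`form (x * y) = form (y * x)`. For commutative `R` this is the notion of a commutative
Frobenius algebra. -/
def IsSymmetricFrobenius [Ring R] [Algebra k R] [FiniteDimensional k R] : Prop :=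
  ∃ form : R →ₗ[k] k, IsFrobeniusForm form ∧ ∀ x y : R, form (x * y) = form (y * x)

end Algebroid
section U

variable (k : Type u) (R : Type u) (L : Type u) [Field k] [CommRing R] [Algebra k R]
  [LieRing L] [LieAlgebra k L] [Module R L] [LieRingModule L R] [LieRinehartRing R L]
  [LieRinehartAlgebra k R L]

open FreeAlgebra in
/-- The defining relations of the universal enveloping algebra of a Lie-Rinehart algebra `L` over
`R`, on generators `ι_R r` (left summand) and `ι_L x` (right summand): `ι_R` is a morphism of
`k`-algebras, `ι_L` a morphism of `k`-Lie algebras, `ι_L (r x) = ι_R r * ι_L x`, and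
`ι_L x * ι_R r - ι_R r * ι_L x = ι_R (x r)`. -/
inductive EnvRel : FreeAlgebra k (R ⊕ L) → FreeAlgebra k (R ⊕ L) → Prop
  | algebraMap (c : k) :
      EnvRel (ι k (.inl (algebraMap k R c))) (algebraMap k (FreeAlgebra k (R ⊕ L)) c)
  | add_left (r s : R) : EnvRel (ι k (.inl (r + s))) (ι k (.inl r) + ι k (.inl s))
  | mul_left (r s : R) : EnvRel (ι k (.inl (r * s))) (ι k (.inl r) * ι k (.inl s))
  | add_right (x y : L) : EnvRel (ι k (.inr (x + y))) (ι k (.inr x) + ι k (.inr y))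
  | smul_right (c : k) (x : L) : EnvRel (ι k (.inr (c • x))) (c • ι k (.inr x))
  | lie (x y : L) : EnvRel (ι k (.inr ⁅x, y⁆))
      (ι k (.inr x) * ι k (.inr y) - ι k (.inr y) * ι k (.inr x))
  | smul (r : R) (x : L) : EnvRel (ι k (.inr (r • x))) (ι k (.inl r) * ι k (.inr x))
  | leibniz (x : L) (r : R) :
      EnvRel (ι k (.inr x) * ι k (.inl r) - ι k (.inl r) * ι k (.inr x)) (ι k (.inl ⁅x, r⁆))

/-- The universal enveloping algebra of a Lie-Rinehart algebra. -/
abbrev Env : Type u := RingQuot (EnvRel k R L)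

/-- The quotient map onto the universal enveloping algebra. -/
noncomputable def Env.mk : FreeAlgebra k (R ⊕ L) →ₐ[k] Env k R L :=
  RingQuot.mkAlgHom k (EnvRel k R L)

variable {k R L} in
lemma Env.mk_rel {a b : FreeAlgebra k (R ⊕ L)} (h : EnvRel k R L a b) :
    Env.mk k R L a = Env.mk k R L b := RingQuot.mkAlgHom_rel k h

/-- The algebra morphism `ι_R : R → U_R(L)`. -/
noncomputable def Env.base : R →ₐ[k] Env k R L where
  toFun r := Env.mk k R L (FreeAlgebra.ι k (.inl r))
  map_one' := by
    rw [← map_one (algebraMap k R), Env.mk_rel (.algebraMap 1)]; simp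
  map_mul' r s := by rw [Env.mk_rel (.mul_left r s), map_mul]
  map_zero' := by
    rw [← map_zero (algebraMap k R), Env.mk_rel (.algebraMap 0)]; simp
  map_add' r s := by rw [Env.mk_rel (.add_left r s), map_add]
  commutes' c := by rw [Env.mk_rel (.algebraMap c), AlgHom.commutes]

/-- The map `ι_L : L → U_R(L)`. -/
noncomputable def Env.lie : L →ₗ[k] Env k R L where
  toFun x := Env.mk k R L (FreeAlgebra.ι k (.inr x))
  map_add' x y := by rw [Env.mk_rel (.add_right x y), map_add]
  map_smul' c x := by rw [Env.mk_rel (.smul_right c x), map_smul]; rfl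

lemma Env.lie_lie (x y : L) : Env.lie k R L ⁅x, y⁆ =
    Env.lie k R L x * Env.lie k R L y - Env.lie k R L y * Env.lie k R L x := by
  change Env.mk k R L _ = _
  rw [Env.mk_rel (.lie x y), map_sub, map_mul, map_mul]; rfl

lemma Env.lie_smul (r : R) (x : L) :
    Env.lie k R L (r • x) = Env.base k R L r * Env.lie k R L x := by
  change Env.mk k R L _ = _
  rw [Env.mk_rel (.smul r x), map_mul]; rfl

lemma Env.lie_mul_base (x : L) (r : R) :
    Env.lie k R L x * Env.base k R L r =
      Env.base k R L r * Env.lie k R L x + Env.base k R L ⁅x, r⁆ := by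
  rw [← sub_eq_iff_eq_add']
  change Env.mk k R L _ * Env.mk k R L _ - Env.mk k R L _ * Env.mk k R L _ = Env.mk k R L _
  rw [← map_mul, ← map_mul, ← map_sub, Env.mk_rel (.leibniz x r)]

variable {k R L} in
theorem Env.induction {p : Env k R L → Prop} (base : ∀ r, p (Env.base k R L r))
    (lie : ∀ x, p (Env.lie k R L x)) (add : ∀ a b, p a → p b → p (a + b))
    (mul : ∀ a b, p a → p b → p (a * b)) (u : Env k R L) : p u := by
  obtain ⟨a, rfl⟩ := RingQuot.mkAlgHom_surjective k (EnvRel k R L) u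
  change p (Env.mk k R L a)
  induction a using FreeAlgebra.induction with
  | grade0 c =>
    rw [← Env.mk_rel (.algebraMap c)]; exact base _
  | grade1 z => rcases z with r | x
                · exact base r
                · exact lie x
  | mul a b ha hb => rw [map_mul]; exact mul _ _ ha hb
  | add a b ha hb => rw [map_add]; exact add _ _ ha hb

/-- An action of `L` on an `R`-module `W`, compatible with the `R`-action. -/
structure LAction (W : Type u) [AddCommGroup W] [Module R W] where
  act : L → W →+ W
  add_act (x y : L) (w : W) : act (x + y) w = act x w + act y w
  smul_act (r : R) (x : L) (w : W) : act (r • x) w = r • act x w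
  lie_act (x y : L) (w : W) : act ⁅x, y⁆ w = act x (act y w) - act y (act x w)
  act_smul (x : L) (r : R) (w : W) : act x (r • w) = r • act x w + ⁅x, r⁆ • w

variable {R L}

lemma lie_algebraMap (x : L) (c : k) : ⁅x, algebraMap k R c⁆ = 0 := by
  have h := LieRinehartRing.leibniz_mul_right x (1 : R) 1
  have h1 : ⁅x, (1 : R)⁆ = 0 := by simpa using h
  rw [Algebra.algebraMap_eq_smul_one, lie_smul c x (1 : R), h1, smul_zero]

/-- The action of the generators of the enveloping algebra. -/
noncomputable def LAction.gen {W : Type u} [AddCommGroup W] [Module R W] [Module k W]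
    [IsScalarTower k R W] (ρ : LAction R L W) : R ⊕ L → Module.End k W
  | .inl r => Algebra.lsmul k k W r
  | .inr x =>
    { toFun := ρ.act x
      map_add' := map_add _
      map_smul' := fun c w => by
        rw [← algebraMap_smul R c w, ρ.act_smul, lie_algebraMap k, zero_smul, add_zero,
          algebraMap_smul]; rfl }

lemma LAction.gen_rel {W : Type u} [AddCommGroup W] [Module R W] [Module k W]
    [IsScalarTower k R W] (ρ : LAction R L W) ⦃a b : FreeAlgebra k (R ⊕ L)⦄
    (h : EnvRel k R L a b) :
    FreeAlgebra.lift k (ρ.gen k) a = FreeAlgebra.lift k (ρ.gen k) b := by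
  induction h with
  | algebraMap c => ext w; simp [LAction.gen]
  | add_left r s => ext w; simp [LAction.gen]
  | mul_left r s => ext w; simp [LAction.gen]
  | add_right x y => ext w; simp [LAction.gen, ρ.add_act]
  | smul_right c x =>
    ext w
    have h : ρ.act (c • x) w = c • ρ.act x w := by
      rw [← algebraMap_smul R c x, ρ.smul_act, algebraMap_smul]
    simpa [LAction.gen] using h
  | lie x y => ext w; simp [LAction.gen, ρ.lie_act]
  | smul r x => ext w; simp [LAction.gen, ρ.smul_act]
  | leibniz x r => ext w; simp [LAction.gen, ρ.act_smul]

/-- The algebra morphism from the enveloping algebra induced by an action of `L`. -/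
noncomputable def LAction.toHom {W : Type u} [AddCommGroup W] [Module R W] [Module k W]
    [IsScalarTower k R W] (ρ : LAction R L W) : Env k R L →ₐ[k] Module.End k W :=
  RingQuot.liftAlgHom k ⟨FreeAlgebra.lift k (ρ.gen k), ρ.gen_rel k⟩


section
variable {W : Type u} [AddCommGroup W] [Module R W] [Module k W]
    [IsScalarTower k R W] (ρ : LAction R L W)

lemma LAction.toHom_base (r : R) (w : W) : ρ.toHom k (Env.base k R L r) w = r • w := by
  have h := RingQuot.liftAlgHom_mkAlgHom_apply k (FreeAlgebra.lift k (ρ.gen k))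
    (s := EnvRel k R L) (ρ.gen_rel k) (FreeAlgebra.ι k (.inl r))
  rw [FreeAlgebra.lift_ι_apply] at h
  exact congrArg (fun f : Module.End k W => f w) h

lemma LAction.toHom_lie (x : L) (w : W) : ρ.toHom k (Env.lie k R L x) w = ρ.act x w := by
  have h := RingQuot.liftAlgHom_mkAlgHom_apply k (FreeAlgebra.lift k (ρ.gen k))
    (s := EnvRel k R L) (ρ.gen_rel k) (FreeAlgebra.ι k (.inr x))
  rw [FreeAlgebra.lift_ι_apply] at h
  exact congrArg (fun f : Module.End k W => f w) h
end

variable (R L) in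
/-- The forgetful functor from modules over the enveloping algebra to `R`-modules. -/
noncomputable abbrev Env.res : ModuleCat.{u} (Env k R L) ⥤ ModuleCat.{u} R :=
  ModuleCat.restrictScalars (Env.base k R L : R →+* Env k R L)

/-- The module structure over the enveloping algebra induced by an action of `L`. -/
@[reducible]
noncomputable def LAction.module {W : Type u} [AddCommGroup W] [Module R W] (ρ : LAction R L W) :
    Module (Env k R L) W :=
  letI : Module k W := Module.compHom W (algebraMap k R)
  haveI : IsScalarTower k R W := IsScalarTower.of_algebraMap_smul fun _ _ => rfl
  Module.compHom W (ρ.toHom k : Env k R L →+* Module.End k W)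

/-- The module over the enveloping algebra given by an action of `L`. -/
noncomputable def LAction.toModuleCat {W : ModuleCat.{u} R} (ρ : LAction R L W) :
    ModuleCat.{u} (Env k R L) :=
  letI := ρ.module k
  ModuleCat.of (Env k R L) W

variable {k}

lemma LAction.base_smul {W : ModuleCat.{u} R} (ρ : LAction R L W) (r : R) (w : W) :
    (Env.base k R L r • (show ρ.toModuleCat k from w) : ρ.toModuleCat k) = (r • w : W) :=
  letI : Module k W := Module.compHom W (algebraMap k R)
  haveI : IsScalarTower k R W := IsScalarTower.of_algebraMap_smul fun _ _ => rfl
  ρ.toHom_base k r w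

lemma LAction.lie_smul {W : ModuleCat.{u} R} (ρ : LAction R L W) (x : L) (w : W) :
    (Env.lie k R L x • (show ρ.toModuleCat k from w) : ρ.toModuleCat k) = ρ.act x w :=
  letI : Module k W := Module.compHom W (algebraMap k R)
  haveI : IsScalarTower k R W := IsScalarTower.of_algebraMap_smul fun _ _ => rfl
  ρ.toHom_lie k x w

variable (k) in
/-- The module given by an action of `L` on `W` has underlying `R`-module `W`. -/
noncomputable def LAction.resIso {W : ModuleCat.{u} R} (ρ : LAction R L W) :
    (Env.res k R L).obj (ρ.toModuleCat k) ≅ W :=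
  let e : (Env.res k R L).obj (ρ.toModuleCat k) ≃ₗ[R] W :=
    { toFun := fun w => w
      invFun := fun w => w
      map_add' := fun _ _ => rfl
      map_smul' := ρ.base_smul
      left_inv := fun _ => rfl
      right_inv := fun _ => rfl }
  LinearEquiv.toModuleIso e

/-- The action of `L` on a module over the enveloping algebra. -/
noncomputable def Env.action (M : ModuleCat.{u} (Env k R L)) :
    LAction R L ((Env.res k R L).obj M) where
  act x := DistribSMul.toAddMonoidHom M (Env.lie k R L x)
  add_act x y w := by
    change Env.lie k R L (x + y) • (show M from w) = _
    rw [map_add, add_smul]; rfl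
  smul_act r x w := by
    change Env.lie k R L (r • x) • (show M from w) = _
    rw [Env.lie_smul, mul_smul]; rfl
  lie_act x y w := by
    change Env.lie k R L ⁅x, y⁆ • (show M from w) = _
    rw [Env.lie_lie, sub_smul, mul_smul, mul_smul]; rfl
  act_smul x r w := by
    change Env.lie k R L x • Env.base k R L r • (show M from w) = _
    rw [← mul_smul, Env.lie_mul_base, add_smul, mul_smul]; rfl

section
variable {M N : Type u} [AddCommGroup M] [Module R M] [AddCommGroup N] [Module R N]

/-- The action `x (m ⊗ n) = (x m) ⊗ n + m ⊗ (x n)` on a tensor product over `R`, which is the one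
given by the comultiplication `Δ (ι_L x) = 1 ⊗ ι_L x + ι_L x ⊗ 1`. -/
noncomputable def LAction.tensorAct (ρ : LAction R L M) (σ : LAction R L N) (x : L) :
    M ⊗[R] N →+ M ⊗[R] N :=
  TensorProduct.liftAddHom
    { toFun := fun m =>
        { toFun := fun n => ρ.act x m ⊗ₜ n + m ⊗ₜ σ.act x n
          map_zero' := by simp
          map_add' := fun a b => by simp only [map_add, TensorProduct.tmul_add]; abel }
      map_zero' := by ext; simp
      map_add' := fun a b => by
        ext n; simp only [map_add, TensorProduct.add_tmul, AddMonoidHom.coe_mk,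
          ZeroHom.coe_mk, AddMonoidHom.add_apply]; abel }
    (fun r m n => by
      simp only [AddMonoidHom.coe_mk, ZeroHom.coe_mk, ρ.act_smul, σ.act_smul,
        TensorProduct.add_tmul, TensorProduct.tmul_add, TensorProduct.smul_tmul]
      abel)

@[simp] lemma LAction.tensorAct_tmul (ρ : LAction R L M) (σ : LAction R L N) (x : L)
    (m : M) (n : N) :
    ρ.tensorAct σ x (m ⊗ₜ n) = ρ.act x m ⊗ₜ n + m ⊗ₜ σ.act x n := rfl

/-- The tensor product of two actions of `L`. -/
noncomputable def LAction.tensor (ρ : LAction R L M) (σ : LAction R L N) :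
    LAction R L (M ⊗[R] N) where
  act := ρ.tensorAct σ
  add_act x y w := by
    induction w with
    | zero => simp
    | tmul m n =>
      simp only [tensorAct_tmul, ρ.add_act, σ.add_act, TensorProduct.add_tmul,
        TensorProduct.tmul_add]; abel
    | add a b ha hb => simp only [map_add, ha, hb]; abel
  smul_act r x w := by
    induction w with
    | zero => simp
    | tmul m n =>
      simp only [tensorAct_tmul, ρ.smul_act, σ.smul_act, smul_add, TensorProduct.smul_tmul',
        TensorProduct.tmul_smul]
    | add a b ha hb => simp only [map_add, ha, hb, smul_add]
  lie_act x y w := by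
    induction w with
    | zero => simp
    | tmul m n =>
      simp only [tensorAct_tmul, ρ.lie_act, σ.lie_act, TensorProduct.sub_tmul,
        TensorProduct.tmul_sub, map_add]; abel
    | add a b ha hb => simp only [map_add, ha, hb]; abel
  act_smul x r w := by
    induction w with
    | zero => simp
    | tmul m n =>
      rw [TensorProduct.smul_tmul']
      simp only [tensorAct_tmul, ρ.act_smul, TensorProduct.add_tmul, smul_add,
        TensorProduct.smul_tmul']
      abel
    | add a b ha hb => simp only [map_add, ha, hb, smul_add]; abel

variable (R L) in
/-- The action of `L` on `R` by derivations; it is the one given by the counit,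
`x r = ε (ι_L x * ι_R r)`. -/
def LAction.unit : LAction R L R where
  act x := AddMonoidHom.mk' (fun r => ⁅x, r⁆) (lie_add x)
  add_act x y r := add_lie x y r
  smul_act r x s := LieRinehartRing.lie_smul_eq_mul r s x
  lie_act x y r := by
    change ⁅⁅x, y⁆, r⁆ = ⁅x, ⁅y, r⁆⁆ - ⁅y, ⁅x, r⁆⁆
    rw [lie_lie]
  act_smul x r s := by
    change ⁅x, r * s⁆ = r * ⁅x, s⁆ + ⁅x, r⁆ * s
    rw [LieRinehartRing.leibniz_mul_right]; rfl

end

/-- Compatibility of an `R`-linear map with actions of `L`. -/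
def LAction.Equivariant {W W' : ModuleCat.{u} R} (ρ : LAction R L W) (σ : LAction R L W')
    (f : W ⟶ W') : Prop :=
  ∀ (x : L) (w : W), f (ρ.act x w) = σ.act x (f w)

namespace LAction.Equivariant
variable {W₁ W₂ W₃ W₁' W₂' : ModuleCat.{u} R} {ρ₁ : LAction R L W₁} {ρ₂ : LAction R L W₂}
  {ρ₃ : LAction R L W₃} {ρ₁' : LAction R L W₁'} {ρ₂' : LAction R L W₂'}

lemma id : ρ₁.Equivariant ρ₁ (𝟙 W₁) := fun _ _ => rfl

lemma comp {f : W₁ ⟶ W₂} {g : W₂ ⟶ W₃} (hf : ρ₁.Equivariant ρ₂ f) (hg : ρ₂.Equivariant ρ₃ g) :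
    ρ₁.Equivariant ρ₃ (f ≫ g) := fun x w => (congrArg g (hf x w)).trans (hg x (f w))

lemma inv {e : W₁ ≅ W₂} (he : ρ₁.Equivariant ρ₂ e.hom) : ρ₂.Equivariant ρ₁ e.inv := fun x w => by
  have h := he x (e.inv w)
  have h1 : e.hom (e.inv w) = w := by simp
  rw [h1] at h
  rw [← h]; simp

lemma res : (Env.action (ρ₁.toModuleCat k)).Equivariant ρ₁ (ρ₁.resIso k).hom :=
  fun x w => ρ₁.lie_smul (k := k) x w

lemma tensor {f : W₁ ⟶ W₁'} {g : W₂ ⟶ W₂'} (hf : ρ₁.Equivariant ρ₁' f)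
    (hg : ρ₂.Equivariant ρ₂' g) :
    LAction.Equivariant (W := W₁ ⊗ W₂) (W' := W₁' ⊗ W₂') (ρ₁.tensor ρ₂) (ρ₁'.tensor ρ₂')
      (f ⊗ₘ g) := fun x w => by
  induction w using TensorProduct.induction_on with
  | zero => simp
  | tmul m n =>
    change (f (ρ₁.act x m) ⊗ₜ[R] g n + f m ⊗ₜ[R] g (ρ₂.act x n) : W₁' ⊗[R] W₂') =
      ρ₁'.act x (f m) ⊗ₜ[R] g n + f m ⊗ₜ[R] ρ₂'.act x (g n)
    rw [hf, hg]
  | add a b ha hb => simp only [map_add, ha, hb]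

lemma assoc : LAction.Equivariant (W := (W₁ ⊗ W₂) ⊗ W₃) (W' := W₁ ⊗ W₂ ⊗ W₃)
    ((ρ₁.tensor ρ₂).tensor ρ₃) (ρ₁.tensor (ρ₂.tensor ρ₃)) (α_ W₁ W₂ W₃).hom := fun x w => by
  induction w using TensorProduct.induction_on with
  | zero => simp
  | tmul a c =>
    induction a using TensorProduct.induction_on with
    | zero => simp
    | tmul a b =>
      change (ρ₁.act x a ⊗ₜ[R] (b ⊗ₜ[R] c) + a ⊗ₜ[R] (ρ₂.act x b ⊗ₜ[R] c) +
        a ⊗ₜ[R] (b ⊗ₜ[R] ρ₃.act x c) : W₁ ⊗[R] (W₂ ⊗[R] W₃)) =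
        ρ₁.act x a ⊗ₜ[R] (b ⊗ₜ[R] c) + a ⊗ₜ[R] (ρ₂.act x b ⊗ₜ[R] c + b ⊗ₜ[R] ρ₃.act x c)
      rw [TensorProduct.tmul_add, add_assoc]
    | add a b ha hb => simp only [TensorProduct.add_tmul, map_add, ha, hb]
  | add a b ha hb => simp only [map_add, ha, hb]

lemma leftUnit : LAction.Equivariant (W := 𝟙_ (ModuleCat R) ⊗ W₁)
    ((LAction.unit R L).tensor ρ₁) ρ₁ (λ_ W₁).hom := fun x w => by
  induction w using TensorProduct.induction_on with
  | zero => simp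
  | tmul r m =>
    change (⁅x, (show R from r)⁆ • m + (show R from r) • ρ₁.act x m : W₁) =
      ρ₁.act x ((show R from r) • m)
    rw [ρ₁.act_smul, add_comm]
  | add a b ha hb => simp only [map_add, ha, hb]

lemma rightUnit : LAction.Equivariant (W := W₁ ⊗ 𝟙_ (ModuleCat R))
    (ρ₁.tensor (LAction.unit R L)) ρ₁ (ρ_ W₁).hom := fun x w => by
  induction w using TensorProduct.induction_on with
  | zero => simp
  | tmul m r =>
    change ((show R from r) • ρ₁.act x m + ⁅x, (show R from r)⁆ • m : W₁) =
      ρ₁.act x ((show R from r) • m)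
    rw [ρ₁.act_smul]
  | add a b ha hb => simp only [map_add, ha, hb]

end LAction.Equivariant

namespace Env

/-- An `R`-linear map commuting with `L` is linear over the enveloping algebra. -/
noncomputable def homMk {M N : ModuleCat.{u} (Env k R L)}
    (f : (res k R L).obj M ⟶ (res k R L).obj N) (hf : (action M).Equivariant (action N) f) :
    M ⟶ N :=
  ModuleCat.ofHom (X := M) (Y := N)
    { toFun := fun m => f m
      map_add' := fun a b => map_add f.hom a b
      map_smul' := fun u => by
        let g : M →+ N := f.hom.toAddMonoidHom
        change ∀ m : M, g (u • m) = u • g m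
        induction u using Env.induction with
        | base r => exact fun m => map_smul f.hom r (show (res k R L).obj M from m)
        | lie x => exact hf x
        | add a b ha hb =>
          intro m
          rw [add_smul, add_smul, map_add, ha, hb]
        | mul a b ha hb =>
          intro m
          rw [mul_smul, mul_smul, ha, hb] }

@[simp] lemma res_map_homMk {M N : ModuleCat.{u} (Env k R L)}
    (f : (res k R L).obj M ⟶ (res k R L).obj N) (hf) :
    (res k R L).map (homMk f hf) = f := rfl

lemma equivariant_map {M N : ModuleCat.{u} (Env k R L)} (f : M ⟶ N) :
    (action M).Equivariant (action N) ((res k R L).map f) :=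
  fun x m => map_smul f.hom (lie k R L x) m

/-- An `R`-linear isomorphism commuting with `L` is linear over the enveloping algebra. -/
noncomputable def isoMk {M N : ModuleCat.{u} (Env k R L)}
    (f : (res k R L).obj M ≅ (res k R L).obj N)
    (hf : (action M).Equivariant (action N) f.hom) : M ≅ N where
  hom := homMk f.hom hf
  inv := homMk f.inv hf.inv
  hom_inv_id := (res k R L).map_injective (by simp)
  inv_hom_id := (res k R L).map_injective (by simp)

lemma res_map_isoMk_hom {M N : ModuleCat.{u} (Env k R L)}
    (f : (res k R L).obj M ≅ (res k R L).obj N) (hf) :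
    (res k R L).map (isoMk f hf).hom = f.hom := rfl

/-- The tensor product over `R` of two modules over the enveloping algebra. -/
noncomputable def tensorModule (M N : ModuleCat.{u} (Env k R L)) : ModuleCat.{u} (Env k R L) :=
  LAction.toModuleCat k (W := (res k R L).obj M ⊗ (res k R L).obj N)
    ((action M).tensor (action N))

/-- The underlying `R`-module of the tensor product. -/
noncomputable def tensorIso (M N : ModuleCat.{u} (Env k R L)) :
    (res k R L).obj (tensorModule M N) ≅ (res k R L).obj M ⊗ (res k R L).obj N :=
  LAction.resIso k (W := (res k R L).obj M ⊗ (res k R L).obj N) ((action M).tensor (action N))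

variable (k R L) in
/-- The module `R` over the enveloping algebra. -/
noncomputable def unitModule : ModuleCat.{u} (Env k R L) :=
  LAction.toModuleCat k (W := 𝟙_ (ModuleCat.{u} R)) (LAction.unit R L)

variable (k R L) in
/-- The underlying `R`-module of the unit module. -/
noncomputable def unitIso : (res k R L).obj (unitModule k R L) ≅ 𝟙_ (ModuleCat.{u} R) :=
  LAction.resIso k (W := 𝟙_ (ModuleCat.{u} R)) (LAction.unit R L)

lemma tensorIso_equivariant (M N : ModuleCat.{u} (Env k R L)) :
    LAction.Equivariant (W' := (res k R L).obj M ⊗ (res k R L).obj N)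
      (action (tensorModule M N)) ((action M).tensor (action N)) (tensorIso M N).hom :=
  LAction.Equivariant.res

variable (k R L) in
lemma unitIso_equivariant :
    LAction.Equivariant (W' := 𝟙_ (ModuleCat.{u} R))
      (action (unitModule k R L)) (LAction.unit R L) (unitIso k R L).hom :=
  LAction.Equivariant.res

/-- The tensor product of two morphisms. -/
noncomputable def tensorMap {M M' N N' : ModuleCat.{u} (Env k R L)} (f : M ⟶ M') (g : N ⟶ N') :
    tensorModule M N ⟶ tensorModule M' N' :=
  homMk ((tensorIso M N).hom ≫ ((res k R L).map f ⊗ₘ (res k R L).map g) ≫ (tensorIso M' N').inv)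
    ((tensorIso_equivariant M N).comp
      (((equivariant_map f).tensor (equivariant_map g)).comp (tensorIso_equivariant M' N').inv))

noncomputable instance : MonoidalCategoryStruct (ModuleCat.{u} (Env k R L)) where
  tensorObj := tensorModule
  whiskerLeft M _ _ f := tensorMap (𝟙 M) f
  whiskerRight f N := tensorMap f (𝟙 N)
  tensorHom := tensorMap
  tensorUnit := unitModule k R L
  associator M N P := isoMk
    (tensorIso (tensorModule M N) P ≪≫ (tensorIso M N ⊗ᵢ Iso.refl _) ≪≫ α_ _ _ _ ≪≫
      (Iso.refl _ ⊗ᵢ (tensorIso N P).symm) ≪≫ (tensorIso M (tensorModule N P)).symm)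
    ((tensorIso_equivariant _ _).comp <|
      ((tensorIso_equivariant _ _).tensor .id).comp <|
      LAction.Equivariant.assoc.comp <|
      (LAction.Equivariant.tensor .id (tensorIso_equivariant _ _).inv).comp
        (tensorIso_equivariant _ _).inv)
  leftUnitor M := isoMk
    (tensorIso (unitModule k R L) M ≪≫ (unitIso k R L ⊗ᵢ Iso.refl _) ≪≫ λ_ _)
    ((tensorIso_equivariant _ _).comp <|
      ((unitIso_equivariant k R L).tensor .id).comp LAction.Equivariant.leftUnit)
  rightUnitor M := isoMk
    (tensorIso M (unitModule k R L) ≪≫ (Iso.refl _ ⊗ᵢ unitIso k R L) ≪≫ ρ_ _)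
    ((tensorIso_equivariant _ _).comp <|
      (LAction.Equivariant.tensor .id (unitIso_equivariant k R L)).comp
        LAction.Equivariant.rightUnit)

variable (k R L) in
/-- The forgetful functor preserves the monoidal structure. -/
noncomputable def resInducing : Monoidal.InducingFunctorData (res k R L) where
  μIso M N := (tensorIso M N).symm
  εIso := (unitIso k R L).symm
  whiskerLeft_eq M _ _ f := by
    rw [← id_tensorHom, ← (res k R L).map_id]
    rfl
  whiskerRight_eq f N := by
    rw [← tensorHom_id, ← (res k R L).map_id]
    rfl
  tensorHom_eq f g := rfl
  associator_eq M N P := by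
    refine (res_map_isoMk_hom _ _).trans ?_
    simp only [Iso.trans_hom, Category.assoc]
    rfl
  leftUnitor_eq M := by
    refine (res_map_isoMk_hom _ _).trans ?_
    simp only [Iso.trans_hom, Category.assoc]
    rfl
  rightUnitor_eq M := by
    refine (res_map_isoMk_hom _ _).trans ?_
    simp only [Iso.trans_hom, Category.assoc]
    rfl

/-- The monoidal category of modules over the enveloping algebra. -/
noncomputable instance : MonoidalCategory (ModuleCat.{u} (Env k R L)) :=
  Monoidal.induced (res k R L) (resInducing k R L)

noncomputable instance : (res k R L).Monoidal :=
  Monoidal.fromInducedMonoidal (res k R L) (resInducing k R L)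

end Env
end U

section EnvFD
variable (k R L : Type u) [Field k] [CommRing R] [Algebra k R]
  [LieRing L] [LieAlgebra k L] [Module R L] [LieRingModule L R] [LieRinehartRing R L]
  [LieRinehartAlgebra k R L]

/-- Finite-dimensional modules over the universal enveloping algebra of a Lie-Rinehart algebra. -/
abbrev Env.FDMod : Type (u + 1) := ((fdModule k R).inverseImage (Env.res k R L)).FullSubcategory

/-- The forgetful functor from finite-dimensional modules over the enveloping algebra to
finite-dimensional `R`-modules. -/
noncomputable abbrev Env.fdForget : Env.FDMod k R L ⥤ (fdModule k R).FullSubcategory :=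
  restrictedFunctor (Env.res k R L) (fdModule k R)

end EnvFD

section Weyl
variable (k : Type u) [Field k] (p n : ℕ)

/-- The truncated polynomial algebra `k[x₁, …, xₙ] / (xᵢ ^ p)`. -/
abbrev TruncPoly : Type u :=
  MvPolynomial (Fin n) k ⧸
    Ideal.span (Set.range fun i : Fin n => (MvPolynomial.X i ^ p : MvPolynomial (Fin n) k))

/-- The quotient map onto the truncated polynomial algebra. -/
noncomputable abbrev TruncPoly.mk : MvPolynomial (Fin n) k →ₐ[k] TruncPoly k p n :=
  Ideal.Quotient.mkₐ k _

/-- The generators `xᵢ` of the truncated polynomial algebra. -/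
noncomputable abbrev TruncPoly.x (i : Fin n) : TruncPoly k p n :=
  TruncPoly.mk k p n (MvPolynomial.X i)

instance TruncPoly.finite [hp : Fact p.Prime] : FiniteDimensional k (TruncPoly k p n) := by
  have hx (i : Fin n) : IsIntegral k (TruncPoly.x k p n i) := by
    refine IsIntegral.of_pow hp.out.pos ?_
    have h : TruncPoly.x k p n i ^ p = 0 := by
      rw [TruncPoly.x, ← map_pow]
      exact Ideal.Quotient.eq_zero_iff_mem.2 (Ideal.subset_span ⟨i, rfl⟩)
    rw [h]
    exact isIntegral_zero
  have : Algebra.IsIntegral k (TruncPoly k p n) := ⟨fun a => by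
    obtain ⟨f, rfl⟩ := Ideal.Quotient.mkₐ_surjective k _ a
    induction f using MvPolynomial.induction_on with
    | C c => exact isIntegral_algebraMap
    | add f g hf hg => rw [map_add]; exact hf.add hg
    | mul_X f i hf => rw [map_mul]; exact hf.mul (hx i)⟩
  exact Algebra.IsIntegral.finite

/-- The defining relations of the truncated modular Weyl algebra, on generators
`xᵢ` (left summand) and `∂ᵢ` (right summand). -/
inductive WeylRel : FreeAlgebra k (Fin n ⊕ Fin n) → FreeAlgebra k (Fin n ⊕ Fin n) → Prop
  | x_pow (i : Fin n) : WeylRel (FreeAlgebra.ι k (.inl i) ^ p) 0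
  | x_comm (i j : Fin n) :
      WeylRel (FreeAlgebra.ι k (.inl i) * FreeAlgebra.ι k (.inl j))
        (FreeAlgebra.ι k (.inl j) * FreeAlgebra.ι k (.inl i))
  | d_comm (i j : Fin n) :
      WeylRel (FreeAlgebra.ι k (.inr i) * FreeAlgebra.ι k (.inr j))
        (FreeAlgebra.ι k (.inr j) * FreeAlgebra.ι k (.inr i))
  | d_x (i j : Fin n) :
      WeylRel (FreeAlgebra.ι k (.inr i) * FreeAlgebra.ι k (.inl j) -
        FreeAlgebra.ι k (.inl j) * FreeAlgebra.ι k (.inr i)) (if i = j then 1 else 0)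

/-- The truncated modular Weyl algebra, by generators and relations. -/
abbrev WeylAlgebra : Type u := RingQuot (WeylRel k p n)

/-- The generators `xᵢ` of the truncated modular Weyl algebra. -/
noncomputable def WeylAlgebra.x (i : Fin n) : WeylAlgebra k p n :=
  RingQuot.mkAlgHom k (WeylRel k p n) (FreeAlgebra.ι k (.inl i))

/-- The generators `∂ᵢ` of the truncated modular Weyl algebra. -/
noncomputable def WeylAlgebra.d (i : Fin n) : WeylAlgebra k p n :=
  RingQuot.mkAlgHom k (WeylRel k p n) (FreeAlgebra.ι k (.inr i))

end Weyl

end HopfGV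

/-! Internal homs are handled through their universal evaluations `X ⊗ H ⟶ Y`, so that no choice of
adjoint enters. A pairing `X ⊗ Y ⟶ K` is perfect if it exhibits each side as the internal hom from
the other side into `K`. If every object occurs on the left and on the right of a perfect pairing
into `K`, then `K` is dualizing (`HasPerfectPairings.isDualizing`).

A closed functor preserves universal evaluations, and a conservative one also reflects them. Hence
perfect pairings into the unit lift along a conservative closed monoidal functor `F : C ⥤ D`: the
evaluation `X ⊗ (X ⊸ 𝟙) ⟶ 𝟙` becomes universal on one side in `D`. There it is perfect, because
duals are unique, and the universality on the other side is reflected back to `C`. This is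
`IsClosedFunctor.isRCategory`. It reduces each r-category claim to two points: the forgetful functor
is closed, and the finite-dimensional objects of the base have perfect pairings into `R`.

Closedness for a Hopf monad `T`: invertible fusion operators give isomorphisms `T (M ⊗ Y) ≅ M ⊗ T Y`
for every module `M`, and these let `T` act on the internal hom of the underlying objects
(`exists_isLeftHom_algebra`). For the enveloping algebra of a Lie-Rinehart algebra, `L` acts on
`Hom_R(M, N)` by `x f = x ∘ f - f ∘ x`.

Perfect pairings in the base: composition with a Frobenius form turns `R`-valued maps into
`k`-valued ones, so that duality into `R` becomes duality of finite-dimensional vector spaces. In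
the commutative case this says that finite-dimensional modules are reflexive
(`IsFrobeniusForm.isReflexive`). For bimodules, pairings `X ⊗ Y ⟶ R` correspond to bilinear forms
invariant under both actions; the symmetry of the form gives the second invariance, and the
`k`-linear dual serves as dual on both sides.

For the truncated Weyl algebra, the top coefficient is a Frobenius form because every monomial has a
complementary one. The derivations of `R` are the combinations `∑ D(xᵢ) ∂ᵢ`, so both algebras have
the same generators and relations. -/

namespace HopfGV

open CategoryTheory MonoidalCategory Opposite
open scoped TensorProduct

/-! ### Universal evaluations, closed functors and perfect pairings -/

section Universal

variable {C : Type u₁} [Category.{v₁} C] [MonoidalCategory C]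
variable {D : Type u₂} [Category.{v₂} D] [MonoidalCategory D]

/-- `ev` exhibits `H` as the left internal hom `X ⊸ Y`. -/
def IsLeftHom {X H Y : C} (ev : X ⊗ H ⟶ Y) : Prop :=
  ∀ ⦃Z : C⦄ (f : X ⊗ Z ⟶ Y), ∃! g : Z ⟶ H, X ◁ g ≫ ev = f

/-- `ev` exhibits `H` as the right internal hom `Y ⟜ X`. -/
def IsRightHom {X H Y : C} (ev : H ⊗ X ⟶ Y) : Prop :=
  ∀ ⦃Z : C⦄ (f : Z ⊗ X ⟶ Y), ∃! g : Z ⟶ H, g ▷ X ≫ ev = f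

namespace IsLeftHom
variable {X H Y : C} {ev : X ⊗ H ⟶ Y}

lemma hom_ext (h : IsLeftHom ev) {Z : C} {g g' : Z ⟶ H}
    (e : X ◁ g ≫ ev = X ◁ g' ≫ ev) : g = g' :=
  (h (X ◁ g' ≫ ev)).unique e rfl

lemma isIso (h : IsLeftHom ev) {H' : C} {ev' : X ⊗ H' ⟶ Y} (h' : IsLeftHom ev') {c : H' ⟶ H}
    (hc : X ◁ c ≫ ev = ev') : IsIso c := by
  obtain ⟨d, hd, -⟩ := h' ev
  refine ⟨d, h'.hom_ext ?_, h.hom_ext ?_⟩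
  · rw [MonoidalCategory.whiskerLeft_comp, Category.assoc, hd, hc]; simp
  · rw [MonoidalCategory.whiskerLeft_comp, Category.assoc, hc, hd]; simp

lemma of_isIso (h : IsLeftHom ev) {H' : C} {ev' : X ⊗ H' ⟶ Y} {c : H' ⟶ H} [IsIso c]
    (hc : X ◁ c ≫ ev = ev') : IsLeftHom ev' := fun Z f => by
  obtain ⟨g, hg, hu⟩ := h f
  refine ⟨g ≫ inv c, ?_, fun g' hg' => ?_⟩
  · simp only [← hc, ← MonoidalCategory.whiskerLeft_comp_assoc]; simpa using hg
  · rw [← hu (g' ≫ c) (by simpa [hc] using hg')]; simp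

lemma whiskerRight_iso (h : IsLeftHom ev) {X' : C} (c : X' ⟶ X) [IsIso c] :
    IsLeftHom (c ▷ H ≫ ev) := fun Z f => by
  obtain ⟨g, hg, hu⟩ := h (inv c ▷ Z ≫ f)
  refine ⟨g, ?_, fun g' hg' => hu g' ?_⟩
  · dsimp only
    rw [whisker_exchange_assoc, hg]; simp
  · dsimp only
    rw [← hg', ← whisker_exchange_assoc]; simp

lemma comp_iso (h : IsLeftHom ev) {Y' : C} (c : Y ⟶ Y') [IsIso c] :
    IsLeftHom (ev ≫ c) := fun Z f => by
  obtain ⟨g, hg, hu⟩ := h (f ≫ inv c)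
  refine ⟨g, ?_, fun g' hg' => hu g' ?_⟩
  · dsimp only
    rw [← Category.assoc, hg]; simp
  · dsimp only
    rw [← hg']; simp

end IsLeftHom

namespace IsRightHom
variable {X H Y : C} {ev : H ⊗ X ⟶ Y}

lemma hom_ext (h : IsRightHom ev) {Z : C} {g g' : Z ⟶ H}
    (e : g ▷ X ≫ ev = g' ▷ X ≫ ev) : g = g' :=
  (h (g' ▷ X ≫ ev)).unique e rfl

lemma isIso (h : IsRightHom ev) {H' : C} {ev' : H' ⊗ X ⟶ Y} (h' : IsRightHom ev') {c : H' ⟶ H}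
    (hc : c ▷ X ≫ ev = ev') : IsIso c := by
  obtain ⟨d, hd, -⟩ := h' ev
  refine ⟨d, h'.hom_ext ?_, h.hom_ext ?_⟩
  · rw [MonoidalCategory.comp_whiskerRight, Category.assoc, hd, hc]; simp
  · rw [MonoidalCategory.comp_whiskerRight, Category.assoc, hc, hd]; simp

lemma of_isIso (h : IsRightHom ev) {H' : C} {ev' : H' ⊗ X ⟶ Y} {c : H' ⟶ H} [IsIso c]
    (hc : c ▷ X ≫ ev = ev') : IsRightHom ev' := fun Z f => by
  obtain ⟨g, hg, hu⟩ := h f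
  refine ⟨g ≫ inv c, ?_, fun g' hg' => ?_⟩
  · simp only [← hc, ← MonoidalCategory.comp_whiskerRight_assoc]; simpa using hg
  · rw [← hu (g' ≫ c) (by simpa [hc] using hg')]; simp

lemma whiskerLeft_iso (h : IsRightHom ev) {X' : C} (c : X' ⟶ X) [IsIso c] :
    IsRightHom (H ◁ c ≫ ev) := fun Z f => by
  obtain ⟨g, hg, hu⟩ := h (Z ◁ inv c ≫ f)
  refine ⟨g, ?_, fun g' hg' => hu g' ?_⟩
  · dsimp only
    rw [← whisker_exchange_assoc, hg]; simp
  · dsimp only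
    rw [← hg', whisker_exchange_assoc]; simp

lemma comp_iso (h : IsRightHom ev) {Y' : C} (c : Y ⟶ Y') [IsIso c] :
    IsRightHom (ev ≫ c) := fun Z f => by
  obtain ⟨g, hg, hu⟩ := h (f ≫ inv c)
  refine ⟨g, ?_, fun g' hg' => hu g' ?_⟩
  · dsimp only
    rw [← Category.assoc, hg]; simp
  · dsimp only
    rw [← hg']; simp

end IsRightHom

lemma tensorLeft_isLeftAdjoint {X : C}
    (h : ∀ Y : C, ∃ (H : C) (ev : X ⊗ H ⟶ Y), IsLeftHom ev) : (tensorLeft X).IsLeftAdjoint := by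
  choose H ev hev using h
  choose g hg hu using fun Y => hev Y
  exact (Adjunction.adjunctionOfEquivRight (F := tensorLeft X) (G_obj := H)
    (fun Z Y =>
      { toFun := fun f => g Y f
        invFun := fun a => X ◁ a ≫ ev Y
        left_inv := fun f => hg Y f
        right_inv := fun a => (hev Y).hom_ext (hg Y _) })
    (fun Z' Z Y a f => (hev Y).hom_ext <| by
      have h1 := hg Y (X ◁ a ≫ f)
      have h2 := hg Y f
      dsimp only at h1 h2
      rw [MonoidalCategory.whiskerLeft_comp, Category.assoc]
      exact h1.trans (congrArg (X ◁ a ≫ ·) h2.symm))).isLeftAdjoint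

lemma tensorRight_isLeftAdjoint {X : C}
    (h : ∀ Y : C, ∃ (H : C) (ev : H ⊗ X ⟶ Y), IsRightHom ev) :
    (tensorRight X).IsLeftAdjoint := by
  choose H ev hev using h
  choose g hg hu using fun Y => hev Y
  exact (Adjunction.adjunctionOfEquivRight (F := tensorRight X) (G_obj := H)
    (fun Z Y =>
      { toFun := fun f => g Y f
        invFun := fun a => a ▷ X ≫ ev Y
        left_inv := fun f => hg Y f
        right_inv := fun a => (hev Y).hom_ext (hg Y _) })
    (fun Z' Z Y a f => (hev Y).hom_ext <| by
      have h1 := hg Y (a ▷ X ≫ f)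
      have h2 := hg Y f
      dsimp only at h1 h2
      rw [MonoidalCategory.comp_whiskerRight, Category.assoc]
      exact h1.trans (congrArg (a ▷ X ≫ ·) h2.symm))).isLeftAdjoint

lemma whiskerLeft_leftCurry {X Z Y : C} [(tensorLeft X).IsLeftAdjoint] (f : X ⊗ Z ⟶ Y) :
    X ◁ leftCurry f ≫ leftEv X Y = f := by
  have := ((Adjunction.ofIsLeftAdjoint (tensorLeft X)).homEquiv Z Y).symm_apply_apply f
  rwa [Adjunction.homEquiv_counit] at this

lemma whiskerRight_rightCurry {X Z Y : C} [(tensorRight X).IsLeftAdjoint] (f : Z ⊗ X ⟶ Y) :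
    rightCurry f ▷ X ≫ rightEv Y X = f := by
  have := ((Adjunction.ofIsLeftAdjoint (tensorRight X)).homEquiv Z Y).symm_apply_apply f
  rwa [Adjunction.homEquiv_counit] at this

lemma isLeftHom_leftEv (X Y : C) [(tensorLeft X).IsLeftAdjoint] : IsLeftHom (leftEv X Y) :=
  fun Z f => ⟨leftCurry f, whiskerLeft_leftCurry f, fun g hg => by
    rw [← hg]
    exact ((((Adjunction.ofIsLeftAdjoint (tensorLeft X)).homEquiv_counit (g := g)).symm ▸
      Equiv.apply_symm_apply _ g : leftCurry (X ◁ g ≫ leftEv X Y) = g)).symm⟩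

lemma isRightHom_rightEv (Y X : C) [(tensorRight X).IsLeftAdjoint] : IsRightHom (rightEv Y X) :=
  fun Z f => ⟨rightCurry f, whiskerRight_rightCurry f, fun g hg => by
    rw [← hg]
    exact ((((Adjunction.ofIsLeftAdjoint (tensorRight X)).homEquiv_counit (g := g)).symm ▸
      Equiv.apply_symm_apply _ g : rightCurry (g ▷ X ≫ rightEv Y X) = g)).symm⟩

open Functor.LaxMonoidal

/-- By naturality of `μ`, whether `F` preserves universality does not depend on the choice of
evaluation: two universal ones differ by an isomorphism of the representing objects. -/
lemma IsLeftHom.map_of_isIso (F : C ⥤ D) [F.LaxMonoidal] {X H H' Y : C} {ev : X ⊗ H ⟶ Y}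
    (h : IsLeftHom (μ F X H ≫ F.map ev)) {ev' : X ⊗ H' ⟶ Y} {c : H' ⟶ H} [IsIso c]
    (hc : X ◁ c ≫ ev = ev') : IsLeftHom (μ F X H' ≫ F.map ev') :=
  h.of_isIso (c := F.map c) (by rw [← hc, F.map_comp, μ_natural_right_assoc])

lemma IsRightHom.map_of_isIso (F : C ⥤ D) [F.LaxMonoidal] {X H H' Y : C} {ev : H ⊗ X ⟶ Y}
    (h : IsRightHom (μ F H X ≫ F.map ev)) {ev' : H' ⊗ X ⟶ Y} {c : H' ⟶ H} [IsIso c]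
    (hc : c ▷ X ≫ ev = ev') : IsRightHom (μ F H' X ≫ F.map ev') :=
  h.of_isIso (c := F.map c) (by rw [← hc, F.map_comp, μ_natural_left_assoc])

/-- A functor is closed as soon as internal homs exist and some universal evaluations are
preserved. -/
lemma IsClosedFunctor.mk_of_universal (F : C ⥤ D) [F.LaxMonoidal]
    (hl : ∀ X Y : C, ∃ (H : C) (ev : X ⊗ H ⟶ Y), IsLeftHom ev ∧ IsLeftHom (μ F X H ≫ F.map ev))
    (hr : ∀ X Y : C, ∃ (H : C) (ev : H ⊗ X ⟶ Y), IsRightHom ev ∧ IsRightHom (μ F H X ≫ F.map ev))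
    (dl : ∀ X Y : D, ∃ (H : D) (ev : X ⊗ H ⟶ Y), IsLeftHom ev)
    (dr : ∀ X Y : D, ∃ (H : D) (ev : H ⊗ X ⟶ Y), IsRightHom ev) : IsClosedFunctor F := by
  have hC : IsClosedMonoidal C :=
    { left := fun X => tensorLeft_isLeftAdjoint fun Y => by
        obtain ⟨H, ev, h, -⟩ := hl X Y; exact ⟨H, ev, h⟩
      right := fun X => tensorRight_isLeftAdjoint fun Y => by
        obtain ⟨H, ev, h, -⟩ := hr X Y; exact ⟨H, ev, h⟩ }
  have hD : IsClosedMonoidal D :=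
    { left := fun X => tensorLeft_isLeftAdjoint (dl X)
      right := fun X => tensorRight_isLeftAdjoint (dr X) }
  refine { isIso_left := fun X Y => ?_, isIso_right := fun Y X => ?_ }
  · obtain ⟨H, ev, h, hF⟩ := hl X Y
    -- The chosen evaluation differs from `ev` by the isomorphism `c`, so its image is universal as
    -- well. The comparator then relates two universal evaluations and is invertible.
    obtain ⟨c, hc, -⟩ := h (leftEv X Y)
    have : IsIso c := h.isIso (isLeftHom_leftEv X Y) hc
    exact (isLeftHom_leftEv _ _).isIso (hF.map_of_isIso F hc) (whiskerLeft_leftCurry _)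
  · obtain ⟨H, ev, h, hF⟩ := hr X Y
    obtain ⟨c, hc, -⟩ := h (rightEv Y X)
    have : IsIso c := h.isIso (isRightHom_rightEv Y X) hc
    exact (isRightHom_rightEv _ _).isIso (hF.map_of_isIso F hc) (whiskerRight_rightCurry _)

namespace IsClosedFunctor
variable {F : C ⥤ D} [F.LaxMonoidal]

/-- Invertibility of the comparator carries universality from `leftEv (F.obj X) (F.obj Y)` to the
image of `leftEv X Y`; every other universal evaluation is isomorphic to that one. -/
lemma map_isLeftHom (hF : IsClosedFunctor F) {X H Y : C} {ev : X ⊗ H ⟶ Y} (h : IsLeftHom ev) :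
    IsLeftHom (μ F X H ≫ F.map ev) := by
  have := hF.closed_source
  have := hF.closed_target
  have := hF.isIso_left X Y
  obtain ⟨c, hc, -⟩ := isLeftHom_leftEv X Y ev
  have : IsIso c := (isLeftHom_leftEv X Y).isIso h hc
  have h1 : IsLeftHom (μ F X (leftHom X Y) ≫ F.map (leftEv X Y)) :=
    (isLeftHom_leftEv (F.obj X) (F.obj Y)).of_isIso (c := leftComparator F X Y)
      (whiskerLeft_leftCurry _)
  exact h1.map_of_isIso F hc

lemma map_isRightHom (hF : IsClosedFunctor F) {X H Y : C} {ev : H ⊗ X ⟶ Y}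
    (h : IsRightHom ev) : IsRightHom (μ F H X ≫ F.map ev) := by
  have := hF.closed_source
  have := hF.closed_target
  have := hF.isIso_right Y X
  obtain ⟨c, hc, -⟩ := isRightHom_rightEv Y X ev
  have : IsIso c := (isRightHom_rightEv Y X).isIso h hc
  have h1 : IsRightHom (μ F (rightHom Y X) X ≫ F.map (rightEv Y X)) :=
    (isRightHom_rightEv (F.obj Y) (F.obj X)).of_isIso (c := rightComparator F Y X)
      (whiskerRight_rightCurry _)
  exact h1.map_of_isIso F hc

/-- The morphism `c` classifying `ev` becomes invertible under `F`, since it then relates two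
universal evaluations; conservativity makes `c` itself invertible. -/
lemma reflect_isLeftHom (hF : IsClosedFunctor F) [F.ReflectsIsomorphisms] {X H Y : C}
    {ev : X ⊗ H ⟶ Y} (h : IsLeftHom (μ F X H ≫ F.map ev)) : IsLeftHom ev := by
  have := hF.closed_source
  have h0 := isLeftHom_leftEv X Y
  obtain ⟨c, hc, -⟩ := h0 ev
  have : IsIso (F.map c) := (hF.map_isLeftHom h0).isIso h
    (by rw [← hc, F.map_comp, μ_natural_right_assoc])
  have : IsIso c := isIso_of_reflects_iso c F
  exact h0.of_isIso hc

lemma reflect_isRightHom (hF : IsClosedFunctor F) [F.ReflectsIsomorphisms] {X H Y : C}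
    {ev : H ⊗ X ⟶ Y} (h : IsRightHom (μ F H X ≫ F.map ev)) : IsRightHom ev := by
  have := hF.closed_source
  have h0 := isRightHom_rightEv Y X
  obtain ⟨c, hc, -⟩ := h0 ev
  have : IsIso (F.map c) := (hF.map_isRightHom h0).isIso h
    (by rw [← hc, F.map_comp, μ_natural_left_assoc])
  have : IsIso c := isIso_of_reflects_iso c F
  exact h0.of_isIso hc

end IsClosedFunctor

/-- A pairing which identifies each side with the internal hom of the other side. -/
structure IsPerfect {X Y K : C} (ev : X ⊗ Y ⟶ K) : Prop where
  left : IsLeftHom ev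
  right : IsRightHom ev

variable (C) in
/-- Every object is a side of a perfect pairing into `K`. -/
structure HasPerfectPairings (K : C) : Prop where
  left (X : C) : ∃ (H : C) (ev : X ⊗ H ⟶ K), IsPerfect ev
  right (X : C) : ∃ (H : C) (ev : H ⊗ X ⟶ K), IsPerfect ev

lemma HasPerfectPairings.of_iso {K K' : C} (h : HasPerfectPairings C K) (e : K ≅ K') :
    HasPerfectPairings C K' where
  left X := by
    obtain ⟨H, ev, hev⟩ := h.left X
    exact ⟨H, ev ≫ e.hom, hev.left.comp_iso _, hev.right.comp_iso _⟩
  right X := by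
    obtain ⟨H, ev, hev⟩ := h.right X
    exact ⟨H, ev ≫ e.hom, hev.left.comp_iso _, hev.right.comp_iso _⟩

/-- The object `X ⊸ K` is unique up to isomorphism, and one of its models already comes with a
perfect pairing. So one-sided universality implies the other side. -/
lemma HasPerfectPairings.isPerfect_of_isLeftHom {X H K : C} (hK : HasPerfectPairings C K)
    {ev : X ⊗ H ⟶ K} (h : IsLeftHom ev) : IsPerfect ev := by
  obtain ⟨H', ev', h'⟩ := hK.left X
  obtain ⟨c, hc, -⟩ := h'.left ev
  have : IsIso c := h'.left.isIso h hc
  exact ⟨h, hc ▸ h'.right.whiskerLeft_iso c⟩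

lemma HasPerfectPairings.isPerfect_of_isRightHom {X H K : C} (hK : HasPerfectPairings C K)
    {ev : H ⊗ X ⟶ K} (h : IsRightHom ev) : IsPerfect ev := by
  obtain ⟨H', ev', h'⟩ := hK.right X
  obtain ⟨c, hc, -⟩ := h'.right ev
  have : IsIso c := h'.right.isIso h hc
  exact ⟨hc ▸ h'.left.whiskerRight_iso c, h⟩

/-- An object into which every object has perfect pairings is dualizing. -/
lemma HasPerfectPairings.isDualizing {K : C} (h : HasPerfectPairings C K) : IsDualizing K := by
  choose H ev hev using h.right
  choose g hg hu using fun Y => (hev Y).right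
  dsimp only at hg
  -- Right universality alone yields the functor `D` and the representing bijections. Left
  -- universality is only needed for `D` to be an equivalence.
  have hgu : ∀ {X Y : C} (a : X ⟶ H Y) (f : X ⊗ Y ⟶ K), a ▷ Y ≫ ev Y = f → g Y f = a :=
    fun a f e => (hev _).right.hom_ext (by rw [hg, e])
  let D : Cᵒᵖ ⥤ C :=
    { obj := fun Y => H Y.unop
      map := fun {Y Y'} f => g Y'.unop (H Y.unop ◁ f.unop ≫ ev Y.unop)
      map_id := fun Y => hgu _ _ (by simp)
      map_comp := fun {Y Y' Y''} f f' => hgu _ _ (by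
        rw [MonoidalCategory.comp_whiskerRight, Category.assoc, hg, ← whisker_exchange_assoc, hg,
          unop_comp, MonoidalCategory.whiskerLeft_comp, Category.assoc]) }
  have hD : ∀ {Y Y' : C} (f : Y' ⟶ Y), D.map f.op ▷ Y' ≫ ev Y' = H Y ◁ f ≫ ev Y :=
    fun {Y Y'} f => hg Y' (H Y ◁ f ≫ ev Y)
  refine ⟨D, fun X Y =>
    { toFun := fun f => g Y f
      invFun := fun a => a ▷ Y ≫ ev Y
      left_inv := fun f => hg Y f
      right_inv := fun a => hgu a _ rfl }, fun X' X Y f a => hgu _ _ ?_, fun X Y' Y f a =>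
      hgu _ _ ?_, ?_⟩
  · rw [MonoidalCategory.comp_whiskerRight, Category.assoc]
    exact congrArg (f ▷ Y ≫ ·) (hg Y a)
  · rw [MonoidalCategory.comp_whiskerRight, Category.assoc, hD, ← whisker_exchange_assoc]
    exact congrArg (X ◁ f ≫ ·) (hg Y a)
  -- By `hD`, `f` and `D f` induce the same pairing `H Y ⊗ Y' ⟶ K`. Left universality makes `f` the
  -- unique morphism with that pairing, right universality does so for `D f`; hence `D` is bijective
  -- on morphisms.
  · have faithful : D.Faithful := ⟨fun {Y Y'} a b e => Quiver.Hom.unop_inj <|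
      (hev Y.unop).left.hom_ext <| by
        rw [← hD, ← hD]
        exact congrArg (· ▷ Y'.unop ≫ ev Y'.unop) e⟩
    have full : D.Full := ⟨fun {Y Y'} c => by
      obtain ⟨f, hf, -⟩ := (hev Y.unop).left (c ▷ Y'.unop ≫ ev Y'.unop)
      exact ⟨f.op, (hev Y'.unop).right.hom_ext ((hD f).trans hf)⟩⟩
    -- A perfect pairing with `X` on the left and `X'` on the right makes `X` a right internal hom
    -- from `X'` to `K`, hence isomorphic to `D X'`.
    have essSurj : D.EssSurj := ⟨fun X => by
      obtain ⟨X', ev', h'⟩ := h.left X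
      obtain ⟨c, hc, -⟩ := (hev X').right ev'
      have : IsIso c := (hev X').right.isIso h'.right hc
      exact ⟨op X', ⟨(asIso c).symm⟩⟩⟩
    exact { }

/-- A conservative closed monoidal functor reflects r-categories. -/
lemma IsClosedFunctor.isRCategory {F : C ⥤ D} [F.Monoidal] [F.ReflectsIsomorphisms]
    (hF : IsClosedFunctor F) (hD : HasPerfectPairings D (𝟙_ D)) : IsRCategory C := by
  have hD' : HasPerfectPairings D (F.obj (𝟙_ C)) := hD.of_iso (Functor.Monoidal.εIso F)
  have := hF.closed_source
  refine HasPerfectPairings.isDualizing ⟨fun X => ?_, fun X => ?_⟩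
  -- Left universality passes to `D`, becomes perfectness there, and the right half of perfectness
  -- is reflected back.
  · have h := isLeftHom_leftEv X (𝟙_ C)
    exact ⟨_, leftEv X _, h, hF.reflect_isRightHom
      (hD'.isPerfect_of_isLeftHom (hF.map_isLeftHom h)).right⟩
  · have h := isRightHom_rightEv (𝟙_ C) X
    exact ⟨_, rightEv _ X, hF.reflect_isLeftHom
      (hD'.isPerfect_of_isRightHom (hF.map_isRightHom h)).left, h⟩

end Universal

/-! ### Restriction to full monoidal subcategories -/

section Restriction
variable {C : Type u₁} [Category.{v₁} C] [MonoidalCategory C]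
variable {D : Type u₂} [Category.{v₂} D] [MonoidalCategory D]

lemma isLeftHom_fullSubcategory {P : ObjectProperty C} [P.IsMonoidal] {X H Y : C}
    {ev : X ⊗ H ⟶ Y} (h : IsLeftHom ev) (hX : P X) (hH : P H) (hY : P Y) :
    IsLeftHom (C := P.FullSubcategory) (X := ⟨X, hX⟩) (H := ⟨H, hH⟩) (Y := ⟨Y, hY⟩)
      (P.homMk ev) := fun Z f => by
  obtain ⟨g, hg, hu⟩ := h f.hom
  refine ⟨P.homMk g, ?_, fun g' hg' => ?_⟩
  · ext; exact hg
  · ext; exact hu g'.hom (congrArg (fun a => a.hom) hg')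

lemma isRightHom_fullSubcategory {P : ObjectProperty C} [P.IsMonoidal] {X H Y : C}
    {ev : H ⊗ X ⟶ Y} (h : IsRightHom ev) (hX : P X) (hH : P H) (hY : P Y) :
    IsRightHom (C := P.FullSubcategory) (X := ⟨X, hX⟩) (H := ⟨H, hH⟩) (Y := ⟨Y, hY⟩)
      (P.homMk ev) := fun Z f => by
  obtain ⟨g, hg, hu⟩ := h f.hom
  refine ⟨P.homMk g, ?_, fun g' hg' => ?_⟩
  · ext; exact hg
  · ext; exact hu g'.hom (congrArg (fun a => a.hom) hg')

variable (F : C ⥤ D) [F.Monoidal] (P : ObjectProperty D) [P.IsMonoidal]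
  [P.IsClosedUnderIsomorphisms]

open Functor.LaxMonoidal

/-- The restriction of a functor to objects satisfying `P` is closed if it preserves internal homs
of such objects and these satisfy `P`. -/
lemma isClosedFunctor_restrictedFunctor
    (hl : ∀ X Y : C, P (F.obj X) → P (F.obj Y) → ∃ (H : C) (ev : X ⊗ H ⟶ Y),
      P (F.obj H) ∧ IsLeftHom ev ∧ IsLeftHom (μ F X H ≫ F.map ev))
    (hr : ∀ X Y : C, P (F.obj X) → P (F.obj Y) → ∃ (H : C) (ev : H ⊗ X ⟶ Y),
      P (F.obj H) ∧ IsRightHom ev ∧ IsRightHom (μ F H X ≫ F.map ev))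
    (dl : ∀ X Y : D, P X → P Y → ∃ (H : D) (ev : X ⊗ H ⟶ Y), P H ∧ IsLeftHom ev)
    (dr : ∀ X Y : D, P X → P Y → ∃ (H : D) (ev : H ⊗ X ⟶ Y), P H ∧ IsRightHom ev) :
    IsClosedFunctor (restrictedFunctor F P) := by
  refine .mk_of_universal _ (fun X Y => ?_) (fun X Y => ?_) (fun X Y => ?_) (fun X Y => ?_)
  · obtain ⟨H, ev, hH, h, hF⟩ := hl X.obj Y.obj X.property Y.property
    exact ⟨⟨H, hH⟩, ObjectProperty.homMk ev,
      isLeftHom_fullSubcategory (P := P.inverseImage F) h X.property hH Y.property,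
      isLeftHom_fullSubcategory hF X.property hH Y.property⟩
  · obtain ⟨H, ev, hH, h, hF⟩ := hr X.obj Y.obj X.property Y.property
    exact ⟨⟨H, hH⟩, ObjectProperty.homMk ev,
      isRightHom_fullSubcategory (P := P.inverseImage F) h X.property hH Y.property,
      isRightHom_fullSubcategory hF X.property hH Y.property⟩
  · obtain ⟨H, ev, hH, h⟩ := dl X.obj Y.obj X.property Y.property
    exact ⟨⟨H, hH⟩, _, isLeftHom_fullSubcategory h X.property hH Y.property⟩
  · obtain ⟨H, ev, hH, h⟩ := dr X.obj Y.obj X.property Y.property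
    exact ⟨⟨H, hH⟩, _, isRightHom_fullSubcategory h X.property hH Y.property⟩

lemma hasPerfectPairings_fullSubcategory
    (hl : ∀ X : D, P X → ∃ (H : D) (ev : X ⊗ H ⟶ 𝟙_ D), P H ∧ IsPerfect ev)
    (hr : ∀ X : D, P X → ∃ (H : D) (ev : H ⊗ X ⟶ 𝟙_ D), P H ∧ IsPerfect ev) :
    HasPerfectPairings P.FullSubcategory (𝟙_ P.FullSubcategory) where
  left X := by
    obtain ⟨H, ev, hH, h⟩ := hl X.obj X.property
    exact ⟨⟨H, hH⟩, _, isLeftHom_fullSubcategory h.left X.property hH _,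
      isRightHom_fullSubcategory h.right hH X.property P.prop_unit⟩
  right X := by
    obtain ⟨H, ev, hH, h⟩ := hr X.obj X.property
    exact ⟨⟨H, hH⟩, _, isLeftHom_fullSubcategory h.left hH X.property _,
      isRightHom_fullSubcategory h.right X.property hH P.prop_unit⟩

instance [F.ReflectsIsomorphisms] : (restrictedFunctor F P).ReflectsIsomorphisms where
  reflects {X Y} f hf := by
    have : IsIso (F.map f.hom) := inferInstanceAs (IsIso (P.ι.map ((restrictedFunctor F P).map f)))
    have : IsIso ((P.inverseImage F).ι.map f) := isIso_of_reflects_iso f.hom F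
    exact isIso_of_reflects_iso f (P.inverseImage F).ι

end Restriction
-- Modules over Hopf monads
section HopfMonad

variable {C : Type u₁} [Category.{v₁} C] [MonoidalCategory C] {T : Monad C} [Bimonad T]

open Functor.OplaxMonoidal

/-- The canonical morphism `T (M ⊗ Y) ⟶ M ⊗ T Y` for a module `M`. -/
def moduleLeftFusion (M : T.Algebra) (Y : C) : T.obj (M.A ⊗ Y) ⟶ M.A ⊗ T.obj Y :=
  δ T.toFunctor M.A Y ≫ M.a ▷ T.obj Y

/-- The canonical morphism `T (Y ⊗ M) ⟶ T Y ⊗ M` for a module `M`. -/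
def moduleRightFusion (M : T.Algebra) (Y : C) : T.obj (Y ⊗ M.A) ⟶ T.obj Y ⊗ M.A :=
  δ T.toFunctor Y M.A ≫ T.obj Y ◁ M.a

lemma moduleLeftFusion_naturality {M N : T.Algebra} (f : M ⟶ N) (Y : C) :
    T.map (f.f ▷ Y) ≫ moduleLeftFusion N Y = moduleLeftFusion M Y ≫ f.f ▷ T.obj Y := by
  rw [moduleLeftFusion, moduleLeftFusion, Category.assoc, ← MonoidalCategory.comp_whiskerRight,
    ← f.h, MonoidalCategory.comp_whiskerRight, δ_natural_left_assoc]

lemma moduleRightFusion_naturality {M N : T.Algebra} (f : M ⟶ N) (Y : C) :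
    T.map (Y ◁ f.f) ≫ moduleRightFusion N Y = moduleRightFusion M Y ≫ T.obj Y ◁ f.f := by
  rw [moduleRightFusion, moduleRightFusion, Category.assoc, ← MonoidalCategory.whiskerLeft_comp,
    ← f.h, MonoidalCategory.whiskerLeft_comp, δ_natural_right_assoc]

/-- The structure morphism of a module, as a morphism from the free module. -/
def moduleAct (M : T.Algebra) : T.free.obj M.A ⟶ M where
  f := M.a
  h := M.assoc.symm

/-- For a free module this morphism is the fusion operator. A general module is the quotient of `T M
` by `T T M`, and this presentation is split in the base category by the unit of `T`; naturality in
the module then transports the inverse, which is the composite `j`. -/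
lemma isIso_moduleLeftFusion (hT : IsHopfMonad T) (M : T.Algebra) (Y : C) :
    IsIso (moduleLeftFusion M Y) := by
  have hfree := hT.left
  have h₁ : T.map (M.a ▷ Y) ≫ moduleLeftFusion M Y =
      leftFusion T M.A Y ≫ M.a ▷ T.obj Y :=
    moduleLeftFusion_naturality (moduleAct M) Y
  have h₂ : T.map (T.map M.a ▷ Y) ≫ leftFusion T M.A Y =
      leftFusion T (T.obj M.A) Y ≫ T.map M.a ▷ T.obj Y :=
    moduleLeftFusion_naturality (T.free.map M.a) Y
  have h₃ : T.map (T.μ.app M.A ▷ Y) ≫ leftFusion T M.A Y =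
      leftFusion T (T.obj M.A) Y ≫ T.μ.app M.A ▷ T.obj Y :=
    moduleLeftFusion_naturality (moduleAct (T.free.obj M.A)) Y
  have hη : M.a ▷ T.obj Y ≫ T.η.app M.A ▷ T.obj Y =
      T.η.app (T.obj M.A) ▷ T.obj Y ≫ T.map M.a ▷ T.obj Y := by
    rw [← MonoidalCategory.comp_whiskerRight, ← MonoidalCategory.comp_whiskerRight]
    exact congrArg (· ▷ T.obj Y) (T.η.naturality M.a)
  have hsplit : T.map (T.η.app M.A ▷ Y) ≫ T.map (M.a ▷ Y) = 𝟙 _ := by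
    rw [← T.map_comp, ← MonoidalCategory.comp_whiskerRight, M.unit]; simp
  let j := T.η.app M.A ▷ T.obj Y ≫ inv (leftFusion T M.A Y) ≫ T.map (M.a ▷ Y)
  refine ⟨j, ?_, ?_⟩
  -- As `T.map (M.a ▷ Y)` is a split epimorphism, it suffices to check the identity after it.
  -- Naturality of the unit and of the fusion operator brings `T.map M.a` in front of `M.a`, where
  -- it may be replaced by `μ`; the latter cancels against the unit.
  · have key : T.map (M.a ▷ Y) ≫ moduleLeftFusion M Y ≫ j = T.map (M.a ▷ Y) := by
      simp only [j]
      rw [reassoc_of% h₁, reassoc_of% hη]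
      have e₂ : T.map M.a ▷ T.obj Y ≫ inv (leftFusion T M.A Y) =
          inv (leftFusion T (T.obj M.A) Y) ≫ T.map (T.map M.a ▷ Y) := by
        rw [IsIso.comp_inv_eq, Category.assoc, h₂]; simp
      have e₃ : inv (leftFusion T (T.obj M.A) Y) ≫ T.map (T.μ.app M.A ▷ Y) =
          T.μ.app M.A ▷ T.obj Y ≫ inv (leftFusion T M.A Y) := by
        rw [IsIso.inv_comp_eq, ← reassoc_of% h₃]; simp
      have e₄ : T.map (T.map M.a ▷ Y) ≫ T.map (M.a ▷ Y) =
          T.map (T.μ.app M.A ▷ Y) ≫ T.map (M.a ▷ Y) := by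
        rw [← T.map_comp, ← T.map_comp, ← MonoidalCategory.comp_whiskerRight,
          ← MonoidalCategory.comp_whiskerRight, M.assoc]
      have e₅ : T.η.app (T.obj M.A) ▷ T.obj Y ≫ T.μ.app M.A ▷ T.obj Y = 𝟙 _ := by
        rw [← MonoidalCategory.comp_whiskerRight, T.left_unit]; simp
      rw [reassoc_of% e₂, e₄, reassoc_of% e₃, reassoc_of% e₅]; simp
    calc moduleLeftFusion M Y ≫ j
        = (T.map (T.η.app M.A ▷ Y) ≫ T.map (M.a ▷ Y)) ≫ moduleLeftFusion M Y ≫ j := by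
          rw [hsplit, Category.id_comp]
      _ = 𝟙 _ := by rw [Category.assoc, key, hsplit]
  · simp only [j, Category.assoc]
    rw [h₁, IsIso.inv_hom_id_assoc, ← MonoidalCategory.comp_whiskerRight, M.unit]; simp

lemma isIso_moduleRightFusion (hT : IsHopfMonad T) (M : T.Algebra) (Y : C) :
    IsIso (moduleRightFusion M Y) := by
  have hfree := hT.right
  have h₁ : T.map (Y ◁ M.a) ≫ moduleRightFusion M Y =
      rightFusion T Y M.A ≫ T.obj Y ◁ M.a :=
    moduleRightFusion_naturality (moduleAct M) Y
  have h₂ : T.map (Y ◁ T.map M.a) ≫ rightFusion T Y M.A =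
      rightFusion T Y (T.obj M.A) ≫ T.obj Y ◁ T.map M.a :=
    moduleRightFusion_naturality (T.free.map M.a) Y
  have h₃ : T.map (Y ◁ T.μ.app M.A) ≫ rightFusion T Y M.A =
      rightFusion T Y (T.obj M.A) ≫ T.obj Y ◁ T.μ.app M.A :=
    moduleRightFusion_naturality (moduleAct (T.free.obj M.A)) Y
  have hη : T.obj Y ◁ M.a ≫ T.obj Y ◁ T.η.app M.A =
      T.obj Y ◁ T.η.app (T.obj M.A) ≫ T.obj Y ◁ T.map M.a := by
    rw [← MonoidalCategory.whiskerLeft_comp, ← MonoidalCategory.whiskerLeft_comp]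
    exact congrArg (T.obj Y ◁ ·) (T.η.naturality M.a)
  have hsplit : T.map (Y ◁ T.η.app M.A) ≫ T.map (Y ◁ M.a) = 𝟙 _ := by
    rw [← T.map_comp, ← MonoidalCategory.whiskerLeft_comp, M.unit]; simp
  let j := T.obj Y ◁ T.η.app M.A ≫ inv (rightFusion T Y M.A) ≫ T.map (Y ◁ M.a)
  refine ⟨j, ?_, ?_⟩
  · have key : T.map (Y ◁ M.a) ≫ moduleRightFusion M Y ≫ j = T.map (Y ◁ M.a) := by
      simp only [j]
      rw [reassoc_of% h₁, reassoc_of% hη]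
      have e₂ : T.obj Y ◁ T.map M.a ≫ inv (rightFusion T Y M.A) =
          inv (rightFusion T Y (T.obj M.A)) ≫ T.map (Y ◁ T.map M.a) := by
        rw [IsIso.comp_inv_eq, Category.assoc, h₂]; simp
      have e₃ : inv (rightFusion T Y (T.obj M.A)) ≫ T.map (Y ◁ T.μ.app M.A) =
          T.obj Y ◁ T.μ.app M.A ≫ inv (rightFusion T Y M.A) := by
        rw [IsIso.inv_comp_eq, ← reassoc_of% h₃]; simp
      have e₄ : T.map (Y ◁ T.map M.a) ≫ T.map (Y ◁ M.a) =
          T.map (Y ◁ T.μ.app M.A) ≫ T.map (Y ◁ M.a) := by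
        rw [← T.map_comp, ← T.map_comp, ← MonoidalCategory.whiskerLeft_comp,
          ← MonoidalCategory.whiskerLeft_comp, M.assoc]
      have e₅ : T.obj Y ◁ T.η.app (T.obj M.A) ≫ T.obj Y ◁ T.μ.app M.A = 𝟙 _ := by
        rw [← MonoidalCategory.whiskerLeft_comp, T.left_unit]; simp
      rw [reassoc_of% e₂, e₄, reassoc_of% e₃, reassoc_of% e₅]; simp
    calc moduleRightFusion M Y ≫ j
        = (T.map (Y ◁ T.η.app M.A) ≫ T.map (Y ◁ M.a)) ≫ moduleRightFusion M Y ≫ j := by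
          rw [hsplit, Category.id_comp]
      _ = 𝟙 _ := by rw [Category.assoc, key, hsplit]
  · simp only [j, Category.assoc]
    rw [h₁, IsIso.inv_hom_id_assoc, ← MonoidalCategory.whiskerLeft_comp, M.unit]; simp

/-- Together with `mul_moduleLeftFusion` this says that `moduleLeftFusion` distributes `T` over `M ⊗
-` compatibly with the monad structure. The two identities yield the unit and associativity laws of
the action on internal homs. -/
lemma unit_moduleLeftFusion (M : T.Algebra) (Y : C) :
    T.η.app (M.A ⊗ Y) ≫ moduleLeftFusion M Y = M.A ◁ T.η.app Y := by
  rw [moduleLeftFusion, ← Category.assoc, Bimonad.unit_comul, tensorHom_def', Category.assoc,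
    ← MonoidalCategory.comp_whiskerRight, M.unit]
  simp

lemma unit_moduleRightFusion (M : T.Algebra) (Y : C) :
    T.η.app (Y ⊗ M.A) ≫ moduleRightFusion M Y = T.η.app Y ▷ M.A := by
  rw [moduleRightFusion, ← Category.assoc, Bimonad.unit_comul,
    MonoidalCategory.tensorHom_def, Category.assoc,
    ← MonoidalCategory.whiskerLeft_comp, M.unit]
  simp

lemma mul_moduleLeftFusion (M : T.Algebra) (Y : C) :
    T.μ.app (M.A ⊗ Y) ≫ moduleLeftFusion M Y =
      T.map (moduleLeftFusion M Y) ≫ moduleLeftFusion M (T.obj Y) ≫ M.A ◁ T.μ.app Y := by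
  simp only [moduleLeftFusion, Functor.map_comp, Category.assoc]
  rw [← Category.assoc, Bimonad.mu_comul, ← δ_natural_left_assoc]
  simp only [Category.assoc, tensorHom_def', whisker_exchange]
  simp only [← MonoidalCategory.comp_whiskerRight_assoc, M.assoc]

lemma mul_moduleRightFusion (M : T.Algebra) (Y : C) :
    T.μ.app (Y ⊗ M.A) ≫ moduleRightFusion M Y =
      T.map (moduleRightFusion M Y) ≫ moduleRightFusion M (T.obj Y) ≫ T.μ.app Y ▷ M.A := by
  simp only [moduleRightFusion, Functor.map_comp, Category.assoc]
  rw [← Category.assoc, Bimonad.mu_comul, ← δ_natural_right_assoc]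
  simp only [Category.assoc, MonoidalCategory.tensorHom_def, ← whisker_exchange]
  simp only [← MonoidalCategory.whiskerLeft_comp_assoc, M.assoc]

lemma moduleLeftFusion_map (M : T.Algebra) {Y Y' : C} (f : Y ⟶ Y') :
    T.map (M.A ◁ f) ≫ moduleLeftFusion M Y' = moduleLeftFusion M Y ≫ M.A ◁ T.map f := by
  simp only [moduleLeftFusion, Category.assoc, ← whisker_exchange]
  rw [← δ_natural_right_assoc]

lemma moduleRightFusion_map (M : T.Algebra) {Y Y' : C} (f : Y ⟶ Y') :
    T.map (f ▷ M.A) ≫ moduleRightFusion M Y' = moduleRightFusion M Y ≫ T.map f ▷ M.A := by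
  simp only [moduleRightFusion, Category.assoc, whisker_exchange]
  rw [← δ_natural_left_assoc]

/-- Internal homs lift to modules over a Hopf monad. -/
lemma exists_isLeftHom_algebra (hT : IsHopfMonad T) (M N : T.Algebra) {H : C} {ev : M.A ⊗ H ⟶ N.A}
    (hev : IsLeftHom ev) : ∃ (H' : T.Algebra) (e : H'.A = H) (ev' : M ⊗ H' ⟶ N),
      ev'.f = M.A ◁ eqToHom e ≫ ev ∧ IsLeftHom ev' := by
  have hiso := isIso_moduleLeftFusion hT M
  -- The action on `H` is the transpose of `M ⊗ T H ≅ T (M ⊗ H) ⟶ T N ⟶ N`; it is the only action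
  -- for which `ev` is a morphism of modules. Its axioms are tested through `ev`, after cancelling
  -- fusion isomorphisms.
  obtain ⟨b, hb, -⟩ := hev (inv (moduleLeftFusion M H) ≫ T.map ev ≫ N.a)
  replace hb : moduleLeftFusion M H ≫ M.A ◁ b ≫ ev = T.map ev ≫ N.a :=
    (congrArg (moduleLeftFusion M H ≫ ·) hb).trans (by simp)
  let H' : T.Algebra :=
    { A := H
      a := b
      unit := hev.hom_ext <| by
        rw [MonoidalCategory.whiskerLeft_comp, Category.assoc, ← unit_moduleLeftFusion,
          Category.assoc, hb, ← T.η.naturality_assoc, N.unit]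
        simp
      assoc := hev.hom_ext <| by
        rw [← cancel_epi (moduleLeftFusion M (T.obj H)),
          ← cancel_epi (T.map (moduleLeftFusion M H)),
          MonoidalCategory.whiskerLeft_comp, MonoidalCategory.whiskerLeft_comp,
          Category.assoc, Category.assoc, ← reassoc_of% mul_moduleLeftFusion, hb,
          ← reassoc_of% moduleLeftFusion_map, hb, ← T.μ.naturality_assoc, N.assoc,
          ← T.map_comp_assoc, ← T.map_comp_assoc, Category.assoc, hb]
        simp }
  refine ⟨H', rfl, ⟨ev, ?_⟩, by simp; rfl, fun Z f => ?_⟩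
  · change _ = (δ T.toFunctor M.A H ≫ (M.a ⊗ₘ b)) ≫ ev
    refine hb.symm.trans ?_
    rw [MonoidalCategory.tensorHom_def, moduleLeftFusion]; simp
  · obtain ⟨f, hf⟩ := f
    change M.A ⊗ Z.A ⟶ N.A at f
    change T.map f ≫ N.a = (δ T.toFunctor M.A Z.A ≫ (M.a ⊗ₘ Z.a)) ≫ f at hf
    obtain ⟨g, hg, hu⟩ := hev f
    refine ⟨⟨g, hev.hom_ext ?_⟩, ?_, fun g' hg' => ?_⟩
    -- The transpose of a module morphism is again one: tested through `ev` and precomposed with the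
    -- fusion isomorphism, its linearity becomes `hf`.
    · change M.A ◁ (T.map g ≫ b) ≫ ev = M.A ◁ (Z.a ≫ g) ≫ ev
      rw [← cancel_epi (moduleLeftFusion M Z.A), MonoidalCategory.whiskerLeft_comp,
        MonoidalCategory.whiskerLeft_comp, Category.assoc, Category.assoc, hg,
        ← reassoc_of% moduleLeftFusion_map, hb, ← T.map_comp_assoc, hg]
      refine hf.trans ?_
      rw [MonoidalCategory.tensorHom_def, moduleLeftFusion]
      simp only [Category.assoc]
    · ext; exact hg
    · ext; exact hu g'.f (congrArg (fun a => a.f) hg')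

/-- The mirror image, with `moduleRightFusion`. The carrier of the lift is equal to `H`, not just
isomorphic, so that substituting along `e` leaves the evaluation and any property of `H` untouched.
-/
lemma exists_isRightHom_algebra (hT : IsHopfMonad T) (M N : T.Algebra) {H : C}
    {ev : H ⊗ M.A ⟶ N.A} (hev : IsRightHom ev) :
    ∃ (H' : T.Algebra) (e : H'.A = H) (ev' : H' ⊗ M ⟶ N),
      ev'.f = eqToHom e ▷ M.A ≫ ev ∧ IsRightHom ev' := by
  have hiso := isIso_moduleRightFusion hT M
  obtain ⟨b, hb, -⟩ := hev (inv (moduleRightFusion M H) ≫ T.map ev ≫ N.a)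
  replace hb : moduleRightFusion M H ≫ b ▷ M.A ≫ ev = T.map ev ≫ N.a :=
    (congrArg (moduleRightFusion M H ≫ ·) hb).trans (by simp)
  let H' : T.Algebra :=
    { A := H
      a := b
      unit := hev.hom_ext <| by
        rw [MonoidalCategory.comp_whiskerRight, Category.assoc, ← unit_moduleRightFusion,
          Category.assoc, hb, ← T.η.naturality_assoc, N.unit]
        simp
      assoc := hev.hom_ext <| by
        rw [← cancel_epi (moduleRightFusion M (T.obj H)),
          ← cancel_epi (T.map (moduleRightFusion M H)),
          MonoidalCategory.comp_whiskerRight, MonoidalCategory.comp_whiskerRight,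
          Category.assoc, Category.assoc, ← reassoc_of% mul_moduleRightFusion, hb,
          ← reassoc_of% moduleRightFusion_map, hb, ← T.μ.naturality_assoc, N.assoc,
          ← T.map_comp_assoc, ← T.map_comp_assoc, Category.assoc, hb]
        simp }
  refine ⟨H', rfl, ⟨ev, ?_⟩, by simp; rfl, fun Z f => ?_⟩
  · change _ = (δ T.toFunctor H M.A ≫ (b ⊗ₘ M.a)) ≫ ev
    refine hb.symm.trans ?_
    rw [tensorHom_def', moduleRightFusion]; simp
  · obtain ⟨f, hf⟩ := f
    change Z.A ⊗ M.A ⟶ N.A at f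
    change T.map f ≫ N.a = (δ T.toFunctor Z.A M.A ≫ (Z.a ⊗ₘ M.a)) ≫ f at hf
    obtain ⟨g, hg, hu⟩ := hev f
    refine ⟨⟨g, hev.hom_ext ?_⟩, ?_, fun g' hg' => ?_⟩
    · change (T.map g ≫ b) ▷ M.A ≫ ev = (Z.a ≫ g) ▷ M.A ≫ ev
      rw [← cancel_epi (moduleRightFusion M Z.A), MonoidalCategory.comp_whiskerRight,
        MonoidalCategory.comp_whiskerRight, Category.assoc, Category.assoc, hg,
        ← reassoc_of% moduleRightFusion_map, hb, ← T.map_comp_assoc, hg]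
      refine hf.trans ?_
      rw [tensorHom_def', moduleRightFusion]
      simp only [Category.assoc]
    · ext; exact hg
    · ext; exact hu g'.f (congrArg (fun a => a.f) hg')

lemma IsHopfMonad.isClosedFunctor_restricted (hT : IsHopfMonad T) (P : ObjectProperty C)
    [P.IsMonoidal] [P.IsClosedUnderIsomorphisms]
    (hl : ∀ X Y : C, P X → P Y → ∃ (H : C) (ev : X ⊗ H ⟶ Y), P H ∧ IsLeftHom ev)
    (hr : ∀ X Y : C, P X → P Y → ∃ (H : C) (ev : H ⊗ X ⟶ Y), P H ∧ IsRightHom ev) :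
    IsClosedFunctor (restrictedFunctor T.forget P) := by
  refine isClosedFunctor_restrictedFunctor _ _ (fun M N hM hN => ?_) (fun M N hM hN => ?_) hl hr
  · obtain ⟨H, ev, hH, hev⟩ := hl M.A N.A hM hN
    obtain ⟨H', rfl, ev', he, hev'⟩ := exists_isLeftHom_algebra hT M N hev
    refine ⟨H', ev', hH, hev', ?_⟩
    -- The forgetful functor is strict, so its `μ` is an identity and the image of the lifted
    -- evaluation is `ev` itself.
    have : Functor.LaxMonoidal.μ T.forget M H' ≫ T.forget.map ev' = ev :=
      (Category.id_comp ev'.f).trans (he.trans (by simp; rfl))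
    rw [this]; exact hev
  · obtain ⟨H, ev, hH, hev⟩ := hr M.A N.A hM hN
    obtain ⟨H', rfl, ev', he, hev'⟩ := exists_isRightHom_algebra hT M N hev
    refine ⟨H', ev', hH, hev', ?_⟩
    have : Functor.LaxMonoidal.μ T.forget H' M ≫ T.forget.map ev' = ev :=
      (Category.id_comp ev'.f).trans (he.trans (by simp; rfl))
    rw [this]; exact hev

end HopfMonad
-- Frobenius forms and reflexivity
section Frobenius
variable {k R : Type u} [Field k]

/-- Nondegeneracy says that `r ↦ form (r * -)` embeds `R` into its `k`-dual, which has the same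
dimension. -/
lemma IsFrobeniusForm.exists_mul_eq [Ring R] [Algebra k R] [FiniteDimensional k R]
    {form : R →ₗ[k] k} (h : IsFrobeniusForm form) (ψ : R →ₗ[k] k) :
    ∃ r : R, ∀ s : R, form (r * s) = ψ s := by
  let e : R →ₗ[k] Module.Dual k R := (LinearMap.mul k R).compr₂ form
  have he : Function.Injective e := by
    rw [injective_iff_map_eq_zero]
    exact fun x hx => h x fun y => congrArg (fun a : Module.Dual k R => a y) hx
  obtain ⟨r, hr⟩ := (LinearMap.injective_iff_surjective_of_finrank_eq_finrank
    Subspace.dual_finrank_eq.symm).1 he ψ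
  exact ⟨r, fun s => congrArg (fun a : Module.Dual k R => a s) hr⟩

lemma IsFrobeniusForm.eq_of_forall [Ring R] [Algebra k R]
    {form : R →ₗ[k] k} (h : IsFrobeniusForm form) {x y : R}
    (e : ∀ s, form (x * s) = form (y * s)) : x = y :=
  sub_eq_zero.1 (h _ fun s => by rw [sub_mul, map_sub, e, sub_self])

variable [CommRing R] [Algebra k R] [FiniteDimensional k R]
  {form : R →ₗ[k] k} (h : IsFrobeniusForm form)
  {N : Type u} [AddCommGroup N] [Module R N] [Module k N] [IsScalarTower k R N]

include h in
-- This is the surjectivity of `Hom_R(N, R) → Hom_k(N, k)`, `φ ↦ form ∘ φ`: the value `φ n` is the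
-- element of `R` that represents `s ↦ ψ (s • n)`. Its uniqueness makes `φ` linear over `R`.
lemma IsFrobeniusForm.exists_linearMap (ψ : N →ₗ[k] k) :
    ∃ φ : N →ₗ[R] R, ∀ n, form (φ n) = ψ n := by
  choose φ hφ using fun n : N =>
    h.exists_mul_eq (ψ ∘ₗ (LinearMap.toSpanSingleton R N n).restrictScalars k)
  replace hφ : ∀ n s, form (φ n * s) = ψ (s • n) := hφ
  refine ⟨{ toFun := φ, map_add' := fun a b => h.eq_of_forall fun s => ?_,
            map_smul' := fun r n => h.eq_of_forall fun s => ?_ }, fun n => ?_⟩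
  · simp only [add_mul, map_add, hφ, smul_add]
  · change _ = form (r * φ n * s)
    rw [hφ, mul_comm r, mul_assoc, hφ, smul_smul, mul_comm]
  · simpa using hφ n 1

include h in
-- Composition with `form` identifies `R`-valued with `k`-valued functionals, so reflexivity over
-- `R` follows from reflexivity of finite-dimensional vector spaces.
lemma IsFrobeniusForm.isReflexive [Module.Finite k N] : Module.IsReflexive R N := by
  refine ⟨(injective_iff_map_eq_zero _).2 fun n hn => ?_, fun α => ?_⟩
  · rw [← Module.forall_dual_apply_eq_zero_iff k]
    intro ψ
    obtain ⟨φ, hφ⟩ := h.exists_linearMap ψ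
    rw [← hφ, show φ n = 0 from congrArg (fun a : Module.Dual R (Module.Dual R N) => a φ) hn,
      map_zero]
  · choose φ hφ using h.exists_linearMap (N := N)
    have hφu (a : N →ₗ[R] R) (ψ : N →ₗ[k] k) (e : ∀ n, form (a n) = ψ n) : φ ψ = a := by
      ext n
      refine h.eq_of_forall fun s => ?_
      rw [mul_comm, mul_comm (a n), ← smul_eq_mul, ← smul_eq_mul, ← map_smul, ← map_smul, hφ, e]
    -- The element `α` of the `R`-bidual, transported to the `k`-bidual; the vector representing `β`
    -- also represents `α`.
    let β : Module.Dual k (Module.Dual k N) :=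
      { toFun := fun ψ => form (α (φ ψ))
        map_add' := fun ψ ψ' => by
          rw [hφu (φ ψ + φ ψ') (ψ + ψ') fun n => by simp [hφ], map_add, map_add]
        map_smul' := fun c ψ => by
          rw [hφu (c • φ ψ) (c • ψ) fun n => by simp [hφ], ← algebraMap_smul R c, map_smul,
            algebraMap_smul, map_smul]; rfl }
    obtain ⟨n, hn⟩ := (Module.bijective_dual_eval k N).2 β
    refine ⟨n, LinearMap.ext fun a => h.eq_of_forall fun s => ?_⟩
    -- Testing on the functional `form ∘ (s • a)`, whose `R`-linear lift is `s • a`, compares `a n`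
    -- and `α a` after multiplication by an arbitrary `s`.
    have h1 := congrArg (fun b : Module.Dual k (Module.Dual k N) =>
      b (form ∘ₗ (s • a).restrictScalars k)) hn
    change form (s • a n) = form (α (φ _)) at h1
    rw [hφu (s • a) _ fun n => rfl, map_smul α] at h1
    rw [mul_comm, mul_comm (α a)]
    exact h1

end Frobenius

/-! ### Internal homs and perfect pairings of modules over a commutative ring -/

section CommRing
variable {R : Type u} [CommRing R]

/-- The evaluation `X ⊗ Hom(X, Y) ⟶ Y`. -/
noncomputable def modLeftEv (X Y : ModuleCat.{u} R) : X ⊗ ModuleCat.of R (X →ₗ[R] Y) ⟶ Y :=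
  ModuleCat.ofHom (TensorProduct.lift (LinearMap.id.flip))

/-- The evaluation `Hom(X, Y) ⊗ X ⟶ Y`. -/
noncomputable def modRightEv (X Y : ModuleCat.{u} R) : ModuleCat.of R (X →ₗ[R] Y) ⊗ X ⟶ Y :=
  ModuleCat.ofHom (TensorProduct.lift LinearMap.id)

lemma modLeftEv_tmul {X Y : ModuleCat.{u} R} (x : X) (f : X →ₗ[R] Y) :
    modLeftEv X Y (x ⊗ₜ[R] f) = f x := rfl

lemma modRightEv_tmul {X Y : ModuleCat.{u} R} (x : X) (f : X →ₗ[R] Y) :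
    modRightEv X Y (f ⊗ₜ[R] x) = f x := rfl

lemma whiskerLeft_comp_eq_iff {X H Y Z : ModuleCat.{u} R} (g : Z ⟶ H) (ev : X ⊗ H ⟶ Y)
    (f : X ⊗ Z ⟶ Y) : X ◁ g ≫ ev = f ↔
      ∀ (x : X) (z : Z), ev (x ⊗ₜ[R] (g z : H)) = f (x ⊗ₜ[R] z) := by
  refine ⟨fun e x z => by rw [← e]; rfl, fun e => ?_⟩
  ext : 1
  exact TensorProduct.ext' e

lemma whiskerRight_comp_eq_iff {X H Y Z : ModuleCat.{u} R} (g : Z ⟶ H) (ev : H ⊗ X ⟶ Y)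
    (f : Z ⊗ X ⟶ Y) : g ▷ X ≫ ev = f ↔
      ∀ (z : Z) (x : X), ev ((g z : H) ⊗ₜ[R] x) = f (z ⊗ₜ[R] x) := by
  refine ⟨fun e x z => by rw [← e]; rfl, fun e => ?_⟩
  ext : 1
  exact TensorProduct.ext' e

lemma isLeftHom_modLeftEv (X Y : ModuleCat.{u} R) : IsLeftHom (modLeftEv X Y) := fun Z f => by
  refine ⟨ModuleCat.ofHom (TensorProduct.curry f.hom).flip,
    (whiskerLeft_comp_eq_iff _ _ _).2 fun x z => rfl, fun g hg => ?_⟩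
  ext z x
  exact (whiskerLeft_comp_eq_iff _ _ _).1 hg x z

lemma isRightHom_modRightEv (X Y : ModuleCat.{u} R) : IsRightHom (modRightEv X Y) := fun Z f => by
  refine ⟨ModuleCat.ofHom (TensorProduct.curry f.hom),
    (whiskerRight_comp_eq_iff _ _ _).2 fun x z => rfl, fun g hg => ?_⟩
  ext z x
  exact (whiskerRight_comp_eq_iff _ _ _).1 hg z x

/-- A map from `Z ⊗ Hom(X, R)` to `R` is a map from `Z` to the bidual of `X`, which reflexivity
identifies with `X`. -/
lemma isRightHom_modLeftEv (X : ModuleCat.{u} R) [Module.IsReflexive R X] :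
    IsRightHom (modLeftEv X (𝟙_ (ModuleCat.{u} R))) := fun Z f => by
  refine ⟨ModuleCat.ofHom ((Module.evalEquiv R X).symm.toLinearMap ∘ₗ TensorProduct.curry f.hom),
    (whiskerRight_comp_eq_iff _ _ _).2 fun z a =>
      Module.apply_evalEquiv_symm_apply (R := R) (M := X) a (TensorProduct.curry f.hom z),
    fun g hg => ?_⟩
  ext z
  refine (Module.evalEquiv R X).injective (LinearMap.ext fun a => ?_)
  refine ((whiskerRight_comp_eq_iff _ _ _).1 hg z a).trans ?_
  exact (Module.apply_evalEquiv_symm_apply (R := R) (M := X) a (TensorProduct.curry f.hom z)).symm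

lemma isLeftHom_modRightEv (X : ModuleCat.{u} R) [Module.IsReflexive R X] :
    IsLeftHom (modRightEv X (𝟙_ (ModuleCat.{u} R))) := fun Z f => by
  let f' := (TensorProduct.curry f.hom).flip
  refine ⟨ModuleCat.ofHom ((Module.evalEquiv R X).symm.toLinearMap ∘ₗ f'),
    (whiskerLeft_comp_eq_iff _ _ _).2 fun a z =>
      Module.apply_evalEquiv_symm_apply (R := R) (M := X) a (f' z),
    fun g hg => ?_⟩
  ext z
  refine (Module.evalEquiv R X).injective (LinearMap.ext fun a => ?_)
  refine ((whiskerLeft_comp_eq_iff _ _ _).1 hg a z).trans ?_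
  exact (Module.apply_evalEquiv_symm_apply (R := R) (M := X) a (f' z)).symm

variable (k : Type u) [Field k] [Algebra k R] [FiniteDimensional k R]

lemma fdModule_linearMap {X Y : ModuleCat.{u} R} (hX : fdModule k R X) (hY : fdModule k R Y) :
    fdModule k R (ModuleCat.of R (X →ₗ[R] Y)) := by
  rw [fdModule_iff] at *
  have : IsNoetherianRing R := isNoetherian_of_tower k inferInstance
  exact inferInstanceAs (Module.Finite R (X →ₗ[R] Y))

variable {k} in
lemma fdModule.isReflexive (h : IsSymmetricFrobenius k R) {X : ModuleCat.{u} R}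
    (hX : fdModule k R X) : Module.IsReflexive R X := by
  obtain ⟨form, hf, -⟩ := h
  let _ : Module k X := Module.compHom X (algebraMap k R)
  have : IsScalarTower k R X := IsScalarTower.of_algebraMap_smul fun _ _ => rfl
  have : Module.Finite R X := (fdModule_iff k R X).1 hX
  have : Module.Finite k X := .trans R X
  exact hf.isReflexive

variable {k} in
lemma hasPerfectPairings_fdModule (h : IsSymmetricFrobenius k R) :
    HasPerfectPairings (fdModule k R).FullSubcategory (𝟙_ _) := by
  have h1 : fdModule k R (𝟙_ (ModuleCat.{u} R)) := (fdModule k R).prop_unit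
  refine hasPerfectPairings_fullSubcategory _ (fun X hX => ?_) (fun X hX => ?_)
  all_goals have := hX.isReflexive h
  · exact ⟨_, modLeftEv X _, fdModule_linearMap k hX h1, isLeftHom_modLeftEv _ _,
      isRightHom_modLeftEv X⟩
  · exact ⟨_, modRightEv X _, fdModule_linearMap k hX h1, isLeftHom_modRightEv X,
      isRightHom_modRightEv _ _⟩

theorem CommHopfAlgebroid.isRCategory_and_isClosedFunctor {k R : Type u} [Field k] [CommRing R]
    [Algebra k R] [FiniteDimensional k R] (h : IsSymmetricFrobenius k R)
    (B : CommHopfAlgebroid k R) : IsRCategory B.FDMod ∧ IsClosedFunctor B.fdForget := by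
  have hc : IsClosedFunctor B.fdForget := B.isHopf.isClosedFunctor_restricted _
    (fun X Y hX hY => ⟨_, modLeftEv X Y, fdModule_linearMap k hX hY, isLeftHom_modLeftEv X Y⟩)
    (fun X Y hX hY => ⟨_, modRightEv X Y, fdModule_linearMap k hX hY, isRightHom_modRightEv X Y⟩)
  exact ⟨hc.isRCategory (hasPerfectPairings_fdModule h), hc⟩

end CommRing
-- Internal homs of modules over the enveloping algebra
section EnvHom
variable {k R L : Type u} [Field k] [CommRing R] [Algebra k R]
  [LieRing L] [LieAlgebra k L] [Module R L] [LieRingModule L R] [LieRinehartRing R L]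
  [LieRinehartAlgebra k R L]

/-- The action `(x f) m = x (f m) - f (x m)` on a module of linear maps. -/
noncomputable def LAction.hom {M N : Type u} [AddCommGroup M] [Module R M] [AddCommGroup N]
    [Module R N] (ρ : LAction R L M) (σ : LAction R L N) : LAction R L (M →ₗ[R] N) where
  act x :=
    { toFun := fun f =>
        { toFun := fun m => σ.act x (f m) - f (ρ.act x m)
          map_add' := fun a b => by simp only [map_add]; abel
          map_smul' := fun r m => by
            simp only [map_smul, σ.act_smul, ρ.act_smul, map_add, smul_sub, RingHom.id_apply]
            abel }
      map_zero' := by ext; simp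
      map_add' := fun f g => by
        ext m
        simp only [LinearMap.add_apply, LinearMap.coe_mk, AddHom.coe_mk, map_add]; abel }
  add_act x y f := by
    ext m
    simp only [AddMonoidHom.coe_mk, ZeroHom.coe_mk, LinearMap.add_apply, LinearMap.coe_mk,
      AddHom.coe_mk, σ.add_act, ρ.add_act, map_add]
    abel
  smul_act r x f := by
    ext m
    simp only [AddMonoidHom.coe_mk, ZeroHom.coe_mk, LinearMap.smul_apply, LinearMap.coe_mk,
      AddHom.coe_mk, σ.smul_act, ρ.smul_act, map_smul, smul_sub]
  lie_act x y f := by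
    ext m
    simp only [AddMonoidHom.coe_mk, ZeroHom.coe_mk, LinearMap.sub_apply, LinearMap.coe_mk,
      AddHom.coe_mk, σ.lie_act, ρ.lie_act, map_sub]
    abel
  act_smul x r f := by
    ext m
    simp only [AddMonoidHom.coe_mk, ZeroHom.coe_mk, LinearMap.add_apply, LinearMap.smul_apply,
      LinearMap.coe_mk, AddHom.coe_mk, σ.act_smul, smul_sub]
    abel

lemma LAction.hom_act_apply {M N : Type u} [AddCommGroup M] [Module R M] [AddCommGroup N]
    [Module R N] (ρ : LAction R L M) (σ : LAction R L N) (x : L) (f : M →ₗ[R] N) (m : M) :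
    (ρ.hom σ).act x f m = σ.act x (f m) - f (ρ.act x m) := rfl

/-- Equivariance of a map out of a tensor product is a Leibniz rule on pure tensors; both the
evaluation and the transposes below are treated in this form. -/
lemma LAction.equivariant_tensor_iff {W₁ W₂ W : ModuleCat.{u} R} (ρ₁ : LAction R L W₁)
    (ρ₂ : LAction R L W₂) (ρ : LAction R L W) (f : W₁ ⊗ W₂ ⟶ W) :
    LAction.Equivariant (W := W₁ ⊗ W₂) (ρ₁.tensor ρ₂) ρ f ↔
      ∀ (x : L) (m : W₁) (n : W₂), f (ρ₁.act x m ⊗ₜ[R] n) + f (m ⊗ₜ[R] ρ₂.act x n) =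
        ρ.act x (f (m ⊗ₜ[R] n)) := by
  refine ⟨fun h x m n => ?_, fun h x w => ?_⟩
  · rw [← h, ← map_add]; rfl
  · induction w using TensorProduct.induction_on with
    | zero => simp
    | tmul m n => exact (map_add f.hom _ _).trans (h x m n)
    | add a b ha hb => simp only [map_add, ha, hb]

namespace Env

open Functor.LaxMonoidal

/-- The internal hom of modules over the enveloping algebra. -/
noncomputable def homModule (M N : ModuleCat.{u} (Env k R L)) : ModuleCat.{u} (Env k R L) :=
  LAction.toModuleCat k (W := ModuleCat.of R ((res k R L).obj M →ₗ[R] (res k R L).obj N))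
    ((action M).hom (action N))

/-- The underlying `R`-module of the internal hom. -/
noncomputable def homIso (M N : ModuleCat.{u} (Env k R L)) :
    (res k R L).obj (homModule M N) ≅
      ModuleCat.of R ((res k R L).obj M →ₗ[R] (res k R L).obj N) :=
  LAction.resIso k (W := ModuleCat.of R ((res k R L).obj M →ₗ[R] (res k R L).obj N))
    ((action M).hom (action N))

lemma homIso_equivariant (M N : ModuleCat.{u} (Env k R L)) :
    LAction.Equivariant (W' := ModuleCat.of R ((res k R L).obj M →ₗ[R] (res k R L).obj N))
      (action (homModule M N)) ((action M).hom (action N)) (homIso M N).hom :=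
  LAction.Equivariant.res

lemma μ_res (M N : ModuleCat.{u} (Env k R L)) : μ (res k R L) M N = (tensorIso M N).inv := rfl

lemma equivariant_μ_comp {M N P : ModuleCat.{u} (Env k R L)} (f : M ⊗ N ⟶ P) :
    LAction.Equivariant (W := (res k R L).obj M ⊗ (res k R L).obj N)
      ((action M).tensor (action N)) (action P) (μ (res k R L) M N ≫ (res k R L).map f) :=
  (tensorIso_equivariant M N).inv.comp (equivariant_map f)

/-- Morphisms out of a tensor product over the enveloping algebra. -/
lemma exists_hom_of_equivariant {M N P : ModuleCat.{u} (Env k R L)}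
    (f : (res k R L).obj M ⊗ (res k R L).obj N ⟶ (res k R L).obj P)
    (hf : LAction.Equivariant (W := (res k R L).obj M ⊗ (res k R L).obj N)
      ((action M).tensor (action N)) (action P) f) :
    ∃ g : M ⊗ N ⟶ P, μ (res k R L) M N ≫ (res k R L).map g = f := by
  refine ⟨homMk ((tensorIso M N).hom ≫ f) ((tensorIso_equivariant M N).comp hf), ?_⟩
  rw [μ_res, res_map_homMk, Iso.inv_hom_id_assoc]

lemma hom_ext_of_μ {M N P : ModuleCat.{u} (Env k R L)} {f g : M ⊗ N ⟶ P}
    (h : μ (res k R L) M N ≫ (res k R L).map f = μ (res k R L) M N ≫ (res k R L).map g) :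
    f = g :=
  (res k R L).map_injective ((cancel_epi _).1 h)

/-- The action on `Hom_R(M, N)` is the one for which evaluation satisfies the Leibniz rule, and the
same rule makes the `R`-linear transpose of an equivariant map equivariant. So the universal
property over `R` lifts. -/
lemma exists_isLeftHom (M N : ModuleCat.{u} (Env k R L)) :
    ∃ ev : M ⊗ homModule M N ⟶ N, IsLeftHom ev ∧
      IsLeftHom (μ (res k R L) M (homModule M N) ≫ (res k R L).map ev) := by
  obtain ⟨ev, hev⟩ := exists_hom_of_equivariant
    ((res k R L).obj M ◁ (homIso M N).hom ≫ modLeftEv _ _)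
    ((LAction.equivariant_tensor_iff _ _ _ _).2 fun x m f => by
      change modLeftEv _ _ (_ ⊗ₜ[R] (homIso M N).hom f) +
        modLeftEv _ _ (_ ⊗ₜ[R] (homIso M N).hom ((action (homModule M N)).act x f)) =
        (action N).act x (modLeftEv _ _ (_ ⊗ₜ[R] (homIso M N).hom f))
      rw [homIso_equivariant]
      simp only
      change _ + ((action N).act x _ - _) = _
      exact add_sub_cancel _ _)
  have hR : IsLeftHom (μ (res k R L) M (homModule M N) ≫ (res k R L).map ev) :=
    (isLeftHom_modLeftEv _ _).of_isIso hev.symm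
  refine ⟨ev, fun Z f => ?_, hR⟩
  obtain ⟨g, hg, hu⟩ := isLeftHom_modLeftEv _ _ (μ (res k R L) M Z ≫ (res k R L).map f)
  have hgv := (whiskerLeft_comp_eq_iff _ _ _).1 hg
  have hfe := (LAction.equivariant_tensor_iff _ _ _ _).1 (equivariant_μ_comp f)
  have hge : (action Z).Equivariant ((action M).hom (action N)) g := fun x z => by
    refine LinearMap.ext fun m => ?_
    rw [LAction.hom_act_apply]
    have h1 := hgv m ((action Z).act x z)
    have h2 := hgv m z
    have h3 := hgv ((action M).act x m) z
    rw [modLeftEv_tmul] at h1 h2 h3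
    rw [h1, h2, h3, ← hfe]
    exact (add_sub_cancel_left _ _).symm
  -- The universal property over the enveloping algebra is rewritten over `R`, by faithfulness of
  -- restriction and the identifications `μ` and `homIso` of the underlying modules.
  have key : ∀ g' : Z ⟶ homModule M N, M ◁ g' ≫ ev = f ↔
      (res k R L).obj M ◁ ((res k R L).map g' ≫ (homIso M N).hom) ≫ modLeftEv _ _ =
        μ (res k R L) M Z ≫ (res k R L).map f := fun g' => by
    rw [MonoidalCategory.whiskerLeft_comp, Category.assoc, ← hev, μ_natural_right_assoc,
      ← Functor.map_comp]
    exact ⟨fun h => by rw [h], hom_ext_of_μ⟩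
  refine ⟨homMk (g ≫ (homIso M N).inv) (hge.comp (homIso_equivariant M N).inv),
    (key _).2 (by simpa using hg), fun g' hg' => ?_⟩
  have := hu _ ((key g').1 hg')
  exact (res k R L).map_injective (by rw [res_map_homMk, ← this]; simp)

lemma exists_isRightHom (M N : ModuleCat.{u} (Env k R L)) :
    ∃ ev : homModule M N ⊗ M ⟶ N, IsRightHom ev ∧
      IsRightHom (μ (res k R L) (homModule M N) M ≫ (res k R L).map ev) := by
  obtain ⟨ev, hev⟩ := exists_hom_of_equivariant
    ((homIso M N).hom ▷ (res k R L).obj M ≫ modRightEv _ _)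
    ((LAction.equivariant_tensor_iff _ _ _ _).2 fun x f m => by
      change modRightEv _ _ ((homIso M N).hom ((action (homModule M N)).act x f) ⊗ₜ[R] _) +
        modRightEv _ _ ((homIso M N).hom f ⊗ₜ[R] _) =
        (action N).act x (modRightEv _ _ ((homIso M N).hom f ⊗ₜ[R] _))
      rw [homIso_equivariant]
      simp only
      change ((action N).act x _ - _) + _ = _
      exact sub_add_cancel _ _)
  have hR : IsRightHom (μ (res k R L) (homModule M N) M ≫ (res k R L).map ev) :=
    (isRightHom_modRightEv _ _).of_isIso hev.symm
  refine ⟨ev, fun Z f => ?_, hR⟩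
  obtain ⟨g, hg, hu⟩ := isRightHom_modRightEv _ _ (μ (res k R L) Z M ≫ (res k R L).map f)
  have hgv := (whiskerRight_comp_eq_iff _ _ _).1 hg
  have hfe := (LAction.equivariant_tensor_iff _ _ _ _).1 (equivariant_μ_comp f)
  have hge : (action Z).Equivariant ((action M).hom (action N)) g := fun x z => by
    refine LinearMap.ext fun m => ?_
    rw [LAction.hom_act_apply]
    have h1 := hgv ((action Z).act x z) m
    have h2 := hgv z m
    have h3 := hgv z ((action M).act x m)
    rw [modRightEv_tmul] at h1 h2 h3
    rw [h1, h2, h3, ← hfe]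
    exact (add_sub_cancel_right _ _).symm
  have key : ∀ g' : Z ⟶ homModule M N, g' ▷ M ≫ ev = f ↔
      ((res k R L).map g' ≫ (homIso M N).hom) ▷ (res k R L).obj M ≫ modRightEv _ _ =
        μ (res k R L) Z M ≫ (res k R L).map f := fun g' => by
    rw [MonoidalCategory.comp_whiskerRight, Category.assoc, ← hev, μ_natural_left_assoc,
      ← Functor.map_comp]
    exact ⟨fun h => by rw [h], hom_ext_of_μ⟩
  refine ⟨homMk (g ≫ (homIso M N).inv) (hge.comp (homIso_equivariant M N).inv),
    (key _).2 (by simpa using hg), fun g' hg' => ?_⟩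
  have := hu _ ((key g').1 hg')
  exact (res k R L).map_injective (by rw [res_map_homMk, ← this]; simp)

theorem isRCategory_and_isClosedFunctor [FiniteDimensional k R] (h : IsSymmetricFrobenius k R) :
    IsRCategory (Env.FDMod k R L) ∧ IsClosedFunctor (Env.fdForget k R L) := by
  have hH : ∀ M N : ModuleCat.{u} (Env k R L), fdModule k R ((res k R L).obj M) →
      fdModule k R ((res k R L).obj N) → fdModule k R ((res k R L).obj (homModule M N)) :=
    fun M N hM hN => (fdModule k R).prop_of_iso (homIso M N).symm (fdModule_linearMap k hM hN)
  have hc : IsClosedFunctor (Env.fdForget k R L) := isClosedFunctor_restrictedFunctor _ _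
    (fun M N hM hN => by
      obtain ⟨ev, hev⟩ := exists_isLeftHom M N
      exact ⟨_, ev, hH M N hM hN, hev⟩)
    (fun M N hM hN => by
      obtain ⟨ev, hev⟩ := exists_isRightHom M N
      exact ⟨_, ev, hH M N hM hN, hev⟩)
    (fun X Y hX hY => ⟨_, modLeftEv X Y, fdModule_linearMap k hX hY, isLeftHom_modLeftEv X Y⟩)
    (fun X Y hX hY => ⟨_, modRightEv X Y, fdModule_linearMap k hX hY, isRightHom_modRightEv X Y⟩)
  exact ⟨hc.isRCategory (hasPerfectPairings_fdModule h), hc⟩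

end Env
end EnvHom
-- Bimodules in terms of elements
namespace RBimod
variable {k R : Type u} [Field k] [Ring R] [Algebra k R]

/-- The left action of `R` on a bimodule. -/
noncomputable def lact (M : RBimod k R) : R →ₗ[k] M.X →ₗ[k] M.X :=
  TensorProduct.curry (M := R) (N := M.X) (P₂ := M.X) M.actLeft.hom

/-- The right action of `R` on a bimodule. -/
noncomputable def ract (M : RBimod k R) : R →ₗ[k] M.X →ₗ[k] M.X :=
  LinearMap.flip (show M.X →ₗ[k] R →ₗ[k] M.X from
    TensorProduct.curry (M := M.X) (N := R) (P₂ := M.X) M.actRight.hom)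

section
variable (M : RBimod k R)

lemma lact_one (m : M.X) : M.lact 1 m = m := by
  have h := congrArg (fun f : 𝟙_ (ModuleCat.{u} k) ⊗ M.X ⟶ M.X => f ((1 : k) ⊗ₜ[k] m))
    M.one_actLeft
  refine Eq.trans ?_ (h.trans (one_smul k m))
  -- The unit of the monoid object `R` is the structure map of the algebra, evaluated here at `1`.
  change M.lact 1 m = M.lact (algebraMap k R 1) m
  rw [(algebraMap k R).map_one]

lemma ract_one (m : M.X) : M.ract 1 m = m := by
  have h := congrArg (fun f : M.X ⊗ 𝟙_ (ModuleCat.{u} k) ⟶ M.X => f (m ⊗ₜ[k] (1 : k)))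
    M.actRight_one
  refine Eq.trans ?_ (h.trans (one_smul k m))
  change M.ract 1 m = M.ract (algebraMap k R 1) m
  rw [(algebraMap k R).map_one]

lemma lact_mul (r s : R) (m : M.X) : M.lact (r * s) m = M.lact r (M.lact s m) :=
  congrArg (fun f : ((algMon k R).X ⊗ (algMon k R).X) ⊗ M.X ⟶ M.X =>
    f (((show (algMon k R).X from r) ⊗ₜ[k] (show (algMon k R).X from s)) ⊗ₜ[k] m)) M.left_assoc

lemma ract_mul (r s : R) (m : M.X) : M.ract (r * s) m = M.ract s (M.ract r m) :=
  congrArg (fun f : M.X ⊗ ((algMon k R).X ⊗ (algMon k R).X) ⟶ M.X =>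
    f (m ⊗ₜ[k] ((show (algMon k R).X from r) ⊗ₜ[k] (show (algMon k R).X from s)))) M.right_assoc

lemma ract_lact (r s : R) (m : M.X) : M.ract s (M.lact r m) = M.lact r (M.ract s m) :=
  congrArg (fun f : ((algMon k R).X ⊗ M.X) ⊗ (algMon k R).X ⟶ M.X =>
    f (((show (algMon k R).X from r) ⊗ₜ[k] m) ⊗ₜ[k] (show (algMon k R).X from s))) M.middle_assoc

end

lemma hom_lact {M N : RBimod k R} (f : M ⟶ N) (r : R) (m : M.X) :
    f.hom (M.lact r m) = N.lact r (f.hom m) :=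
  congrArg (fun g : (algMon k R).X ⊗ M.X ⟶ N.X => g ((show (algMon k R).X from r) ⊗ₜ[k] m))
    f.left_act_hom

lemma hom_ract {M N : RBimod k R} (f : M ⟶ N) (r : R) (m : M.X) :
    f.hom (M.ract r m) = N.ract r (f.hom m) :=
  congrArg (fun g : M.X ⊗ (algMon k R).X ⟶ N.X => g (m ⊗ₜ[k] (show (algMon k R).X from r)))
    f.right_act_hom

/-- A morphism of bimodules from a linear map commuting with both actions. -/
noncomputable def homMk {M N : RBimod k R} (f : M.X →ₗ[k] N.X)
    (hl : ∀ r m, f (M.lact r m) = N.lact r (f m)) (hr : ∀ r m, f (M.ract r m) = N.ract r (f m)) :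
    M ⟶ N :=
  Bimod.Hom.mk (ModuleCat.ofHom f)
    (by ext : 1; exact TensorProduct.ext' fun r m => hl r m)
    (by ext : 1; exact TensorProduct.ext' fun m r => hr r m)

/-- A bimodule from two commuting actions. -/
noncomputable def mk (X : Type u) [AddCommGroup X] [Module k X] (l r : R →ₗ[k] X →ₗ[k] X)
    (l_one : ∀ x, l 1 x = x) (l_mul : ∀ a b x, l (a * b) x = l a (l b x))
    (r_one : ∀ x, r 1 x = x) (r_mul : ∀ a b x, r (a * b) x = r b (r a x))
    (r_l : ∀ a b x, r b (l a x) = l a (r b x)) : RBimod k R where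
  X := ModuleCat.of k X
  actLeft := ModuleCat.ofHom (X := TensorProduct k R X) (TensorProduct.lift l)
  actRight := ModuleCat.ofHom (X := TensorProduct k X R) (TensorProduct.lift r.flip)
  one_actLeft := by
    ext : 1
    refine TensorProduct.ext' fun c x => ?_
    change l (algebraMap k R c) x = c • x
    rw [Algebra.algebraMap_eq_smul_one, map_smul, LinearMap.smul_apply, l_one]
  actRight_one := by
    ext : 1
    refine TensorProduct.ext' fun x c => ?_
    change r (algebraMap k R c) x = c • x
    rw [Algebra.algebraMap_eq_smul_one, map_smul, LinearMap.smul_apply, r_one]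
  left_assoc := by
    ext : 1
    exact TensorProduct.ext_threefold fun a b x => l_mul a b x
  right_assoc := by
    ext : 1
    refine TensorProduct.ext' fun x w => ?_
    induction w using TensorProduct.induction_on with
    | zero => simp
    | tmul a b => exact r_mul a b x
    | add a b ha hb => rw [TensorProduct.tmul_add, map_add, map_add, ha, hb]
  middle_assoc := by
    ext : 1
    exact TensorProduct.ext_threefold fun a x b => r_l a b x

section Tensor
open Limits

variable (M N : RBimod k R)

/-- The projection from the tensor product over `k` to the tensor product over `R`. -/
noncomputable def tensorπ : M.X ⊗ N.X ⟶ (M ⊗ N).X :=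
  coequalizer.π (M.actRight ▷ N.X) ((α_ M.X _ N.X).hom ≫ M.X ◁ N.actLeft)

/-- Pure tensors. -/
noncomputable def tmul : M.X →ₗ[k] N.X →ₗ[k] (M ⊗ N).X := TensorProduct.curry (tensorπ M N).hom

variable {M N}

lemma tmul_lact (r : R) (m : M.X) (n : N.X) :
    tmul M N m (N.lact r n) = tmul M N (M.ract r m) n :=
  (congrArg (fun f : (M.X ⊗ (algMon k R).X) ⊗ N.X ⟶ (M ⊗ N).X =>
    f ((m ⊗ₜ[k] (show (algMon k R).X from r)) ⊗ₜ[k] n))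
    (coequalizer.condition (M.actRight ▷ N.X) ((α_ M.X _ N.X).hom ≫ M.X ◁ N.actLeft))).symm

lemma lact_tmul (r : R) (m : M.X) (n : N.X) :
    (M ⊗ N).lact r (tmul M N m n) = tmul M N (M.lact r m) n :=
  congrArg (fun f : (algMon k R).X ⊗ (M.X ⊗ N.X) ⟶ (M ⊗ N).X =>
    f ((show (algMon k R).X from r) ⊗ₜ[k] (m ⊗ₜ[k] n)))
    (Bimod.TensorBimod.whiskerLeft_π_actLeft M N)

lemma ract_tmul (r : R) (m : M.X) (n : N.X) :
    (M ⊗ N).ract r (tmul M N m n) = tmul M N m (N.ract r n) :=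
  congrArg (fun f : (M.X ⊗ N.X) ⊗ (algMon k R).X ⟶ (M ⊗ N).X =>
    f ((m ⊗ₜ[k] n) ⊗ₜ[k] (show (algMon k R).X from r)))
    (Bimod.TensorBimod.π_tensor_id_actRight M N)

lemma tensor_hom_ext {X : ModuleCat.{u} k} {f g : (M ⊗ N).X ⟶ X}
    (h : ∀ m n, f (tmul M N m n) = g (tmul M N m n)) : f = g := by
  have : Epi (tensorπ M N) := coequalizer.π_epi
  rw [← cancel_epi (tensorπ M N)]
  ext : 1
  exact TensorProduct.ext' h

/-- The morphism out of a tensor product given by a balanced bilinear map. -/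
lemma exists_hom_of_balanced {P : RBimod k R} (β : M.X →ₗ[k] N.X →ₗ[k] P.X)
    (hb : ∀ r m n, β (M.ract r m) n = β m (N.lact r n))
    (hl : ∀ r m n, β (M.lact r m) n = P.lact r (β m n))
    (hr : ∀ r m n, β m (N.ract r n) = P.ract r (β m n)) :
    ∃ f : M ⊗ N ⟶ P, ∀ m n, f.hom (tmul M N m n) = β m n := by
  -- The tensor product over `R` is a coequalizer of maps of vector spaces, and `hb` is the
  -- condition to factor through it.
  let g : (M ⊗ N).X ⟶ P.X := coequalizer.desc (f := M.actRight ▷ N.X)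
    (g := (α_ M.X _ N.X).hom ≫ M.X ◁ N.actLeft)
    (ModuleCat.ofHom (X := TensorProduct k M.X N.X) (TensorProduct.lift β)) (by
      ext : 1
      exact TensorProduct.ext_threefold fun m r n => hb r m n)
  have hg : ∀ m n, g (tmul M N m n) = β m n := fun m n =>
    congrArg (fun f : (M.X ⊗ N.X : ModuleCat.{u} k) ⟶ P.X => f (m ⊗ₜ[k] n)) (coequalizer.π_desc _ _)
  refine ⟨homMk g.hom (fun r x => ?_) (fun r x => ?_), hg⟩
  · refine congrArg (fun f : (M ⊗ N).X ⟶ P.X => f x) (tensor_hom_ext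
      (f := ModuleCat.ofHom (g.hom ∘ₗ (M ⊗ N).lact r))
      (g := ModuleCat.ofHom (P.lact r ∘ₗ g.hom)) fun m n => ?_)
    change g ((M ⊗ N).lact r (tmul M N m n)) = P.lact r (g (tmul M N m n))
    rw [lact_tmul, hg, hg, hl]
  · refine congrArg (fun f : (M ⊗ N).X ⟶ P.X => f x) (tensor_hom_ext
      (f := ModuleCat.ofHom (g.hom ∘ₗ (M ⊗ N).ract r))
      (g := ModuleCat.ofHom (P.ract r ∘ₗ g.hom)) fun m n => ?_)
    change g ((M ⊗ N).ract r (tmul M N m n)) = P.ract r (g (tmul M N m n))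
    rw [ract_tmul, hg, hg, hr]

lemma whiskerLeft_tmul (M : RBimod k R) {N N' : RBimod k R} (f : N ⟶ N') (m : M.X) (n : N.X) :
    (M ◁ f).hom (tmul M N m n) = tmul M N' m (f.hom n) :=
  have h : tensorπ M N ≫ (M ◁ f).hom = M.X ◁ f.hom ≫ tensorπ M N' :=
    ι_colimMap _ WalkingParallelPair.one
  congrArg (fun f : (M.X ⊗ N.X : ModuleCat.{u} k) ⟶ (M ⊗ N').X => f (m ⊗ₜ[k] n)) h

lemma whiskerRight_tmul {M M' : RBimod k R} (f : M ⟶ M') (N : RBimod k R) (m : M.X) (n : N.X) :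
    (f ▷ N).hom (tmul M N m n) = tmul M' N (f.hom m) n :=
  have h : tensorπ M N ≫ (f ▷ N).hom = f.hom ▷ N.X ≫ tensorπ M' N :=
    ι_colimMap _ WalkingParallelPair.one
  congrArg (fun f : (M.X ⊗ N.X : ModuleCat.{u} k) ⟶ (M' ⊗ N).X => f (m ⊗ₜ[k] n)) h

lemma whiskerLeft_comp_eq_iff {X H Y Z : RBimod k R} (g : Z ⟶ H) (ev : X ⊗ H ⟶ Y)
    (f : X ⊗ Z ⟶ Y) : X ◁ g ≫ ev = f ↔
      ∀ x z, ev.hom (tmul X H x (g.hom z)) = f.hom (tmul X Z x z) := by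
  refine ⟨fun e x z => by rw [← e, ← whiskerLeft_tmul]; rfl, fun e => ?_⟩
  refine Bimod.hom_ext _ _ (tensor_hom_ext fun x z => ?_)
  rw [← e, ← whiskerLeft_tmul]; rfl

lemma whiskerRight_comp_eq_iff {X H Y Z : RBimod k R} (g : Z ⟶ H) (ev : H ⊗ X ⟶ Y)
    (f : Z ⊗ X ⟶ Y) : g ▷ X ≫ ev = f ↔
      ∀ z x, ev.hom (tmul H X (g.hom z) x) = f.hom (tmul Z X z x) := by
  refine ⟨fun e x z => by rw [← e, ← whiskerRight_tmul]; rfl, fun e => ?_⟩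
  refine Bimod.hom_ext _ _ (tensor_hom_ext fun x z => ?_)
  rw [← e, ← whiskerRight_tmul]; rfl

end Tensor
end RBimod
namespace RBimod
variable {k R : Type u} [Field k] [Ring R] [Algebra k R]

/-! ### Internal homs of bimodules -/

section InternalHom
variable (X Y : RBimod k R)

/-- The maps commuting with the left actions. -/
def leftLinearMaps : Submodule k (X.X →ₗ[k] Y.X) where
  carrier := {g | ∀ r x, g (X.lact r x) = Y.lact r (g x)}
  add_mem' ha hb r x := by simp [ha r x, hb r x]
  zero_mem' r x := by simp
  smul_mem' c g hg r x := by simp [hg r x]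

/-- The maps commuting with the right actions. -/
def rightLinearMaps : Submodule k (X.X →ₗ[k] Y.X) where
  carrier := {g | ∀ r x, g (X.ract r x) = Y.ract r (g x)}
  add_mem' ha hb r x := by simp [ha r x, hb r x]
  zero_mem' r x := by simp
  smul_mem' c g hg r x := by simp [hg r x]

/-- The left internal hom of bimodules: the maps commuting with the left actions. -/
noncomputable def homLeft : RBimod k R :=
  mk (leftLinearMaps X Y)
    (LinearMap.mk₂ k (fun r g => ⟨g.1 ∘ₗ X.ract r, fun s x => by
        simp only [LinearMap.comp_apply, ract_lact, g.2 s]⟩)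
      (fun r s g => by ext x; simp) (fun c r g => by ext x; simp)
      (fun r g g' => by ext x; simp) (fun c r g => by ext x; simp))
    (LinearMap.mk₂ k (fun r g => ⟨Y.ract r ∘ₗ g.1, fun s x => by
        simp only [LinearMap.comp_apply, ract_lact, g.2 s]⟩)
      (fun r s g => by ext x; simp) (fun c r g => by ext x; simp)
      (fun r g g' => by ext x; simp) (fun c r g => by ext x; simp))
    (fun g => by ext x; simp [ract_one]) (fun a b g => by ext x; simp [ract_mul])
    (fun g => by ext x; simp [ract_one]) (fun a b g => by ext x; simp [ract_mul])
    (fun a b g => by ext x; simp)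

/-- The right internal hom of bimodules: the maps commuting with the right actions. -/
noncomputable def homRight : RBimod k R :=
  mk (rightLinearMaps X Y)
    (LinearMap.mk₂ k (fun r g => ⟨Y.lact r ∘ₗ g.1, fun s x => by
        simp only [LinearMap.comp_apply, ract_lact, g.2 s]⟩)
      (fun r s g => by ext x; simp) (fun c r g => by ext x; simp)
      (fun r g g' => by ext x; simp) (fun c r g => by ext x; simp))
    (LinearMap.mk₂ k (fun r g => ⟨g.1 ∘ₗ X.lact r, fun s x => by
        simp only [LinearMap.comp_apply, ← ract_lact, g.2 s]⟩)
      (fun r s g => by ext x; simp) (fun c r g => by ext x; simp)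
      (fun r g g' => by ext x; simp) (fun c r g => by ext x; simp))
    (fun g => by ext x; simp [lact_one]) (fun a b g => by ext x; simp [lact_mul])
    (fun g => by ext x; simp [lact_one]) (fun a b g => by ext x; simp [lact_mul])
    (fun a b g => by ext x; simp)

/-- This is currying. For `f : X ⊗ Z ⟶ Y`, left linearity of `f` puts the curried maps into
`leftLinearMaps`, balancedness of the tensor product makes the transpose left linear, and right
linearity of `f` makes it right linear. -/
lemma exists_isLeftHom : ∃ ev : X ⊗ homLeft X Y ⟶ Y, IsLeftHom ev := by
  obtain ⟨ev, hev⟩ := exists_hom_of_balanced (M := X) (N := homLeft X Y) (P := Y)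
    (leftLinearMaps X Y).subtype.flip (fun r x g => rfl) (fun r x g => g.2 r x)
    (fun r x g => rfl)
  replace hev : ∀ (x : X.X) (g : leftLinearMaps X Y), ev.hom (tmul X (homLeft X Y) x g) = g.1 x :=
    hev
  refine ⟨ev, fun Z f => ?_⟩
  let g₀ : Z.X →ₗ[k] leftLinearMaps X Y :=
    LinearMap.codRestrict _ ((tmul X Z).compr₂ f.hom.hom).flip fun z r x => by
      change f.hom (tmul X Z (X.lact r x) z) = Y.lact r (f.hom (tmul X Z x z))
      rw [← lact_tmul, hom_lact]
  have hg₀ : ∀ z x, (g₀ z).1 x = f.hom (tmul X Z x z) := fun z x => rfl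
  let g : Z ⟶ homLeft X Y := homMk (N := homLeft X Y) g₀
    (fun r z => Subtype.ext <| LinearMap.ext fun x => by
      change (g₀ (Z.lact r z)).1 x = (g₀ z).1 (X.ract r x)
      rw [hg₀, hg₀, tmul_lact])
    (fun r z => Subtype.ext <| LinearMap.ext fun x => by
      change (g₀ (Z.ract r z)).1 x = Y.ract r ((g₀ z).1 x)
      rw [hg₀, hg₀, ← ract_tmul, hom_ract])
  refine ⟨g, (whiskerLeft_comp_eq_iff _ _ _).2 fun x z => hev x (g₀ z), fun g' hg' => ?_⟩
  refine Bimod.hom_ext _ _ (ModuleCat.hom_ext <| LinearMap.ext fun z => Subtype.ext <|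
    LinearMap.ext fun x => ?_)
  exact (hev x _).symm.trans ((whiskerLeft_comp_eq_iff _ _ _).1 hg' x z)

lemma exists_isRightHom : ∃ ev : homRight X Y ⊗ X ⟶ Y, IsRightHom ev := by
  obtain ⟨ev, hev⟩ := exists_hom_of_balanced (M := homRight X Y) (N := X) (P := Y)
    (rightLinearMaps X Y).subtype (fun r g x => rfl) (fun r g x => rfl) (fun r g x => g.2 r x)
  replace hev : ∀ (g : rightLinearMaps X Y) (x : X.X),
      ev.hom (tmul (homRight X Y) X g x) = g.1 x := hev
  refine ⟨ev, fun Z f => ?_⟩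
  let g₀ : Z.X →ₗ[k] rightLinearMaps X Y :=
    LinearMap.codRestrict _ ((tmul Z X).compr₂ f.hom.hom) fun z r x => by
      change f.hom (tmul Z X z (X.ract r x)) = Y.ract r (f.hom (tmul Z X z x))
      rw [← ract_tmul, hom_ract]
  have hg₀ : ∀ z x, (g₀ z).1 x = f.hom (tmul Z X z x) := fun z x => rfl
  let g : Z ⟶ homRight X Y := homMk (N := homRight X Y) g₀
    (fun r z => Subtype.ext <| LinearMap.ext fun x => by
      change (g₀ (Z.lact r z)).1 x = Y.lact r ((g₀ z).1 x)
      rw [hg₀, hg₀, ← lact_tmul, hom_lact])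
    (fun r z => Subtype.ext <| LinearMap.ext fun x => by
      change (g₀ (Z.ract r z)).1 x = (g₀ z).1 (X.lact r x)
      rw [hg₀, hg₀, tmul_lact])
  refine ⟨g, (whiskerRight_comp_eq_iff _ _ _).2 fun z x => hev (g₀ z) x, fun g' hg' => ?_⟩
  refine Bimod.hom_ext _ _ (ModuleCat.hom_ext <| LinearMap.ext fun z => Subtype.ext <|
    LinearMap.ext fun x => ?_)
  exact (hev _ x).symm.trans ((whiskerRight_comp_eq_iff _ _ _).1 hg' z x)

variable {X Y} in
lemma fdBimod_homLeft (hX : fdBimod k R X) (hY : fdBimod k R Y) : fdBimod k R (homLeft X Y) := by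
  have : FiniteDimensional k X.X := hX
  have : FiniteDimensional k Y.X := hY
  exact inferInstanceAs (FiniteDimensional k (leftLinearMaps X Y))

variable {X Y} in
lemma fdBimod_homRight (hX : fdBimod k R X) (hY : fdBimod k R Y) :
    fdBimod k R (homRight X Y) := by
  have : FiniteDimensional k X.X := hX
  have : FiniteDimensional k Y.X := hY
  exact inferInstanceAs (FiniteDimensional k (rightLinearMaps X Y))

end InternalHom

/-! ### Bimodule pairings as invariant bilinear forms -/

section Pairing

variable (k R) in
/-- The identification of `R` with the underlying space of the unit bimodule. -/
noncomputable def toUnit : R ≃ₗ[k] (𝟙_ (RBimod k R) : RBimod k R).X := LinearEquiv.refl k R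

lemma unit_lact (r s : R) : (𝟙_ (RBimod k R) : RBimod k R).lact r (toUnit k R s) =
    toUnit k R (r * s) := rfl

lemma unit_ract (r s : R) : (𝟙_ (RBimod k R) : RBimod k R).ract r (toUnit k R s) =
    toUnit k R (s * r) := rfl

/-- The bilinear form associated with a bimodule pairing and a linear form on `R`. -/
noncomputable def pairingForm {X Y : RBimod k R} (form : R →ₗ[k] k) (f : X ⊗ Y ⟶ 𝟙_ (RBimod k R)) :
    X.X →ₗ[k] Y.X →ₗ[k] k :=
  (tmul X Y).compr₂ (form ∘ₗ (toUnit k R).symm.toLinearMap ∘ₗ f.hom.hom)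

variable {form : R →ₗ[k] k} {X Y : RBimod k R}

lemma pairingForm_apply (f : X ⊗ Y ⟶ 𝟙_ (RBimod k R)) (x : X.X) (y : Y.X) :
    pairingForm form f x y = form ((toUnit k R).symm (f.hom (tmul X Y x y))) := rfl

lemma pairingForm_ract_left (f : X ⊗ Y ⟶ 𝟙_ (RBimod k R)) (r : R) (x : X.X) (y : Y.X) :
    pairingForm form f (X.ract r x) y = pairingForm form f x (Y.lact r y) := by
  rw [pairingForm_apply, pairingForm_apply, tmul_lact]

lemma pairingForm_ract_right (f : X ⊗ Y ⟶ 𝟙_ (RBimod k R)) (r : R) (x : X.X) (y : Y.X) :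
    pairingForm form f x (Y.ract r y) = form ((toUnit k R).symm (f.hom (tmul X Y x y)) * r) := by
  rw [pairingForm_apply, ← ract_tmul, hom_ract]; rfl

/-- Linearity extracts `r` on the left of the value of `f`, whereas the right action extracts it on
the right; the symmetry of `form` identifies the two. -/
lemma pairingForm_lact_left (hs : ∀ x y : R, form (x * y) = form (y * x))
    (f : X ⊗ Y ⟶ 𝟙_ (RBimod k R)) (r : R) (x : X.X) (y : Y.X) :
    pairingForm form f (X.lact r x) y = pairingForm form f x (Y.ract r y) := by
  rw [pairingForm_ract_right, hs, pairingForm_apply, ← lact_tmul, hom_lact]; rfl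

lemma pairingForm_whiskerLeft {Z : RBimod k R} (g : Z ⟶ Y) (f : X ⊗ Y ⟶ 𝟙_ (RBimod k R)) (x : X.X)
    (z : Z.X) : pairingForm form (X ◁ g ≫ f) x z = pairingForm form f x (g.hom z) := by
  rw [pairingForm_apply, ← (whiskerLeft_comp_eq_iff g f _).1 rfl, pairingForm_apply]

lemma pairingForm_whiskerRight {Z : RBimod k R} (g : Z ⟶ X) (f : X ⊗ Y ⟶ 𝟙_ (RBimod k R)) (z : Z.X)
    (y : Y.X) : pairingForm form (g ▷ Y ≫ f) z y = pairingForm form f (g.hom z) y := by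
  rw [pairingForm_apply, ← (whiskerRight_comp_eq_iff g f _).1 rfl, pairingForm_apply]

/-- For a Frobenius form, a pairing is determined by its bilinear form. -/
lemma pairing_ext (h : IsFrobeniusForm form) {f g : X ⊗ Y ⟶ 𝟙_ (RBimod k R)}
    (e : ∀ x y, pairingForm form f x y = pairingForm form g x y) : f = g := by
  refine Bimod.hom_ext _ _ (tensor_hom_ext fun x y => (toUnit k R).symm.injective ?_)
  refine h.eq_of_forall fun s => ?_
  rw [← pairingForm_ract_right, ← pairingForm_ract_right, e]

/-- For a symmetric Frobenius form, each suitably invariant bilinear form comes from a pairing. -/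
lemma exists_pairing [FiniteDimensional k R] (h : IsFrobeniusForm form)
    (hs : ∀ x y : R, form (x * y) = form (y * x)) (β : X.X →ₗ[k] Y.X →ₗ[k] k)
    (hb : ∀ r x y, β (X.ract r x) y = β x (Y.lact r y))
    (hc : ∀ r x y, β (X.lact r x) y = β x (Y.ract r y)) :
    ∃ f : X ⊗ Y ⟶ 𝟙_ (RBimod k R), ∀ x y, pairingForm form f x y = β x y := by
  -- The value of the pairing at `x` and `y` is forced by right linearity: it must represent `s ↦ β
  -- x (y s)`. All remaining identities follow from uniqueness of the representing element `pu`.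
  choose p hp using fun x y => h.exists_mul_eq (β x ∘ₗ Y.ract.flip y)
  replace hp : ∀ x y s, form (p x y * s) = β x (Y.ract s y) := hp
  have pu : ∀ {x y a}, (∀ s, form (a * s) = β x (Y.ract s y)) → p x y = a := fun e =>
    h.eq_of_forall fun s => by rw [hp, e]
  let P : X.X →ₗ[k] Y.X →ₗ[k] R := LinearMap.mk₂ k p
    (fun x x' y => pu fun s => by simp [add_mul, hp])
    (fun c x y => pu fun s => by simp [hp])
    (fun x y y' => pu fun s => by simp [add_mul, hp])
    (fun c x y => pu fun s => by simp [hp])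
  obtain ⟨f, hf⟩ := exists_hom_of_balanced (M := X) (N := Y) (P := 𝟙_ (RBimod k R))
    (P.compr₂ (toUnit k R).toLinearMap)
    (fun r x y => congrArg (toUnit k R) <| pu fun s => by
      rw [hb, ← ract_lact, ← hp]; rfl)
    -- Left linearity uses the symmetry of the form, which rotates `r` from the front of the product
    -- to its end.
    (fun r x y => (congrArg (toUnit k R) <| pu fun s => by
      change form (r * p x y * s) = _
      rw [hc, ← ract_mul, ← hp, mul_assoc, hs, mul_assoc]).trans (unit_lact r _).symm)
    (fun r x y => (congrArg (toUnit k R) <| pu fun s => by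
      change form (p x y * r * s) = _
      rw [← ract_mul, ← hp, mul_assoc]).trans (unit_ract r _).symm)
  refine ⟨f, fun x y => ?_⟩
  rw [pairingForm_apply, hf]
  have := hp x y 1
  rw [mul_one, ract_one] at this
  exact this

variable [FiniteDimensional k R] (h : IsFrobeniusForm form)
  (hs : ∀ x y : R, form (x * y) = form (y * x))

include h hs

/-- A pairing of `Z` with `Y` amounts to an invariant map from `Z` to the `k`-dual of `Y`, and `f`
identifies `X` with that dual. Injectivity of the identification and invariance of both forms make
the resulting map a morphism of bimodules. -/
lemma isRightHom_of_bijective {f : X ⊗ Y ⟶ 𝟙_ (RBimod k R)}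
    (hf : Function.Bijective (pairingForm form f)) : IsRightHom f := fun Z a => by
  let e : X.X ≃ₗ[k] Module.Dual k Y.X := LinearEquiv.ofBijective _ hf
  let g₀ : Z.X →ₗ[k] X.X := e.symm.toLinearMap ∘ₗ pairingForm form a
  have hg₀ : ∀ z y, pairingForm form f (g₀ z) y = pairingForm form a z y := fun z y =>
    congrArg (fun b : Module.Dual k Y.X => b y) (e.apply_symm_apply (pairingForm form a z))
  let g : Z ⟶ X := homMk g₀
    (fun r z => hf.1 <| LinearMap.ext fun y => by
      rw [hg₀, pairingForm_lact_left hs, pairingForm_lact_left hs, hg₀])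
    (fun r z => hf.1 <| LinearMap.ext fun y => by
      rw [hg₀, pairingForm_ract_left, pairingForm_ract_left, hg₀])
  refine ⟨g, pairing_ext h fun z y => ?_, fun g' hg' => ?_⟩
  · rw [pairingForm_whiskerRight]; exact hg₀ z y
  · refine Bimod.hom_ext _ _ (ModuleCat.hom_ext <| LinearMap.ext fun z => hf.1 <|
      LinearMap.ext fun y => ?_)
    refine Eq.trans ?_ (hg₀ z y).symm
    rw [← hg', pairingForm_whiskerRight]

lemma isLeftHom_of_bijective {f : X ⊗ Y ⟶ 𝟙_ (RBimod k R)}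
    (hf : Function.Bijective (pairingForm form f).flip) : IsLeftHom f := fun Z a => by
  let e : Y.X ≃ₗ[k] Module.Dual k X.X := LinearEquiv.ofBijective _ hf
  let g₀ : Z.X →ₗ[k] Y.X := e.symm.toLinearMap ∘ₗ (pairingForm form a).flip
  have hg₀ : ∀ x z, pairingForm form f x (g₀ z) = pairingForm form a x z := fun x z =>
    congrArg (fun b : Module.Dual k X.X => b x)
      (e.apply_symm_apply ((pairingForm form a).flip z))
  let g : Z ⟶ Y := homMk g₀
    (fun r z => hf.1 <| LinearMap.ext fun x => by
      simp only [LinearMap.flip_apply]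
      rw [hg₀, ← pairingForm_ract_left, ← pairingForm_ract_left, hg₀])
    (fun r z => hf.1 <| LinearMap.ext fun x => by
      simp only [LinearMap.flip_apply]
      rw [hg₀, ← pairingForm_lact_left hs, ← pairingForm_lact_left hs, hg₀])
  refine ⟨g, pairing_ext h fun x z => ?_, fun g' hg' => ?_⟩
  · rw [pairingForm_whiskerLeft]; exact hg₀ x z
  · refine Bimod.hom_ext _ _ (ModuleCat.hom_ext <| LinearMap.ext fun z => hf.1 <|
      LinearMap.ext fun x => ?_)
    refine Eq.trans ?_ (hg₀ x z).symm
    rw [← hg', pairingForm_whiskerLeft]; rfl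

omit [FiniteDimensional k R] h hs in
variable (X) in
/-- The `k`-linear dual of a bimodule. -/
noncomputable def dual : RBimod k R :=
  mk (Module.Dual k X.X)
    (LinearMap.mk₂ k (fun r φ => φ ∘ₗ X.ract r)
      (fun r s g => by ext x; simp) (fun c r g => by ext x; simp)
      (fun r g g' => by ext x; simp) (fun c r g => by ext x; simp))
    (LinearMap.mk₂ k (fun r φ => φ ∘ₗ X.lact r)
      (fun r s g => by ext x; simp) (fun c r g => by ext x; simp)
      (fun r g g' => by ext x; simp) (fun c r g => by ext x; simp))
    (fun g => by ext x; simp [ract_one]) (fun a b g => by ext x; simp [ract_mul])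
    (fun g => by ext x; simp [lact_one]) (fun a b g => by ext x; simp [lact_mul])
    (fun a b g => by ext x; simp [ract_lact])

/-- The pairing is the one whose bilinear form is the canonical evaluation. The actions on `dual X`
are set up for its invariance, and both of its transposes are bijective as `X` is
finite-dimensional. -/
lemma exists_isPerfect_left [FiniteDimensional k X.X] :
    ∃ f : X ⊗ dual X ⟶ 𝟙_ (RBimod k R), IsPerfect f := by
  obtain ⟨f, hf⟩ := exists_pairing (X := X) (Y := dual X) h hs
    (LinearMap.flip (LinearMap.id : Module.Dual k X.X →ₗ[k] X.X →ₗ[k] k))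
    (fun r x φ => rfl) (fun r x φ => rfl)
  have e₁ : pairingForm form f = Module.Dual.eval k X.X := LinearMap.ext₂ hf
  have e₂ : (pairingForm form f).flip = (LinearMap.id : Module.Dual k X.X →ₗ[k] X.X →ₗ[k] k) :=
    LinearMap.ext₂ fun φ x => hf x φ
  exact ⟨f, isLeftHom_of_bijective h hs (e₂ ▸ Function.bijective_id),
    isRightHom_of_bijective h hs (e₁ ▸ Module.bijective_dual_eval k X.X)⟩

lemma exists_isPerfect_right [FiniteDimensional k X.X] :
    ∃ f : dual X ⊗ X ⟶ 𝟙_ (RBimod k R), IsPerfect f := by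
  obtain ⟨f, hf⟩ := exists_pairing (X := dual X) (Y := X) h hs
    (LinearMap.id : Module.Dual k X.X →ₗ[k] X.X →ₗ[k] k)
    (fun r x φ => rfl) (fun r x φ => rfl)
  have e₁ : pairingForm form f = (LinearMap.id : Module.Dual k X.X →ₗ[k] X.X →ₗ[k] k) :=
    LinearMap.ext₂ hf
  have e₂ : (pairingForm form f).flip = Module.Dual.eval k X.X :=
    LinearMap.ext₂ fun x φ => hf φ x
  exact ⟨f, isLeftHom_of_bijective h hs (e₂ ▸ Module.bijective_dual_eval k X.X),
    isRightHom_of_bijective h hs (e₁ ▸ Function.bijective_id)⟩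

end Pairing
end RBimod

theorem HopfAlgebroid.isRCategory_and_isClosedFunctor {k R : Type u} [Field k] [Ring R]
    [Algebra k R] [FiniteDimensional k R] (h : IsSymmetricFrobenius k R)
    (B : HopfAlgebroid k R) : IsRCategory B.FDMod ∧ IsClosedFunctor B.fdForget := by
  have hc : IsClosedFunctor B.fdForget := B.isHopf.isClosedFunctor_restricted _
    (fun X Y hX hY => by
      obtain ⟨ev, hev⟩ := RBimod.exists_isLeftHom X Y
      exact ⟨_, ev, RBimod.fdBimod_homLeft hX hY, hev⟩)
    (fun X Y hX hY => by
      obtain ⟨ev, hev⟩ := RBimod.exists_isRightHom X Y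
      exact ⟨_, ev, RBimod.fdBimod_homRight hX hY, hev⟩)
  obtain ⟨form, hf, hs⟩ := h
  refine ⟨hc.isRCategory (hasPerfectPairings_fullSubcategory _ (fun X hX => ?_)
    (fun X hX => ?_)), hc⟩
  all_goals
    have : FiniteDimensional k X.X := hX
    have hd : fdBimod k R X.dual := inferInstanceAs (FiniteDimensional k (Module.Dual k X.X))
  · obtain ⟨f, hp⟩ := RBimod.exists_isPerfect_left (X := X) hf hs
    exact ⟨_, f, hd, hp⟩
  · obtain ⟨f, hp⟩ := RBimod.exists_isPerfect_right (X := X) hf hs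
    exact ⟨_, f, hd, hp⟩

/-! ### Truncated polynomial algebras: derivations and Frobenius form -/

section TruncatedPolynomials
variable {k : Type u} [Field k] {p n : ℕ}

namespace TruncPoly

lemma x_pow (i : Fin n) : x k p n i ^ p = 0 := by
  rw [x, ← map_pow]
  exact Ideal.Quotient.eq_zero_iff_mem.2 (Ideal.subset_span ⟨i, rfl⟩)

lemma mk_surjective : Function.Surjective (mk k p n) := Ideal.Quotient.mkₐ_surjective k _

@[elab_as_elim]
lemma induction {P : TruncPoly k p n → Prop} (C : ∀ c : k, P (algebraMap k _ c))
    (add : ∀ a b, P a → P b → P (a + b)) (mul_x : ∀ a i, P a → P (a * x k p n i))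
    (a : TruncPoly k p n) : P a := by
  obtain ⟨f, rfl⟩ := mk_surjective a
  induction f using MvPolynomial.induction_on with
  | C c => exact C c
  | add f g hf hg => rw [map_add]; exact add _ _ hf hg
  | mul_X f i hf => rw [map_mul]; exact mul_x _ i hf

lemma algHom_ext {A : Type*} [Semiring A] [Algebra k A] {f g : TruncPoly k p n →ₐ[k] A}
    (h : ∀ i, f (x k p n i) = g (x k p n i)) : f = g := by
  ext a
  induction a using TruncPoly.induction with
  | C c => rw [AlgHom.commutes, AlgHom.commutes]
  | add a b ha hb => rw [map_add, map_add, ha, hb]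
  | mul_x a i ha => rw [map_mul, map_mul, ha, h]

lemma derivation_ext {D E : Derivation k (TruncPoly k p n) (TruncPoly k p n)}
    (h : ∀ i, D (x k p n i) = E (x k p n i)) : D = E := by
  ext a
  induction a using TruncPoly.induction with
  | C c => rw [Derivation.map_algebraMap, Derivation.map_algebraMap]
  | add a b ha hb => rw [map_add, map_add, ha, hb]
  | mul_x a i ha => rw [Derivation.leibniz, Derivation.leibniz, ha, h]

/-- Algebra morphisms out of a truncated polynomial algebra are given by commuting nilpotent
elements of any algebra. -/
lemma exists_lift {A : Type u} [Ring A] [Algebra k A] (a : Fin n → A)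
    (hc : ∀ i j, a i * a j = a j * a i) (hp : ∀ i, a i ^ p = 0) :
    ∃ f : TruncPoly k p n →ₐ[k] A, ∀ i, f (x k p n i) = a i := by
  have hcomm : ∀ y ∈ Set.range a, ∀ z ∈ Set.range a, y * z = z * y := by
    rintro _ ⟨i, rfl⟩ _ ⟨j, rfl⟩
    exact hc i j
  -- Polynomials are evaluated in commutative algebras, so `A` is replaced by the subalgebra
  -- generated by the commuting elements `a i`.
  let _ : CommRing (Algebra.adjoin k (Set.range a)) :=
    { (inferInstance : Ring (Algebra.adjoin k (Set.range a))) with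
      mul_comm := (Algebra.isMulCommutative_adjoin k hcomm).is_comm.comm }
  let a' : Fin n → Algebra.adjoin k (Set.range a) :=
    fun i => ⟨a i, Algebra.subset_adjoin ⟨i, rfl⟩⟩
  let g : MvPolynomial (Fin n) k →ₐ[k] Algebra.adjoin k (Set.range a) := MvPolynomial.aeval a'
  have hg : ∀ f ∈ Ideal.span (Set.range fun i : Fin n =>
      (MvPolynomial.X i ^ p : MvPolynomial (Fin n) k)), g f = 0 := by
    intro f hf
    refine (Ideal.span_le (I := RingHom.ker g)).2 ?_ hf
    rintro _ ⟨i, rfl⟩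
    refine Subtype.ext ?_
    change ((g (MvPolynomial.X i ^ p) : Algebra.adjoin k (Set.range a)) : A) = 0
    rw [map_pow, MvPolynomial.aeval_X]
    exact hp i
  refine ⟨(Algebra.adjoin k (Set.range a)).val.comp (Ideal.Quotient.liftₐ _ g hg), fun i => ?_⟩
  exact congrArg Subtype.val (MvPolynomial.aeval_X a' i)

section Derivation

variable (k p n) in
/-- The Lie-Rinehart algebra of derivations of the truncated polynomial algebra. -/
abbrev Der : Type u := Derivation k (TruncPoly k p n) (TruncPoly k p n)

variable [CharP k p]

/-- In characteristic `p` the derivative of a `p`-th power vanishes, so partial derivatives preserve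
the ideal and descend to the quotient. -/
lemma mk_pderiv_eq_zero (i : Fin n) (f : MvPolynomial (Fin n) k) (hf : mk k p n f = 0) :
    mk k p n (MvPolynomial.pderiv i f) = 0 := by
  replace hf : f ∈ Ideal.span (Set.range fun i : Fin n =>
    (MvPolynomial.X i ^ p : MvPolynomial (Fin n) k)) := Ideal.Quotient.eq_zero_iff_mem.1 hf
  induction hf using Submodule.span_induction with
  | mem f hf =>
    obtain ⟨j, rfl⟩ := hf
    dsimp only
    have hp : (p : MvPolynomial (Fin n) k) = 0 := by
      rw [← map_natCast MvPolynomial.C, CharP.cast_eq_zero, map_zero]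
    rw [Derivation.leibniz_pow, ← Nat.cast_smul_eq_nsmul (MvPolynomial (Fin n) k), hp, zero_smul,
      map_zero]
  | zero => rw [map_zero, map_zero]
  | add f g _ _ hf hg => rw [map_add, map_add, hf, hg, add_zero]
  | smul a f hf' hf =>
    have h0 : mk k p n f = 0 := Ideal.Quotient.eq_zero_iff_mem.2 hf'
    rw [smul_eq_mul, Derivation.leibniz, map_add, smul_eq_mul, smul_eq_mul, map_mul, map_mul, hf,
      h0]
    simp

/-- The partial derivatives of the truncated polynomial algebra. -/
noncomputable def pderiv (i : Fin n) : Derivation k (TruncPoly k p n) (TruncPoly k p n) :=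
  Derivation.liftOfSurjective mk_surjective (mk_pderiv_eq_zero i)

lemma pderiv_x (i j : Fin n) : pderiv i (x k p n j) = if i = j then 1 else 0 := by
  have h := Derivation.liftOfSurjective_apply (mk_surjective (k := k) (p := p) (n := n))
    (mk_pderiv_eq_zero (k := k) (p := p) i) (MvPolynomial.X j)
  refine h.trans ?_
  rw [MvPolynomial.pderiv_X, Pi.single_apply]
  simp only [eq_comm (a := j)]
  split_ifs
  · exact map_one _
  · exact map_zero _

/-- A derivation is determined by its values on the generators. Thus the partial derivatives span
all derivations, which is why they suffice to generate the enveloping algebra over `R`. -/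
lemma derivation_eq_sum (D : Derivation k (TruncPoly k p n) (TruncPoly k p n)) :
    D = ∑ i, D (x k p n i) • pderiv i := by
  refine derivation_ext fun j => ?_
  rw [← Derivation.coeFnAddMonoidHom_apply (∑ i, _), map_sum, Finset.sum_apply]
  simp [pderiv_x]

lemma derivation_apply (D : Derivation k (TruncPoly k p n) (TruncPoly k p n))
    (r : TruncPoly k p n) : D r = ∑ i, D (x k p n i) * pderiv i r := by
  conv_lhs => rw [derivation_eq_sum D]
  rw [← Derivation.coeFnAddMonoidHom_apply (∑ i, _), map_sum, Finset.sum_apply]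
  rfl

lemma pderiv_lie (i j : Fin n) :
    ⁅(pderiv i : Der k p n), (pderiv j : Der k p n)⁆ = 0 := by
  refine derivation_ext fun l => ?_
  rw [Derivation.commutator_apply, pderiv_x (k := k) (p := p), pderiv_x (k := k) (p := p)]
  split_ifs <;> simp

end Derivation

section Form

/-- The ideal is generated by monomials, so membership is decided monomial by monomial: each one in
the support must be divisible by some `xᵢ ^ p`. -/
lemma mk_eq_zero_iff (f : MvPolynomial (Fin n) k) :
    mk k p n f = 0 ↔ ∀ m : Fin n →₀ ℕ, (∀ i, m i < p) → f.coeff m = 0 := by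
  have h := MvPolynomial.mem_ideal_span_monomial_image (x := f)
    (s := Set.range fun i : Fin n => Finsupp.single i p)
  have e : (fun s => MvPolynomial.monomial s (1 : k)) '' (Set.range fun i => Finsupp.single i p) =
      Set.range fun i : Fin n => (MvPolynomial.X i ^ p : MvPolynomial (Fin n) k) := by
    rw [← Set.range_comp]
    exact congrArg _ (funext fun i => MvPolynomial.X_pow_eq_monomial.symm)
  rw [e] at h
  refine Ideal.Quotient.eq_zero_iff_mem.trans (h.trans ⟨fun H m hm => ?_, fun H m hm => ?_⟩)
  · by_contra hne
    obtain ⟨_, ⟨i, rfl⟩, hi⟩ := H m (MvPolynomial.mem_support_iff.2 hne)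
    exact (hm i).not_ge (Finsupp.single_le_iff.1 hi)
  · by_contra! hne
    refine MvPolynomial.mem_support_iff.1 hm (H m fun i => ?_)
    by_contra! hi
    exact hne _ ⟨i, rfl⟩ (Finsupp.single_le_iff.2 hi)

/-- Extracting the coefficient of the top monomial is a Frobenius form. -/
lemma exists_isFrobeniusForm [hp : Fact p.Prime] : ∃ form : TruncPoly k p n →ₗ[k] k,
    (∀ f : MvPolynomial (Fin n) k, form (mk k p n f) =
      MvPolynomial.coeff (Finsupp.equivFunOnFinite.symm fun _ => p - 1) f) ∧
    IsFrobeniusForm form := by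
  let top : Fin n →₀ ℕ := Finsupp.equivFunOnFinite.symm fun _ => p - 1
  let I := Ideal.span (Set.range fun i : Fin n => (MvPolynomial.X i ^ p : MvPolynomial (Fin n) k))
  have h : I.restrictScalars k ≤ LinearMap.ker (MvPolynomial.lcoeff k top) := fun f hf =>
    (mk_eq_zero_iff f).1 (Ideal.Quotient.eq_zero_iff_mem.2 hf) top fun i =>
      Nat.sub_lt hp.out.pos one_pos
  let form : TruncPoly k p n →ₗ[k] k := (I.restrictScalars k).liftQ _ h ∘ₗ
    (Submodule.Quotient.restrictScalarsEquiv k I).symm.toLinearMap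
  have hform : ∀ f, form (mk k p n f) = f.coeff top := fun f => rfl
  refine ⟨form, hform, fun a ha => ?_⟩
  obtain ⟨f, rfl⟩ := mk_surjective a
  refine (mk_eq_zero_iff f).2 fun m hm => ?_
  -- Multiplication by the complementary monomial moves the coefficient at `m` to the top monomial.
  -- The truncated subtraction is exact, as `m i < p` gives `m ≤ top`.
  have h1 := ha (mk k p n (MvPolynomial.monomial (top - m) 1))
  have h2 : m + (top - m) = top := by
    ext i
    have h3 : top i = p - 1 := rfl
    have := hm i
    rw [Finsupp.add_apply, Finsupp.tsub_apply, h3]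
    omega
  rw [← map_mul, hform] at h1
  have h4 := MvPolynomial.coeff_mul_monomial m (top - m) (1 : k) f
  rwa [h2, h1, mul_one, eq_comm] at h4

lemma isSymmetricFrobenius (k : Type u) [Field k] (p n : ℕ) [Fact p.Prime] :
    IsSymmetricFrobenius k (TruncPoly k p n) := by
  obtain ⟨form, -, h⟩ := exists_isFrobeniusForm (k := k) (p := p) (n := n)
  exact ⟨form, h, fun x y => by rw [mul_comm]⟩

end Form
end TruncPoly
end TruncatedPolynomials

/-! ### The truncated Weyl algebra as an enveloping algebra -/

section WeylIso
variable {k : Type u} [Field k] {p n : ℕ}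

namespace WeylAlgebra

lemma x_pow (i : Fin n) : x k p n i ^ p = 0 := by
  have h := RingQuot.mkAlgHom_rel k (WeylRel.x_pow (k := k) (p := p) i)
  rwa [map_pow, map_zero] at h

lemma x_comm (i j : Fin n) : x k p n i * x k p n j = x k p n j * x k p n i := by
  have h := RingQuot.mkAlgHom_rel k (WeylRel.x_comm (k := k) (p := p) i j)
  rwa [map_mul, map_mul] at h

lemma d_comm (i j : Fin n) : d k p n i * d k p n j = d k p n j * d k p n i := by
  have h := RingQuot.mkAlgHom_rel k (WeylRel.d_comm (k := k) (p := p) i j)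
  rwa [map_mul, map_mul] at h

lemma d_mul_x (i j : Fin n) :
    d k p n i * x k p n j = x k p n j * d k p n i + if i = j then 1 else 0 := by
  have h := RingQuot.mkAlgHom_rel k (WeylRel.d_x (k := k) (p := p) i j)
  rw [map_sub, map_mul, map_mul, sub_eq_iff_eq_add'] at h
  refine h.trans (congrArg (x k p n j * d k p n i + ·) ?_)
  split_ifs
  · exact map_one _
  · exact map_zero _

lemma algHom_ext {A : Type*} [Semiring A] [Algebra k A] {f g : WeylAlgebra k p n →ₐ[k] A}
    (hx : ∀ i, f (x k p n i) = g (x k p n i)) (hd : ∀ i, f (d k p n i) = g (d k p n i)) :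
    f = g := by
  refine RingQuot.ringQuot_ext' k _ _ (FreeAlgebra.hom_ext (funext fun z => ?_))
  rcases z with i | i
  · exact hx i
  · exact hd i

lemma exists_lift {A : Type u} [Ring A] [Algebra k A] (a b : Fin n → A)
    (ha : ∀ i, a i ^ p = 0) (haa : ∀ i j, a i * a j = a j * a i)
    (hbb : ∀ i j, b i * b j = b j * b i)
    (hba : ∀ i j, b i * a j - a j * b i = if i = j then 1 else 0) :
    ∃ f : WeylAlgebra k p n →ₐ[k] A, ∀ i, f (x k p n i) = a i ∧ f (d k p n i) = b i := by
  let g : FreeAlgebra k (Fin n ⊕ Fin n) →ₐ[k] A := FreeAlgebra.lift k (Sum.elim a b)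
  have hl : ∀ i, g (FreeAlgebra.ι k (.inl i)) = a i := fun i => FreeAlgebra.lift_ι_apply _ _
  have hr : ∀ i, g (FreeAlgebra.ι k (.inr i)) = b i := fun i => FreeAlgebra.lift_ι_apply _ _
  have hg : ∀ ⦃y z⦄, WeylRel k p n y z → g y = g z := by
    intro y z h
    induction h with
    | x_pow i => rw [map_pow, hl, ha, map_zero]
    | x_comm i j => rw [map_mul, map_mul, hl, hl, haa]
    | d_comm i j => rw [map_mul, map_mul, hr, hr, hbb]
    | d_x i j =>
      rw [map_sub, map_mul, map_mul, hl, hr, hba]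
      split_ifs <;> simp
  refine ⟨RingQuot.liftAlgHom k ⟨g, hg⟩, fun i => ⟨?_, ?_⟩⟩
  · exact (RingQuot.liftAlgHom_mkAlgHom_apply k g hg _).trans (hl i)
  · exact (RingQuot.liftAlgHom_mkAlgHom_apply k g hg _).trans (hr i)

end WeylAlgebra

namespace Env
variable {R L : Type u} [CommRing R] [Algebra k R]
  [LieRing L] [LieAlgebra k L] [Module R L] [LieRingModule L R] [LieRinehartRing R L]
  [LieRinehartAlgebra k R L]

lemma algHom_ext {A : Type*} [Semiring A] [Algebra k A] {f g : Env k R L →ₐ[k] A}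
    (hb : ∀ r, f (base k R L r) = g (base k R L r)) (hl : ∀ y, f (lie k R L y) = g (lie k R L y)) :
    f = g := by
  refine RingQuot.ringQuot_ext' k _ _ (FreeAlgebra.hom_ext (funext fun z => ?_))
  rcases z with r | y
  · exact hb r
  · exact hl y

lemma exists_lift {A : Type u} [Ring A] [Algebra k A] (φ : R →ₐ[k] A) (v : L →ₗ[k] A)
    (hlie : ∀ y z, v ⁅y, z⁆ = v y * v z - v z * v y) (hsmul : ∀ r y, v (r • y) = φ r * v y)
    (hleib : ∀ y r, v y * φ r - φ r * v y = φ ⁅y, r⁆) :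
    ∃ f : Env k R L →ₐ[k] A, (∀ r, f (base k R L r) = φ r) ∧ ∀ y, f (lie k R L y) = v y := by
  let g : FreeAlgebra k (R ⊕ L) →ₐ[k] A := FreeAlgebra.lift k (Sum.elim φ v)
  have hl : ∀ i, g (FreeAlgebra.ι k (.inl i)) = φ i := fun i => FreeAlgebra.lift_ι_apply _ _
  have hr : ∀ i, g (FreeAlgebra.ι k (.inr i)) = v i := fun i => FreeAlgebra.lift_ι_apply _ _
  have hg : ∀ ⦃y z⦄, EnvRel k R L y z → g y = g z := by
    intro y z h
    induction h with
    | algebraMap c => rw [hl, AlgHom.commutes, AlgHom.commutes]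
    | add_left r s => rw [map_add, hl, hl, hl, map_add]
    | mul_left r s => rw [map_mul, hl, hl, hl, map_mul]
    | add_right y z => rw [map_add, hr, hr, hr, map_add]
    | smul_right c y => rw [map_smul, hr, hr, map_smul]
    | lie y z => rw [map_sub, map_mul, map_mul, hr, hr, hr, hlie]
    | smul r y => rw [map_mul, hr, hl, hr, hsmul]
    | leibniz y r => rw [map_sub, map_mul, map_mul, hl, hl, hr, hleib]
  refine ⟨RingQuot.liftAlgHom k ⟨g, hg⟩, fun r => ?_, fun y => ?_⟩
  · exact (RingQuot.liftAlgHom_mkAlgHom_apply k g hg _).trans (hl r)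
  · exact (RingQuot.liftAlgHom_mkAlgHom_apply k g hg _).trans (hr y)

end Env

namespace WeylAlgebra
variable [CharP k p]

/-- The commutator with `∂ᵢ` obeys the Leibniz rule, so the relations on the generators `xⱼ`
propagate to all of `R`. -/
lemma d_mul_base {φ : TruncPoly k p n →ₐ[k] WeylAlgebra k p n}
    (hφ : ∀ i, φ (TruncPoly.x k p n i) = x k p n i) (i : Fin n) (r : TruncPoly k p n) :
    d k p n i * φ r = φ r * d k p n i + φ (TruncPoly.pderiv i r) := by
  induction r using TruncPoly.induction with
  | C c =>
    rw [AlgHom.commutes, Derivation.map_algebraMap, map_zero, add_zero]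
    exact (Algebra.commutes c _).symm
  | add a b ha hb => simp only [map_add, mul_add, add_mul, ha, hb]; abel
  | mul_x a j ha =>
    have h : φ (TruncPoly.pderiv i (a * TruncPoly.x k p n j)) =
        φ a * (if i = j then 1 else 0) + φ (TruncPoly.pderiv i a) * φ (TruncPoly.x k p n j) := by
      rw [Derivation.leibniz, TruncPoly.pderiv_x, smul_eq_mul, smul_eq_mul, map_add φ, map_mul φ,
        mul_comm (TruncPoly.x k p n j), map_mul φ]
      split_ifs
      · rw [map_one φ]
      · rw [map_zero φ]
    rw [h, map_mul φ, ← mul_assoc, ha, add_mul, mul_assoc (φ a), hφ, d_mul_x, mul_add, mul_assoc,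
      add_assoc]

lemma exists_toEnv : ∃ f : WeylAlgebra k p n →ₐ[k] Env k (TruncPoly k p n) (TruncPoly.Der k p n),
    ∀ i, f (x k p n i) = Env.base k _ _ (TruncPoly.x k p n i) ∧
      f (d k p n i) = Env.lie k _ (TruncPoly.Der k p n) (TruncPoly.pderiv i) :=
  exists_lift _ _
    (fun i => by rw [← map_pow (Env.base k _ (TruncPoly.Der k p n)), TruncPoly.x_pow, map_zero])
    (fun i j => by
      rw [← map_mul (Env.base k _ (TruncPoly.Der k p n)),
        ← map_mul (Env.base k _ (TruncPoly.Der k p n)), mul_comm])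
    (fun i j => by rw [← sub_eq_zero, ← Env.lie_lie, TruncPoly.pderiv_lie, map_zero])
    (fun i j => by
      rw [Env.lie_mul_base, add_sub_cancel_left, Derivation.bracket_eq_fun, TruncPoly.pderiv_x]
      split_ifs
      · exact map_one _
      · exact map_zero _)

/-- The image of a derivation is forced by `TruncPoly.derivation_eq_sum`; the substance is that this
assignment respects brackets. The formula uses the restriction of `g` to `R`, so the auxiliary
morphism `φ` does not appear in the statement. -/
lemma exists_ofEnv : ∃ g : Env k (TruncPoly k p n) (TruncPoly.Der k p n) →ₐ[k] WeylAlgebra k p n,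
    (∀ i, g (Env.base k _ _ (TruncPoly.x k p n i)) = x k p n i) ∧
    ∀ D, g (Env.lie k _ _ D) =
      ∑ i, g (Env.base k _ _ (D (TruncPoly.x k p n i))) * d k p n i := by
  obtain ⟨φ, hφ⟩ := TruncPoly.exists_lift (k := k) (p := p) (x k p n) x_comm x_pow
  have hcomm : ∀ r s, φ r * φ s = φ s * φ r := fun r s => by
    rw [← map_mul φ, ← map_mul φ, mul_comm]
  let v : TruncPoly.Der k p n →ₗ[k] WeylAlgebra k p n :=
    { toFun := fun D => ∑ i, φ (D (TruncPoly.x k p n i)) * d k p n i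
      map_add' := fun D E => by
        simp only [Derivation.add_apply, map_add φ, add_mul, Finset.sum_add_distrib]
      map_smul' := fun c D => by
        simp only [Derivation.smul_apply, map_smul φ, smul_mul_assoc, Finset.smul_sum,
          RingHom.id_apply] }
  have hv : ∀ D, v D = ∑ i, φ (D (TruncPoly.x k p n i)) * d k p n i := fun D => rfl
  have hleib : ∀ D r, v D * φ r = φ r * v D + φ (D r) := fun D r => by
    rw [hv, TruncPoly.derivation_apply D r, map_sum, Finset.sum_mul, Finset.mul_sum,
      ← Finset.sum_add_distrib]
    refine Finset.sum_congr rfl fun i _ => ?_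
    rw [mul_assoc, d_mul_base hφ, mul_add, ← mul_assoc, ← mul_assoc, hcomm r, map_mul φ]
  -- The product splits into a second-order and a first-order part. The second-order part is
  -- symmetric in `D` and `E`, since the coefficients commute and so do the `∂ᵢ`; it cancels in the
  -- commutator and leaves the image of `⁅D, E⁆`.
  have hmul : ∀ D E, v D * v E = ∑ j, ∑ i, φ (E (TruncPoly.x k p n j)) *
      φ (D (TruncPoly.x k p n i)) * (d k p n i * d k p n j) +
      ∑ j, φ (D (E (TruncPoly.x k p n j))) * d k p n j := fun D E => by
    rw [hv E, Finset.mul_sum, ← Finset.sum_add_distrib]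
    refine Finset.sum_congr rfl fun j _ => ?_
    rw [← mul_assoc, hleib, add_mul, hv, Finset.mul_sum, Finset.sum_mul]
    simp only [mul_assoc]
  obtain ⟨g, hg₁, hg₂⟩ := Env.exists_lift (L := TruncPoly.Der k p n) φ v
    (fun D E => by
      have hsymm : ∑ j, ∑ i, φ (E (TruncPoly.x k p n j)) * φ (D (TruncPoly.x k p n i)) *
          (d k p n i * d k p n j) = ∑ j, ∑ i, φ (D (TruncPoly.x k p n j)) *
          φ (E (TruncPoly.x k p n i)) * (d k p n i * d k p n j) := by
        rw [Finset.sum_comm]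
        refine Finset.sum_congr rfl fun i _ => Finset.sum_congr rfl fun j _ => ?_
        rw [hcomm, d_comm]
      rw [hmul, hmul, hsymm, add_sub_add_left_eq_sub, hv, ← Finset.sum_sub_distrib]
      refine Finset.sum_congr rfl fun i _ => ?_
      rw [Derivation.commutator_apply, map_sub φ, sub_mul])
    (fun r D => by
      rw [hv, hv, Finset.mul_sum]
      refine Finset.sum_congr rfl fun i _ => ?_
      rw [Derivation.smul_apply, smul_eq_mul, map_mul φ, mul_assoc])
    (fun D r => by rw [hleib, add_sub_cancel_left, Derivation.bracket_eq_fun])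
  exact ⟨g, fun i => (hg₁ _).trans (hφ i), fun D => by simp only [hg₁, hg₂, hv]⟩

/-- The truncated modular Weyl algebra is the enveloping algebra of the derivations of the
truncated polynomial algebra. -/
theorem exists_algEquiv : ∃ e : WeylAlgebra k p n ≃ₐ[k]
    Env k (TruncPoly k p n) (Derivation k (TruncPoly k p n) (TruncPoly k p n)),
    ∀ i, e (x k p n i) = Env.base k _ _ (TruncPoly.x k p n i) ∧
      e (d k p n i) = Env.lie k _ _ (TruncPoly.pderiv i) := by
  obtain ⟨f, hf⟩ := exists_toEnv (k := k) (p := p) (n := n)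
  obtain ⟨g, hg₁, hg₂⟩ := exists_ofEnv (k := k) (p := p) (n := n)
  -- Both sides are algebra morphisms in `r`, so it suffices to compare them on the generators `xᵢ`.
  have h : ∀ r, f (g (Env.base k _ _ r)) = Env.base k _ _ r := fun r =>
    DFunLike.congr_fun (f := (f.comp g).comp (Env.base k _ (TruncPoly.Der k p n)))
      (TruncPoly.algHom_ext fun i => (congrArg f (hg₁ i)).trans (hf i).1) r
  refine ⟨AlgEquiv.ofAlgHom f g (Env.algHom_ext h fun D => ?_)
    (algHom_ext (fun i => ?_) fun i => ?_), hf⟩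
  · rw [AlgHom.comp_apply, hg₂, map_sum, AlgHom.id_apply]
    conv_rhs => rw [TruncPoly.derivation_eq_sum D, map_sum]
    refine Finset.sum_congr rfl fun i _ => ?_
    rw [map_mul f, h, (hf i).2, Env.lie_smul]
  · rw [AlgHom.comp_apply, (hf i).1, hg₁, AlgHom.id_apply]
  -- As `∂ᵢ(xⱼ) = δᵢⱼ`, the sum that represents the image of `∂ᵢ` collapses to one term.
  · rw [AlgHom.comp_apply, (hf i).2, hg₂, AlgHom.id_apply, Finset.sum_eq_single i,
      TruncPoly.pderiv_x, if_pos rfl, map_one (Env.base k _ _), map_one g, one_mul]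
    · intro j _ hj
      rw [TruncPoly.pderiv_x, if_neg hj.symm, map_zero (Env.base k _ _), map_zero g, zero_mul]
    · exact fun h => absurd (Finset.mem_univ i) h

end WeylAlgebra
end WeylIso
end HopfGV

theorem mainTheorem12 :
    -- Hopf algebroids over symmetric Frobenius algebras
    (∀ (k R : Type u) [Field k] [Ring R] [Algebra k R] [FiniteDimensional k R],
      HopfGV.IsSymmetricFrobenius k R → ∀ B : HopfGV.HopfAlgebroid k R,
        HopfGV.IsRCategory B.FDMod ∧ HopfGV.IsClosedFunctor B.fdForget) ∧
    -- Hopf algebroids with commutative base over commutative Frobenius algebras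
    (∀ (k R : Type u) [Field k] [CommRing R] [Algebra k R] [FiniteDimensional k R],
      HopfGV.IsSymmetricFrobenius k R → ∀ B : HopfGV.CommHopfAlgebroid k R,
        HopfGV.IsRCategory B.FDMod ∧ HopfGV.IsClosedFunctor B.fdForget) ∧
    -- enveloping algebras of Lie-Rinehart algebras
    (∀ (k R L : Type u) [Field k] [CommRing R] [Algebra k R] [FiniteDimensional k R]
      [LieRing L] [LieAlgebra k L] [Module R L] [LieRingModule L R] [LieRinehartRing R L]
      [LieRinehartAlgebra k R L],
      HopfGV.IsSymmetricFrobenius k R →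
        HopfGV.IsRCategory (HopfGV.Env.FDMod k R L) ∧
        HopfGV.IsClosedFunctor (HopfGV.Env.fdForget k R L)) ∧
    -- truncated modular Weyl algebras
    (∀ (k : Type u) [Field k] (p n : ℕ) [Fact p.Prime] [CharP k p],
      (∃ form : HopfGV.TruncPoly k p n →ₗ[k] k,
        (∀ f : MvPolynomial (Fin n) k, form (HopfGV.TruncPoly.mk k p n f) =
          MvPolynomial.coeff (Finsupp.equivFunOnFinite.symm fun _ => p - 1) f) ∧
        HopfGV.IsFrobeniusForm form) ∧
      (∃ d : Fin n → Derivation k (HopfGV.TruncPoly k p n) (HopfGV.TruncPoly k p n),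
        (∀ i j, d i (HopfGV.TruncPoly.x k p n j) = if i = j then 1 else 0) ∧
        ∃ e : HopfGV.WeylAlgebra k p n ≃ₐ[k]
            HopfGV.Env k (HopfGV.TruncPoly k p n)
              (Derivation k (HopfGV.TruncPoly k p n) (HopfGV.TruncPoly k p n)),
          ∀ i, e (HopfGV.WeylAlgebra.x k p n i) =
              HopfGV.Env.base k _ _ (HopfGV.TruncPoly.x k p n i) ∧
            e (HopfGV.WeylAlgebra.d k p n i) = HopfGV.Env.lie k _ _ (d i)) ∧
      HopfGV.IsRCategory (HopfGV.Env.FDMod k (HopfGV.TruncPoly k p n)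
        (Derivation k (HopfGV.TruncPoly k p n) (HopfGV.TruncPoly k p n))) ∧
      HopfGV.IsClosedFunctor (HopfGV.Env.fdForget k (HopfGV.TruncPoly k p n)
        (Derivation k (HopfGV.TruncPoly k p n) (HopfGV.TruncPoly k p n)))) := by
  exact
    ⟨fun k R _ _ _ _ h B => B.isRCategory_and_isClosedFunctor h,
    fun k R _ _ _ _ h B => B.isRCategory_and_isClosedFunctor h,
    fun k R L _ _ _ _ _ _ _ _ _ _ h => HopfGV.Env.isRCategory_and_isClosedFunctor h,
    fun k _ p n _ _ => ⟨HopfGV.TruncPoly.exists_isFrobeniusForm,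
      ⟨HopfGV.TruncPoly.pderiv, HopfGV.TruncPoly.pderiv_x, HopfGV.WeylAlgebra.exists_algEquiv⟩,
      HopfGV.Env.isRCategory_and_isClosedFunctor
        (HopfGV.TruncPoly.isSymmetricFrobenius k p n)⟩⟩
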